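/- Let $p\ge 1$ and let $(\Omega,\mathcal A,\mathbb P)$ be a probability space. Let $a=(a_0,\dots,a_p)$, $b=(b_0,\dots,b_p)\in\mathbb R^{p+1}$, let $(X_n)_{n\ge1}$ be real random variables and $(\varepsilon_n)$ a noise such that for all $n\ge 2^{p-1}$ $$X_{2n}=a_0+\sum_{k=1}^p a_kX_{[n/2^{k-1}]}+\varepsilon_{2n},\qquad X_{2n+1}=b_0+\sum_{k=1}^p b_kX_{[n/2^{k-1}]}+\varepsilon_{2n+1},$$ where the initial states satisfy $\mathbb E[X_k^8]<\infty$ for $1\le k\le 2^p-1$. Let $A$ and $B$ be the $p\times p$ companion matrices with first rows $(a_1,\dots,a_p)$ and $(b_1,\dots,b_p)$, ones just below the diagonal and zeros elsewhere, and assume that, for some norm on $\mathbb R^p$ and the operator norm it induces, $\max\{\|A\|,\|B\|\}<1$. Write $\mathbb G_n=\{2^n,\dots,2^{n+1}-1\}$, $\mathbb T_n=\bigcup_{k\le n}\mathbb G_k$, $\mathbb T_{n,q}=\{k\in\mathbb T_n: k\ge 2^q\}$, $|\mathbb T_n|=2^{n+1}-1$ and $\mathcal F_n=\sigma(X_k,\,k\in\mathbb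 T_n)$. Assume: (H.1) there is $\sigma^2>0$ such that for all $n\ge p-1$ and $k\in\mathbb G_{n+1}$, $\varepsilon_k\in L^2$, $\mathbb E[\varepsilon_k\mid\mathcal F_n]=0$ and $\mathbb E[\varepsilon_k^2\mid\mathcal F_n]=\sigma^2$ a.s.; (H.2) there is $\rho$ with $|\rho|<\sigma^2$ such that for all $n\ge p-1$ and all different $k,l\in\mathbb G_{n+1}$ with $[k/2]=[l/2]$, $\mathbb E[\varepsilon_k\varepsilon_l\mid\mathcal F_n]=\rho$ a.s., and for all $n\ge p-1$ the pairs $(\varepsilon_{2k},\varepsilon_{2k+1})$, $k\in\mathbb G_n$, are (mutually) conditionally independent given $\mathcal F_n$; (H.3) for all $n\ge p-1$ and $k\in\mathbb G_{n+1}$, $\varepsilon_k\in L^4$, and $\sup_{n\ge p-1}\sup_{k\in\mathbb G_{n+1}}\mathbb E[\varepsilon_k^4\mid\mathcal F_n]<\infty$ a.s. Let $Y_k=(1,X_k,X_{[k/2]},\dots,X_{[k/2^{p-1}]})^t$, $Z_k=(X_{2k},X_{2k+1})^t$, $S_n=\sum_{k\in\mathbb T_{n,p-1}}Y_kY_k^t$,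 and let $\theta$ be the $(p+1)\times2$ matrix with columns $a$ and $b$. For $n\ge p$ let the least-squares estimator $\widehat\theta_n$ be the minimizer over $(p+1)\times2$ matrices $\eta$ of $\frac12\sum_{k\in\mathbb T_{n-1,p-1}}\|Z_k-\eta^tY_k\|^2$ whenever $S_{n-1}$ is invertible, that is $\widehat\theta_n=S_{n-1}^{-1}\sum_{k\in\mathbb T_{n-1,p-1}}Y_kZ_k^t$; when $S_{n-1}$ is singular, or $n<p$, the value of $\widehat\theta_n$ is arbitrary. Matrices of size $(p+1)\times 2$ are identified with vectors of $\mathbb R^{2(p+1)}$ by stacking their columns, and $\|\cdot\|$ is then the Euclidean norm. Then $\widehat\theta_n\to\theta$ a.s., with $$\|\widehat\theta_n-\theta\|^2=\mathcal O\left(\frac{\log|\mathbb T_{n-1}|}{|\mathbb T_{n-1}|}\right)\quad\text{a.s.}$$ Moreover, put $\bar a=\frac12(a_0+b_0)$, $\bar A=\frac12(A+B)$, $e_1=(1,0,\dots,0)^t\in\mathbb R^p$, $\lambda=\bar a(I_p-\bar A)^{-1}e_1$ and $$T=\Big(\sigma^2+\frac{a_0^2+b_0^2}2\Big)e_1e_1^t+\frac12\Big(a_0(A\lambda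 e_1^t+e_1\lambda^tA^t)+b_0(B\lambda e_1^t+e_1\lambda^tB^t)\Big).$$ The equation $\ell=T+\frac12(A\ell A^t+B\ell B^t)$ has a unique solution $\ell\in\mathbb R^{p\times p}$, the matrix $L=\begin{pmatrix}1&\lambda^t\\ \lambda&\ell\end{pmatrix}$ is positive definite, and with $\Lambda=I_2\otimes L$ $$\lim_{n\to\infty}\frac1n\sum_{k=1}^n|\mathbb T_{k-1}|\,(\widehat\theta_k-\theta)^t\Lambda(\widehat\theta_k-\theta)=2(p+1)\sigma^2\quad\text{a.s.}$$ -/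

import Mathlib

open MeasureTheory ProbabilityTheory Filter Asymptotics
open scoped Matrix Kronecker Topology

namespace BAR

noncomputable section

/-! ### The binary tree -/

/-- The `n`-th generation `{2^n, …, 2^(n+1) - 1}`. -/
def gen (n : ℕ) : Finset ℕ := Finset.Ico (2 ^ n) (2 ^ (n + 1))

/-- The sub-tree `{1, …, 2^(n+1) - 1}` of all individuals up to the `n`-th generation. -/
def tree (n : ℕ) : Finset ℕ := Finset.Ico 1 (2 ^ (n + 1))

/-- The individuals `k ≥ 2^q` of the sub-tree `tree n`. -/
def treeFrom (n q : ℕ) : Finset ℕ := (tree n).filter (fun k => 2 ^ q ≤ k)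

/-! ### The parameters -/

/-- The companion matrix with first row `(c₁, …, c_p)` and ones below the diagonal, for the
coefficients `c = (c₀, c₁, …, c_p)` (the intercept `c₀` does not enter). -/
def companion {p : ℕ} (c : Fin (p + 1) → ℝ) : Matrix (Fin p) (Fin p) ℝ :=
  Matrix.of fun i j => if (i : ℕ) = 0 then c j.succ else if (i : ℕ) = (j : ℕ) + 1 then 1 else 0

/-- The first vector of the canonical basis of `ℝ^p`. -/
def e₁ (p : ℕ) : Fin p → ℝ := fun i => if (i : ℕ) = 0 then 1 else 0

/-- The `(p+1) × 2` parameter matrix with columns `a` and `b`. -/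
def theta {p : ℕ} (a b : Fin (p + 1) → ℝ) : Matrix (Fin (p + 1)) (Fin 2) ℝ :=
  Matrix.of fun i => ![a i, b i]

/-- `A` and `B` are contractions for the operator norm `‖M‖ = sup {N (M u) : N u = 1}` induced by
a common norm `N` on `ℝ^p`, that is `max ‖A‖ ‖B‖ < 1`. (The Euclidean operator norm of a
companion matrix of size `p ≥ 2` is never `< 1`, so the norm has to be left free.) -/
def Contracting {p : ℕ} (A B : Matrix (Fin p) (Fin p) ℝ) : Prop :=
  ∃ N : Seminorm ℝ (Fin p → ℝ), (∀ u, N u = 0 → u = 0) ∧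
    ∃ β : ℝ, β < 1 ∧ ∀ u, N (A *ᵥ u) ≤ β * N u ∧ N (B *ᵥ u) ≤ β * N u

/-! ### The process -/

section Model

variable {Ω : Type*}

/-- The recursion of the asymmetric bifurcating autoregressive process of order `p`. -/
def IsProcess {p : ℕ} (a b : Fin (p + 1) → ℝ) (X ε : ℕ → Ω → ℝ) : Prop :=
  ∀ n, 2 ^ (p - 1) ≤ n → ∀ ω,
    X (2 * n) ω = a 0 + ∑ k : Fin p, a k.succ * X (n / 2 ^ (k : ℕ)) ω + ε (2 * n) ω ∧
    X (2 * n + 1) ω = b 0 + ∑ k : Fin p, b k.succ * X (n / 2 ^ (k : ℕ)) ω + ε (2 * n + 1) ω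

/-- The `σ`-algebra generated by all individuals up to the `n`-th generation. -/
@[reducible] def sigmaAlg (X : ℕ → Ω → ℝ) (n : ℕ) : MeasurableSpace Ω :=
  ⨆ k ∈ tree n, MeasurableSpace.comap (X k) inferInstance

/-- `Y_k = (1, X_k, X_[k/2], …, X_[k/2^(p-1)])`. -/
def regressor (X : ℕ → Ω → ℝ) (p k : ℕ) (ω : Ω) : Fin (p + 1) → ℝ :=
  Matrix.vecCons 1 fun i : Fin p => X (k / 2 ^ (i : ℕ)) ω

/-- `Z_k = (X_{2k}, X_{2k+1})`. -/
def response (X : ℕ → Ω → ℝ) (k : ℕ) (ω : Ω) : Fin 2 → ℝ :=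
  ![X (2 * k) ω, X (2 * k + 1) ω]

/-- `S_n = ∑ Y_k Y_kᵗ`, over the individuals `k ≥ 2^(p-1)` up to generation `n`. -/
def gram (X : ℕ → Ω → ℝ) (p n : ℕ) (ω : Ω) : Matrix (Fin (p + 1)) (Fin (p + 1)) ℝ :=
  ∑ k ∈ treeFrom n (p - 1), Matrix.vecMulVec (regressor X p k ω) (regressor X p k ω)

/-- The least-squares criterion `½ ∑ ‖Z_k - ηᵗ Y_k‖²` (Euclidean norm of `ℝ²`), over the
individuals `k ≥ 2^(p-1)` up to generation `n - 1`. -/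
def lsCriterion (X : ℕ → Ω → ℝ) (p n : ℕ) (ω : Ω) (η : Matrix (Fin (p + 1)) (Fin 2) ℝ) : ℝ :=
  1 / 2 * ∑ k ∈ treeFrom (n - 1) (p - 1),
    ∑ j : Fin 2, (response X k ω j - (ηᵀ *ᵥ regressor X p k ω) j) ^ 2

/-- `θh` is the least-squares estimator: for `n ≥ p` it minimizes the criterion whenever `S_{n-1}`
is invertible (the minimizer is then unique). Its value for singular `S_{n-1}`, or for `n < p`, is
left free, so that every convention for these cases is covered. -/
def IsLSEstimator (X : ℕ → Ω → ℝ) (p : ℕ) (θh : ℕ → Ω → Matrix (Fin (p + 1)) (Fin 2) ℝ) : Prop :=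
  ∀ n, p ≤ n → ∀ ω, IsUnit (gram X p (n - 1) ω) →
    ∀ η, lsCriterion X p n ω (θh n ω) ≤ lsCriterion X p n ω η

/-! ### The moment hypotheses on the noise -/

variable [MeasurableSpace Ω]

/-- Conditionally centred noise with constant conditional variance `σ2 > 0`. -/
def NoiseVariance (μ : Measure Ω) (p : ℕ) (X ε : ℕ → Ω → ℝ) (σ2 : ℝ) : Prop :=
  0 < σ2 ∧ ∀ n, p - 1 ≤ n → ∀ k ∈ gen (n + 1),
    MemLp (ε k) 2 μ ∧
    μ[ε k | sigmaAlg X n] =ᵐ[μ] (fun _ => 0) ∧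
    μ[fun ω => ε k ω ^ 2 | sigmaAlg X n] =ᵐ[μ] (fun _ => σ2)

/-- The finite family `(f i)`, `i ∈ s`, is (mutually) conditionally independent given `m`. -/
def CondIndepFamily {ι β : Type*} [MeasurableSpace β] (μ : Measure Ω) (m : MeasurableSpace Ω)
    (s : Finset ι) (f : ι → Ω → β) : Prop :=
  ∀ t ⊆ s, ∀ D : ι → Set β, (∀ i ∈ t, MeasurableSet (D i)) →
    μ⟦⋂ i ∈ t, f i ⁻¹' D i | m⟧ =ᵐ[μ] fun ω => ∏ i ∈ t, (μ⟦f i ⁻¹' D i | m⟧) ω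

/-- Constant conditional covariance `ρ`, `|ρ| < σ2`, for the noises of two sisters, and
conditional independence of the noise pairs `(ε_{2k}, ε_{2k+1})` of the different mothers `k` of
generation `n`, given the first `n` generations. -/
def NoiseCovariance (μ : Measure Ω) (p : ℕ) (X ε : ℕ → Ω → ℝ) (σ2 ρ : ℝ) : Prop :=
  |ρ| < σ2 ∧ ∀ n, p - 1 ≤ n →
    (∀ k ∈ gen (n + 1), ∀ l ∈ gen (n + 1), k ≠ l → k / 2 = l / 2 →
      μ[fun ω => ε k ω * ε l ω | sigmaAlg X n] =ᵐ[μ] (fun _ => ρ)) ∧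
    CondIndepFamily μ (sigmaAlg X n) (gen n) (fun k ω => (ε (2 * k) ω, ε (2 * k + 1) ω))

/-- Fourth moments, with almost surely bounded conditional fourth moments. -/
def NoiseFourthMoment (μ : Measure Ω) (p : ℕ) (X ε : ℕ → Ω → ℝ) : Prop :=
  (∀ n, p - 1 ≤ n → ∀ k ∈ gen (n + 1), MemLp (ε k) 4 μ) ∧
  ∀ᵐ ω ∂μ, ∃ C : ℝ, ∀ n, p - 1 ≤ n → ∀ k ∈ gen (n + 1),
    (μ[fun ω' => ε k ω' ^ 4 | sigmaAlg X n]) ω ≤ C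

end Model

/-! ### The limiting matrix -/

/-- `λ = ā (I - Ā)⁻¹ e₁` with `ā = (a₀ + b₀) / 2` and `Ā = (A + B) / 2`. -/
def limMean {p : ℕ} (a b : Fin (p + 1) → ℝ) : Fin p → ℝ :=
  ((a 0 + b 0) / 2) • ((1 - (1 / 2 : ℝ) • (companion a + companion b))⁻¹ *ᵥ e₁ p)

/-- `T = (σ² + (a₀² + b₀²)/2) e₁e₁ᵗ + ½ (a₀ (Aλe₁ᵗ + e₁λᵗAᵗ) + b₀ (Bλe₁ᵗ + e₁λᵗBᵗ))`. -/
def limSource {p : ℕ} (a b : Fin (p + 1) → ℝ) (σ2 : ℝ) : Matrix (Fin p) (Fin p) ℝ :=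
  (σ2 + (a 0 ^ 2 + b 0 ^ 2) / 2) • Matrix.vecMulVec (e₁ p) (e₁ p) +
    (1 / 2 : ℝ) •
      (a 0 • (Matrix.vecMulVec (companion a *ᵥ limMean a b) (e₁ p) +
          Matrix.vecMulVec (e₁ p) (companion a *ᵥ limMean a b)) +
        b 0 • (Matrix.vecMulVec (companion b *ᵥ limMean a b) (e₁ p) +
          Matrix.vecMulVec (e₁ p) (companion b *ᵥ limMean a b)))

/-- The equation `M = T + ½ (A M Aᵗ + B M Bᵗ)`. -/
def LimEquation {p : ℕ} (a b : Fin (p + 1) → ℝ) (σ2 : ℝ) (M : Matrix (Fin p) (Fin p) ℝ) : Prop :=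
  M = limSource a b σ2 +
    (1 / 2 : ℝ) • (companion a * M * (companion a)ᵀ + companion b * M * (companion b)ᵀ)

/-- The block matrix `L` with first row `(1, λᵗ)` and first column `(1, λ)`, and lower right
block `M`. -/
def limMatrix {p : ℕ} (a b : Fin (p + 1) → ℝ) (M : Matrix (Fin p) (Fin p) ℝ) :
    Matrix (Fin (p + 1)) (Fin (p + 1)) ℝ :=
  Matrix.of (Matrix.vecCons (Matrix.vecCons 1 (limMean a b))
    fun i => Matrix.vecCons (limMean a b i) (M i))

end

end BAR

/-!
Write `M_n = ∑_{k < 2ⁿ} Y_k (ε_{2k}, ε_{2k+1})`, the sum running over mothers `k ≥ 2^(p-1)`. By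
the normal equations (`IsModel.gram_mul_error`) the error of the estimator is `S_{n-1}⁻¹ M_n` as
soon as the Gram matrix `S_{n-1}` is invertible. The theorem follows from two facts: `2⁻ⁿ S_{n-1}`
converges almost surely to the positive definite matrix `L`, and the products of the entries of
`M_n` obey the quadratic strong law `1/n ∑_k 2⁻ᵏ M_k^{rc} M_k^{sc} → σ² L_{rs}` for each column
`c`. Linear algebra (`error_limits`) then turns the second fact into the quadratic strong law for
the error, with the constant `σ² ∑_c tr (L⁻¹ L) = 2 (p + 1) σ²`, and, since a sequence with
convergent Cesàro means is `o(n)`, into the rate `o(n / 2ⁿ)` for the squared error, which gives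
consistency too.

*Linear time.* The generation-wise hypotheses on the noise are transported to the filtration
`σ(X_1, …, X_{2j-1})`, `j ∈ ℕ`, in which the mothers produce their offspring one after the other.
This is where the conditional independence of the pairs of sisters enters
(`condExp_sup_of_condIndepFamily`, `IsModel.condExp_eq`, `IsModel.isNoise`). In linear time all
fluctuations are sums of square integrable martingale differences, controlled by orthogonality, by
the convergence of `L²`-bounded martingales and by Kronecker's lemma
(`IsMDiff.ae_tendsto_gen_average`, `IsMDiff.ae_tendsto_gen_cesaro`).

*Gram matrices.* The vector of an individual and its `p - 1` nearest ancestors follows an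
autoregression driven by the companion matrices. The averages over the generations of this vector
and of its second order products satisfy affine recursions, perturbed by averages of the noise
that vanish in the limit. The linear parts `½ (A + B)` and `ℓ ↦ ½ (A ℓ Aᵗ + B ℓ Bᵗ)` are
contractions, the latter for the norm of `ℓ` as a map from the dual space (`MatBound`), so the
averages converge to the unique fixed points (`IsContraction.existsUnique_matrix`,
`IsContraction.tendsto_genAvg`, `IsModel.ae_tendsto_gram`). The quadratic form of `L` reproduces
itself along the two types of offspring plus `σ² x_1²` (`limForm_eq`); at a zero of the form the
first coordinate therefore vanishes, and as the transposed companion matrix then acts as the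
shift, all coordinates do (`limForm_eq_zero`).

*Quadratic strong law.* For two scalar transforms `M`, `M'` of the noise by regressors `U`, `V`,
the normalized products `P_k = 2⁻ᵏ M_{2ᵏ} M'_{2ᵏ}` satisfy `P_{k+1} = P_k / 2 + r_k`, where `r_k`
collects the cross terms `M_j V_j η_j` and `M'_j U_j η_j` and the diagonal terms `U_j V_j η_j²` of
generation `k`. In Cesàro mean the cross terms vanish and the squared noise may be replaced by its
variance, so `r_k` averages to `σ² L_{rs} / 2` and `P_k` to `σ² L_{rs}` (`IsNoise.quadratic_law`,
`tendsto_cesaro_of_recursion`). The second moments needed for this are available after truncating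
the regressors and the conditional fourth moments of the noise at a deterministic level; the
truncation is inactive at almost every `ω` once the level is large.
-/

namespace BAR

set_option linter.unusedSectionVars false

/-! ### Deterministic limit lemmas -/

/-- A perturbed contraction: the perturbation vanishes, so the sequence does. -/
lemma tendsto_zero_of_le_mul_add {x s : ℕ → ℝ} {α : ℝ} (n₀ : ℕ) (hα0 : 0 ≤ α) (hα1 : α < 1)
    (hx : ∀ n, 0 ≤ x n) (hs : Tendsto s atTop (𝓝 0))
    (h : ∀ n, n₀ ≤ n → x (n + 1) ≤ α * x n + s n) : Tendsto x atTop (𝓝 0) := by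
  rw [Metric.tendsto_atTop]
  intro e he
  have he2 : 0 < (1 - α) * (e / 2) := mul_pos (by linarith) (by linarith)
  obtain ⟨n₁, hn₁⟩ := (Metric.tendsto_atTop.1 hs) _ he2
  set N := max n₀ n₁
  have key : ∀ m, x (N + m) ≤ α ^ m * x N + e / 2 := by
    intro m
    induction m with
    | zero => simp; linarith
    | succ m ih =>
      have h1 := h (N + m) (le_trans (le_max_left _ _) (Nat.le_add_right _ _))
      have h2 := hn₁ (N + m) (le_trans (le_max_right _ _) (Nat.le_add_right _ _))
      rw [Real.dist_eq, sub_zero] at h2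
      have h3 := (abs_lt.1 h2).2
      have h4 := mul_le_mul_of_nonneg_left ih hα0
      have : x (N + (m + 1)) ≤ α * (α ^ m * x N + e / 2) + (1 - α) * (e / 2) := by
        rw [← add_assoc]; linarith
      calc _ ≤ _ := this
        _ = _ := by ring
  have ht : Tendsto (fun m => α ^ m * x N) atTop (𝓝 0) := by
    simpa using (tendsto_pow_atTop_nhds_zero_of_lt_one hα0 hα1).mul_const (x N)
  obtain ⟨m₁, hm₁⟩ := (Metric.tendsto_atTop.1 ht) (e / 2) (by linarith)
  refine ⟨N + m₁, fun n hn => ?_⟩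
  obtain ⟨m, rfl⟩ := Nat.exists_eq_add_of_le (le_trans (Nat.le_add_right N m₁) hn)
  have h1 := hm₁ m (by omega)
  rw [Real.dist_eq, sub_zero] at h1 ⊢
  rw [abs_of_nonneg (hx _)]
  linarith [key m, (abs_lt.1 h1).2]

/-- Kronecker's lemma for the weights `k + 1`. -/
lemma tendsto_cesaro_of_tendsto_sum_div {d : ℕ → ℝ} {c : ℝ}
    (h : Tendsto (fun n => ∑ k ∈ Finset.range n, d k / ((k : ℝ) + 1)) atTop (𝓝 c)) :
    Tendsto (fun n : ℕ => (n : ℝ)⁻¹ * ∑ k ∈ Finset.range n, d k) atTop (𝓝 0) := by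
  set S : ℕ → ℝ := fun n => ∑ k ∈ Finset.range n, d k / ((k : ℝ) + 1) with hS
  have habel : ∀ n : ℕ, ∑ k ∈ Finset.range n, d k
      = (n : ℝ) * S n - ∑ k ∈ Finset.range n, S k := by
    intro n
    induction n with
    | zero => simp
    | succ n ih =>
      have hn : (n : ℝ) + 1 ≠ 0 := by positivity
      have h1 : S (n + 1) = S n + d n / ((n : ℝ) + 1) := by
        simp only [hS, Finset.sum_range_succ]
      rw [Finset.sum_range_succ, ih, Finset.sum_range_succ _ n, h1]
      push_cast
      field_simp
      ring
  have h2 := h.sub h.cesaro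
  rw [sub_self] at h2
  refine h2.congr' ?_
  filter_upwards [eventually_gt_atTop 0] with n hn
  have hn' : (n : ℝ) ≠ 0 := by positivity
  rw [habel]
  field_simp

/-- Cesàro means of the solution of `P (k + 1) = P k / 2 + r k`. -/
lemma tendsto_cesaro_of_recursion {P r : ℕ → ℝ} {ℓ : ℝ}
    (hP : ∀ k, P (k + 1) = (1 / 2) * P k + r k)
    (hr : Tendsto (fun n : ℕ => (n : ℝ)⁻¹ * ∑ k ∈ Finset.range n, r k) atTop (𝓝 (ℓ / 2))) :
    Tendsto (fun n : ℕ => (n : ℝ)⁻¹ * ∑ k ∈ Finset.range n, P k) atTop (𝓝 ℓ) := by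
  set C : ℕ → ℝ := fun n => ∑ k ∈ Finset.range n, P k with hC
  set R : ℕ → ℝ := fun n => ∑ k ∈ Finset.range n, r k with hR
  have hrec : ∀ n, C (n + 1) = P 0 + 1 / 2 * C n + R n := by
    intro n
    simp only [hC, hR]
    rw [Finset.sum_range_succ', Finset.sum_congr rfl fun k _ => hP k, Finset.sum_add_distrib,
      ← Finset.mul_sum]
    ring
  have hq : Tendsto (fun n : ℕ => ((n : ℝ) + 1)⁻¹) atTop (𝓝 0) := by
    simpa [one_div] using tendsto_one_div_add_atTop_nhds_zero_nat (𝕜 := ℝ)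
  -- `n / (n + 1) → 1`
  have hq1 : Tendsto (fun n : ℕ => 1 - ((n : ℝ) + 1)⁻¹) atTop (𝓝 1) := by
    simpa using hq.const_sub 1
  have hs : Tendsto (fun n : ℕ => |1 / 2 * (1 - ((n : ℝ) + 1)⁻¹) * ℓ + ((n : ℝ) + 1)⁻¹ * P 0
      + (1 - ((n : ℝ) + 1)⁻¹) * ((n : ℝ)⁻¹ * R n) - ℓ|) atTop (𝓝 0) := by
    have := ((((hq1.const_mul (1 / 2)).mul_const ℓ).add (hq.mul_const (P 0))).add
      (hq1.mul hr)).sub_const ℓ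
    have h0 : 1 / 2 * 1 * ℓ + 0 * P 0 + 1 * (ℓ / 2) - ℓ = 0 := by ring
    rw [h0] at this
    simpa using this.abs
  have hx := tendsto_zero_of_le_mul_add (x := fun n : ℕ => |(n : ℝ)⁻¹ * C n - ℓ|) (α := 1 / 2) 1
    (by norm_num) (by norm_num) (fun n => abs_nonneg _) hs ?_
  · rw [tendsto_iff_norm_sub_tendsto_zero]
    exact hx
  · intro n hn
    have hn' : (n : ℝ) ≠ 0 := by positivity
    have hn1 : (n : ℝ) + 1 ≠ 0 := by positivity
    have e1 : ((n + 1 : ℕ) : ℝ)⁻¹ * C (n + 1) - ℓ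
        = 1 / 2 * (1 - ((n : ℝ) + 1)⁻¹) * ((n : ℝ)⁻¹ * C n - ℓ)
        + (1 / 2 * (1 - ((n : ℝ) + 1)⁻¹) * ℓ + ((n : ℝ) + 1)⁻¹ * P 0
        + (1 - ((n : ℝ) + 1)⁻¹) * ((n : ℝ)⁻¹ * R n) - ℓ) := by
      rw [hrec]
      push_cast
      field_simp
      ring
    rw [e1]
    refine (abs_add_le _ _).trans (add_le_add ?_ le_rfl)
    rw [abs_mul, abs_mul]
    have h3 : |1 - ((n : ℝ) + 1)⁻¹| ≤ 1 := by
      have : 0 ≤ ((n : ℝ) + 1)⁻¹ := by positivity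
      have h5 : ((n : ℝ) + 1)⁻¹ ≤ 1 := inv_le_one_of_one_le₀ (by linarith [Nat.cast_nonneg (α := ℝ) n])
      rw [abs_le]; constructor <;> linarith
    have h4 : |(1 / 2 : ℝ)| = 1 / 2 := by norm_num
    rw [h4]
    nlinarith [abs_nonneg ((n : ℝ)⁻¹ * C n - ℓ), abs_nonneg (1 - ((n : ℝ) + 1)⁻¹)]

/-- Convergent weights may be replaced by their limit in a Cesàro mean, as long as the absolute
values have bounded Cesàro means. -/
lemma tendsto_cesaro_mul {c P : ℕ → ℝ} {c₀ ℓ C : ℝ} (hc : Tendsto c atTop (𝓝 c₀))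
    (hP : Tendsto (fun n : ℕ => (n : ℝ)⁻¹ * ∑ k ∈ Finset.range n, P k) atTop (𝓝 ℓ))
    (hC : ∀ n : ℕ, (n : ℝ)⁻¹ * ∑ k ∈ Finset.range n, |P k| ≤ C) :
    Tendsto (fun n : ℕ => (n : ℝ)⁻¹ * ∑ k ∈ Finset.range n, c k * P k) atTop (𝓝 (c₀ * ℓ)) := by
  have hC0 : 0 ≤ C := by simpa using hC 0
  have h0 : Tendsto (fun n : ℕ => (n : ℝ)⁻¹ * ∑ k ∈ Finset.range n, (c k - c₀) * P k) atTop
      (𝓝 0) := by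
    rw [Metric.tendsto_atTop]
    intro e he
    obtain ⟨K, hK⟩ := Metric.tendsto_atTop.1 hc (e / (2 * (C + 1))) (by positivity)
    set B := ∑ k ∈ Finset.range K, |(c k - c₀) * P k| with hB
    have hBt : Tendsto (fun n : ℕ => (n : ℝ)⁻¹ * B) atTop (𝓝 0) := by
      simpa using (tendsto_inv_atTop_nhds_zero_nat (𝕜 := ℝ)).mul_const B
    obtain ⟨N, hN⟩ := Metric.tendsto_atTop.1 hBt (e / 2) (by linarith)
    refine ⟨N, fun n hn => ?_⟩
    have h1 := hN n hn
    rw [Real.dist_eq, sub_zero] at h1 ⊢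
    have h2 : |∑ k ∈ Finset.range n, (c k - c₀) * P k|
        ≤ B + e / (2 * (C + 1)) * ∑ k ∈ Finset.range n, |P k| := by
      refine (Finset.abs_sum_le_sum_abs _ _).trans ?_
      rw [hB, Finset.mul_sum]
      have : ∀ k ∈ Finset.range n, |(c k - c₀) * P k|
          ≤ (if k < K then |(c k - c₀) * P k| else 0) + e / (2 * (C + 1)) * |P k| := by
        intro k _
        split_ifs with hk
        · have : 0 ≤ e / (2 * (C + 1)) * |P k| := by positivity
          linarith
        · rw [zero_add, abs_mul]
          have := hK k (not_lt.1 hk)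
          rw [Real.dist_eq] at this
          exact mul_le_mul_of_nonneg_right this.le (abs_nonneg _)
      refine (Finset.sum_le_sum this).trans ?_
      rw [Finset.sum_add_distrib]
      refine add_le_add ?_ le_rfl
      rw [← Finset.sum_filter]
      refine Finset.sum_le_sum_of_subset_of_nonneg ?_ fun _ _ _ => abs_nonneg _
      intro k hk
      simp only [Finset.mem_filter, Finset.mem_range] at hk ⊢
      exact hk.2
    have hn0 : (0 : ℝ) ≤ (n : ℝ)⁻¹ := by positivity
    rw [abs_mul, abs_of_nonneg hn0]
    have h3 := mul_le_mul_of_nonneg_left h2 hn0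
    have h4 := mul_le_mul_of_nonneg_left (hC n) (show 0 ≤ e / (2 * (C + 1)) by positivity)
    have h5 : e / (2 * (C + 1)) * C < e / 2 := by
      rw [div_mul_eq_mul_div, div_lt_div_iff₀ (by positivity) (by norm_num)]
      nlinarith
    have h6 := (abs_lt.1 h1).2
    nlinarith
  have := h0.add (hP.const_mul c₀)
  rw [zero_add] at this
  refine this.congr fun n => ?_
  rw [mul_left_comm, ← mul_add, Finset.mul_sum, ← Finset.sum_add_distrib]
  congr 1
  exact Finset.sum_congr rfl fun k _ => by ring

/-- A sequence with convergent Cesàro means is `o(n)`. -/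
lemma tendsto_div_of_cesaro {P : ℕ → ℝ} {ℓ : ℝ}
    (hP : Tendsto (fun n : ℕ => (n : ℝ)⁻¹ * ∑ k ∈ Finset.range n, P k) atTop (𝓝 ℓ)) :
    Tendsto (fun n : ℕ => (n : ℝ)⁻¹ * P n) atTop (𝓝 0) := by
  have h1 := hP.comp (tendsto_add_atTop_nat 1)
  have hq : Tendsto (fun n : ℕ => 1 + (n : ℝ)⁻¹) atTop (𝓝 1) := by
    simpa using (tendsto_inv_atTop_nhds_zero_nat (𝕜 := ℝ)).const_add 1
  have h2 := (hq.mul h1).sub hP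
  rw [one_mul, sub_self] at h2
  refine h2.congr' ?_
  filter_upwards [eventually_gt_atTop 0] with n hn
  have hn' : (n : ℝ) ≠ 0 := by positivity
  simp only [Function.comp, Finset.sum_range_succ]
  push_cast
  field_simp
  ring

/-- Averages over the whole tree inherit the limit of the averages over the generations. -/
lemma tendsto_tree_average {g T : ℕ → ℝ} {ℓ : ℝ} (n₀ : ℕ)
    (hg : Tendsto (fun k => (2 ^ k : ℝ)⁻¹ * g k) atTop (𝓝 ℓ))
    (hT : ∀ n, n₀ ≤ n → T (n + 1) = T n + g n) :
    Tendsto (fun n => (2 ^ n : ℝ)⁻¹ * T n) atTop (𝓝 ℓ) := by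
  have hs : Tendsto (fun k => 1 / 2 * |(2 ^ k : ℝ)⁻¹ * g k - ℓ|) atTop (𝓝 0) := by
    have := ((hg.sub_const ℓ).abs).const_mul (1 / 2)
    simpa using this
  have := tendsto_zero_of_le_mul_add (x := fun n => |(2 ^ n : ℝ)⁻¹ * T n - ℓ|) (α := 1 / 2) n₀
    (by norm_num) (by norm_num) (fun n => abs_nonneg _) hs ?_
  · rw [tendsto_iff_norm_sub_tendsto_zero]
    exact this
  · intro n hn
    rw [hT n hn, pow_succ]
    have : ((2 : ℝ) ^ n * 2)⁻¹ * (T n + g n) - ℓ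
        = 1 / 2 * ((2 ^ n : ℝ)⁻¹ * T n - ℓ) + 1 / 2 * ((2 ^ n : ℝ)⁻¹ * g n - ℓ) := by
      rw [mul_inv]; ring
    rw [this]
    refine (abs_add_le _ _).trans ?_
    rw [abs_mul, abs_mul, show |(1 / 2 : ℝ)| = 1 / 2 by norm_num]

/-! ### Square integrable martingale differences -/

section MartingaleDifferences

variable {Ω : Type*} {mΩ : MeasurableSpace Ω} {μ : Measure Ω}

/-- `D j`, `j ∈ ℕ`, are square integrable martingale differences: `D j` is known at time `j + 1`
and centred given the past `𝒢 j`. -/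
structure IsMDiff (μ : Measure Ω) (𝒢 : Filtration ℕ mΩ) (D : ℕ → Ω → ℝ) : Prop where
  adapted : ∀ j, StronglyMeasurable[𝒢 (j + 1)] (D j)
  memLp : ∀ j, MemLp (D j) 2 μ
  mean : ∀ j, μ[D j | 𝒢 j] =ᵐ[μ] 0

lemma IsMDiff.const_mul {𝒢 : Filtration ℕ mΩ} {D : ℕ → Ω → ℝ} (hD : IsMDiff μ 𝒢 D) (w : ℕ → ℝ) :
    IsMDiff μ 𝒢 (fun j ω => w j * D j ω) where
  adapted j := (hD.adapted j).const_mul (w j)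
  memLp j := (hD.memLp j).const_mul (w j)
  mean j := by
    have h1 : μ[fun ω => w j * D j ω | 𝒢 j] =ᵐ[μ] w j • μ[D j | 𝒢 j] :=
      condExp_smul (w j) (D j) (𝒢 j)
    filter_upwards [h1, hD.mean j] with ω h2 h3
    rw [h2, Pi.smul_apply, h3]; simp

variable [IsProbabilityMeasure μ]

lemma integral_mul_eq_zero_of_condExp {m : MeasurableSpace Ω} (hm : m ≤ mΩ) {f g : Ω → ℝ}
    (hf : StronglyMeasurable[m] f) (hfg : Integrable (f * g) μ) (hg : Integrable g μ)
    (h : μ[g | m] =ᵐ[μ] 0) : ∫ ω, f ω * g ω ∂μ = 0 := by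
  have h1 := condExp_mul_of_stronglyMeasurable_left hf hfg hg
  have h2 := integral_condExp (μ := μ) (f := f * g) hm
  have h3 : ∫ ω, (f * g) ω ∂μ = 0 := by
    rw [← h2]
    have : μ[f * g | m] =ᵐ[μ] 0 := by
      filter_upwards [h1, h] with ω h4 h5
      rw [h4, Pi.mul_apply, h5]; simp
    rw [integral_congr_ae this]; simp
  exact h3

/-- Orthogonality of martingale differences. -/
lemma integral_sq_sum_Ico {𝒢 : Filtration ℕ mΩ} {D : ℕ → Ω → ℝ} {a b : ℕ} (hab : a ≤ b)
    (hD : ∀ j ∈ Finset.Ico a b, StronglyMeasurable[𝒢 (j + 1)] (D j) ∧ MemLp (D j) 2 μ ∧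
      μ[D j | 𝒢 j] =ᵐ[μ] 0) :
    ∫ ω, (∑ j ∈ Finset.Ico a b, D j ω) ^ 2 ∂μ = ∑ j ∈ Finset.Ico a b, ∫ ω, D j ω ^ 2 ∂μ := by
  induction b, hab using Nat.le_induction with
  | base => simp
  | succ b hab ih =>
    have hmem : ∀ j ∈ Finset.Ico a b, j ∈ Finset.Ico a (b + 1) := fun j hj => by
      simp only [Finset.mem_Ico] at hj ⊢; omega
    have ih' := ih fun j hj => hD j (hmem j hj)
    obtain ⟨h1, h2, h3⟩ := hD b (by simp only [Finset.mem_Ico]; omega)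
    have hS : MemLp (fun ω => ∑ j ∈ Finset.Ico a b, D j ω) 2 μ :=
      memLp_finsetSum _ fun j hj => (hD j (hmem j hj)).2.1
    have hSm : StronglyMeasurable[𝒢 b] (fun ω => ∑ j ∈ Finset.Ico a b, D j ω) := by
      refine Finset.stronglyMeasurable_fun_sum _ fun j hj => ?_
      exact (hD j (hmem j hj)).1.mono (𝒢.mono (by simp only [Finset.mem_Ico] at hj; omega))
    have h0 := integral_mul_eq_zero_of_condExp (𝒢.le b) hSm (hS.integrable_mul h2)
      (h2.integrable (by norm_num)) h3
    have hi : Integrable (fun ω => (∑ j ∈ Finset.Ico a b, D j ω) * D b ω) μ := hS.integrable_mul h2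
    rw [Finset.sum_Ico_succ_top hab, ← ih', ← integral_add hS.integrable_sq h2.integrable_sq]
    have : ∀ ω, (∑ j ∈ Finset.Ico a (b + 1), D j ω) ^ 2
        = ((∑ j ∈ Finset.Ico a b, D j ω) ^ 2 + D b ω ^ 2)
          + 2 * ((∑ j ∈ Finset.Ico a b, D j ω) * D b ω) := by
      intro ω
      rw [Finset.sum_Ico_succ_top hab]; ring
    have h4 : Integrable (fun ω => (∑ j ∈ Finset.Ico a b, D j ω) ^ 2 + D b ω ^ 2) μ :=
      hS.integrable_sq.add h2.integrable_sq
    rw [integral_congr_ae (ae_of_all _ this), integral_add h4 (hi.const_mul 2),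
      integral_const_mul, h0]
    ring

lemma IsMDiff.integral_sq_sum {𝒢 : Filtration ℕ mΩ} {D : ℕ → Ω → ℝ} (hD : IsMDiff μ 𝒢 D) (n : ℕ) :
    ∫ ω, (∑ j ∈ Finset.range n, D j ω) ^ 2 ∂μ = ∑ j ∈ Finset.range n, ∫ ω, D j ω ^ 2 ∂μ := by
  rw [Finset.range_eq_Ico]
  exact integral_sq_sum_Ico (Nat.zero_le n) fun j _ => ⟨hD.adapted j, hD.memLp j, hD.mean j⟩

/-- An `L²`-bounded martingale converges almost surely. -/
lemma IsMDiff.ae_exists_tendsto {𝒢 : Filtration ℕ mΩ} {D : ℕ → Ω → ℝ} (hD : IsMDiff μ 𝒢 D) {C : ℝ}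
    (hC : ∀ n, ∑ j ∈ Finset.range n, ∫ ω, D j ω ^ 2 ∂μ ≤ C) :
    ∀ᵐ ω ∂μ, ∃ c, Tendsto (fun n => ∑ j ∈ Finset.range n, D j ω) atTop (𝓝 c) := by
  have hL2 : ∀ n, MemLp (fun ω => ∑ j ∈ Finset.range n, D j ω) 2 μ := fun n =>
    memLp_finsetSum _ fun j _ => hD.memLp j
  have hmart : Martingale (fun n ω => ∑ j ∈ Finset.range n, D j ω) 𝒢 μ := by
    refine martingale_of_condExp_sub_eq_zero_nat ?_ (fun n => (hL2 n).integrable (by norm_num)) ?_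
    · intro n
      refine Finset.stronglyMeasurable_fun_sum _ fun j hj => ?_
      exact (hD.adapted j).mono (𝒢.mono (by simp only [Finset.mem_range] at hj; omega))
    · intro n
      have : ((fun ω => ∑ j ∈ Finset.range (n + 1), D j ω)
          - fun ω => ∑ j ∈ Finset.range n, D j ω) = D n := by
        ext ω
        simp [Finset.sum_range_succ]
      rw [this]
      exact hD.mean n
  refine hmart.submartingale.exists_ae_tendsto_of_bdd (R := (1 + C).toNNReal) fun n => ?_
  have hi := (hL2 n).integrable (by norm_num : (1 : ENNReal) ≤ 2)
  rw [eLpNorm_one_eq_lintegral_enorm, ← ofReal_integral_norm_eq_lintegral_enorm hi]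
  refine ENNReal.ofReal_le_ofReal ?_
  calc ∫ ω, ‖∑ j ∈ Finset.range n, D j ω‖ ∂μ
      ≤ ∫ ω, (1 + (∑ j ∈ Finset.range n, D j ω) ^ 2) ∂μ := by
        refine integral_mono hi.norm ((integrable_const _).add (hL2 n).integrable_sq) fun ω => ?_
        have := sq_abs (∑ j ∈ Finset.range n, D j ω)
        simp only [Real.norm_eq_abs]
        nlinarith [sq_nonneg (|∑ j ∈ Finset.range n, D j ω| - 1)]
    _ = 1 + ∫ ω, (∑ j ∈ Finset.range n, D j ω) ^ 2 ∂μ := by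
        rw [integral_add (integrable_const _) (hL2 n).integrable_sq]; simp
    _ ≤ 1 + C := by
        rw [hD.integral_sq_sum]; linarith [hC n]

lemma log_eq_of_mem_gen {k j : ℕ} (hj : j ∈ gen k) : Nat.log 2 j = k := by
  simp only [gen, Finset.mem_Ico] at hj
  have h2 : 0 < 2 ^ k := by positivity
  rw [Nat.log_eq_iff (Or.inr ⟨by norm_num, by omega⟩)]
  exact hj

lemma pos_of_mem_gen {k j : ℕ} (hj : j ∈ gen k) : 0 < j := by
  simp only [gen, Finset.mem_Ico] at hj
  exact lt_of_lt_of_le (by positivity) hj.1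

lemma sum_range_two_pow_succ {M : Type*} [AddCommMonoid M] (f : ℕ → M) (n : ℕ) :
    ∑ j ∈ Finset.range (2 ^ (n + 1)), f j = ∑ j ∈ Finset.range (2 ^ n), f j + ∑ j ∈ gen n, f j := by
  rw [gen, Finset.range_eq_Ico, Finset.range_eq_Ico,
    Finset.sum_Ico_consecutive _ (Nat.zero_le _) (Nat.pow_le_pow_right (by norm_num) (by omega))]

lemma sum_range_two_pow {f : ℕ → ℝ} (h0 : f 0 = 0) (n : ℕ) :
    ∑ j ∈ Finset.range (2 ^ n), f j = ∑ k ∈ Finset.range n, ∑ j ∈ gen k, f j := by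
  induction n with
  | zero => simp [h0]
  | succ n ih => rw [sum_range_two_pow_succ, ih, Finset.sum_range_succ]

/-- Almost sure convergence of the series of the weighted sums over the generations. -/
lemma IsMDiff.ae_exists_tendsto_gen {𝒢 : Filtration ℕ mΩ} {D : ℕ → Ω → ℝ} (hD : IsMDiff μ 𝒢 D)
    {c K : ℕ → ℝ} (hK : ∀ k, ∑ j ∈ gen k, ∫ ω, D j ω ^ 2 ∂μ ≤ K k)
    (hc : Summable fun k => c k ^ 2 * K k) :
    ∀ᵐ ω ∂μ, ∃ l, Tendsto (fun n => ∑ k ∈ Finset.range n, c k * ∑ j ∈ gen k, D j ω) atTop (𝓝 l) := by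
  set w : ℕ → ℝ := fun j => if j = 0 then 0 else c (Nat.log 2 j) with hw
  have hwgen : ∀ k, ∀ j ∈ gen k, w j = c k := fun k j hj => by
    rw [hw]; simp only [(pos_of_mem_gen hj).ne', if_false, log_eq_of_mem_gen hj]
  have hK0 : ∀ k, 0 ≤ K k := fun k =>
    (Finset.sum_nonneg fun j _ => integral_nonneg fun ω => sq_nonneg _).trans (hK k)
  have hD' := hD.const_mul w
  have hbound : ∀ n, ∑ j ∈ Finset.range n, ∫ ω, (w j * D j ω) ^ 2 ∂μ ≤ ∑' k, c k ^ 2 * K k := by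
    intro n
    have h1 : ∑ j ∈ Finset.range n, ∫ ω, (w j * D j ω) ^ 2 ∂μ
        ≤ ∑ j ∈ Finset.range (2 ^ n), ∫ ω, (w j * D j ω) ^ 2 ∂μ :=
      Finset.sum_le_sum_of_subset_of_nonneg
        (Finset.range_subset_range.2 Nat.lt_two_pow_self.le)
        fun j _ _ => integral_nonneg fun ω => sq_nonneg _
    refine h1.trans ?_
    rw [sum_range_two_pow (by simp [hw])]
    refine le_trans (Finset.sum_le_sum fun k _ => ?_)
      (hc.sum_le_tsum (Finset.range n) fun k _ => mul_nonneg (sq_nonneg _) (hK0 k))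
    rw [Finset.sum_congr rfl fun j hj => by rw [hwgen k j hj]]
    simp_rw [mul_pow, integral_const_mul]
    rw [← Finset.mul_sum]
    exact mul_le_mul_of_nonneg_left (hK k) (sq_nonneg _)
  filter_upwards [hD'.ae_exists_tendsto hbound] with ω ⟨l, hl⟩
  refine ⟨l, (hl.comp (tendsto_pow_atTop_atTop_of_one_lt (r := 2) (by norm_num))).congr fun n => ?_⟩
  simp only [Function.comp]
  rw [sum_range_two_pow (by simp [hw])]
  refine Finset.sum_congr rfl fun k _ => ?_
  rw [Finset.mul_sum]
  exact Finset.sum_congr rfl fun j hj => by rw [hwgen k j hj]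

/-- Strong law of large numbers over the generations. -/
lemma IsMDiff.ae_tendsto_gen_average {𝒢 : Filtration ℕ mΩ} {D : ℕ → Ω → ℝ} (hD : IsMDiff μ 𝒢 D)
    {C : ℝ} (hC : ∀ j, 0 < j → ∫ ω, D j ω ^ 2 ∂μ ≤ C) :
    ∀ᵐ ω ∂μ, Tendsto (fun k => (2 ^ k : ℝ)⁻¹ * ∑ j ∈ gen k, D j ω) atTop (𝓝 0) := by
  have hcard : ∀ k, ∑ j ∈ gen k, ∫ ω, D j ω ^ 2 ∂μ ≤ 2 ^ k * C := by
    intro k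
    refine (Finset.sum_le_sum fun j hj => hC j (pos_of_mem_gen hj)).trans ?_
    rw [Finset.sum_const, nsmul_eq_mul, gen, Nat.card_Ico, pow_succ]
    have : 2 ^ k * 2 - 2 ^ k = 2 ^ k := by omega
    rw [this]; push_cast; rfl
  have hs : Summable fun k : ℕ => ((2 ^ k : ℝ)⁻¹) ^ 2 * (2 ^ k * C) := by
    have := (summable_geometric_of_lt_one (r := (1 / 2 : ℝ)) (by norm_num) (by norm_num)).mul_right C
    refine this.congr fun k => ?_
    rw [one_div, inv_pow]
    field_simp
  filter_upwards [hD.ae_exists_tendsto_gen hcard hs] with ω ⟨l, hl⟩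
  have h1 := (hl.comp (tendsto_add_atTop_nat 1)).sub hl
  rw [sub_self] at h1
  refine h1.congr fun n => ?_
  simp [Function.comp, Finset.sum_range_succ]

/-- If the averages over the generations only have bounded second moments, then their Cesàro means
still vanish in the limit. -/
lemma IsMDiff.ae_tendsto_gen_cesaro {𝒢 : Filtration ℕ mΩ} {D : ℕ → Ω → ℝ} (hD : IsMDiff μ 𝒢 D)
    {C : ℝ} (hC : ∀ k, ∑ j ∈ gen k, ∫ ω, D j ω ^ 2 ∂μ ≤ C * 4 ^ k) :
    ∀ᵐ ω ∂μ, Tendsto (fun n : ℕ => (n : ℝ)⁻¹ *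
      ∑ k ∈ Finset.range n, (2 ^ k : ℝ)⁻¹ * ∑ j ∈ gen k, D j ω) atTop (𝓝 0) := by
  have hs : Summable fun k : ℕ => ((2 ^ k : ℝ)⁻¹ / ((k : ℝ) + 1)) ^ 2 * (C * 4 ^ k) := by
    have h1 : Summable fun k : ℕ => 1 / ((k : ℝ) + 1) ^ 2 := by
      have := (summable_nat_add_iff 1).2 (Real.summable_one_div_nat_pow.2 (by norm_num : 1 < 2))
      simpa using this
    refine (h1.mul_left C).congr fun k => ?_
    have : (4 : ℝ) ^ k = 2 ^ k * 2 ^ k := by rw [← mul_pow]; norm_num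
    rw [this]
    field_simp
  filter_upwards [hD.ae_exists_tendsto_gen hC hs] with ω ⟨l, hl⟩
  refine tendsto_cesaro_of_tendsto_sum_div (c := l) (hl.congr fun n => ?_)
  exact Finset.sum_congr rfl fun k _ => by ring

end MartingaleDifferences

/-! ### Noise sequences -/

section Noise

variable {Ω : Type*} {mΩ : MeasurableSpace Ω} {μ : Measure Ω} [IsProbabilityMeasure μ]

/-- A centred noise with deterministic conditional variances `s j ≤ σ2` and almost surely bounded
conditional fourth moments, with respect to the linearly ordered filtration `𝒢`. -/
structure IsNoise (μ : Measure Ω) (𝒢 : Filtration ℕ mΩ) (η : ℕ → Ω → ℝ) (s : ℕ → ℝ) (σ2 : ℝ) :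
    Prop where
  adapted : ∀ j, StronglyMeasurable[𝒢 (j + 1)] (η j)
  memLp : ∀ j, MemLp (η j) 4 μ
  mean : ∀ j, μ[η j | 𝒢 j] =ᵐ[μ] 0
  var : ∀ j, μ[fun ω => η j ω ^ 2 | 𝒢 j] =ᵐ[μ] fun _ => s j
  var_le : ∀ j, s j ≤ σ2
  fourth : ∀ᵐ ω ∂μ, ∃ C : ℝ, ∀ j, (μ[fun ω' => η j ω' ^ 4 | 𝒢 j]) ω ≤ C

lemma holderTriple_four : ENNReal.HolderTriple 4 4 2 := ⟨by
  have : (4 : ENNReal) = 2 * 2 := by norm_num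
  rw [this, ENNReal.mul_inv (by norm_num) (by norm_num), ← two_mul, ← mul_assoc,
    ENNReal.mul_inv_cancel (by norm_num) (by norm_num), one_mul]⟩

lemma memLp_two_mul {f g : Ω → ℝ} (hf : MemLp f 4 μ) (hg : MemLp g 4 μ) :
    MemLp (fun ω => f ω * g ω) 2 μ :=
  haveI := holderTriple_four
  MemLp.mul' hg hf

lemma memLp_two_sq {f : Ω → ℝ} (hf : MemLp f 4 μ) : MemLp (fun ω => f ω ^ 2) 2 μ := by
  simpa only [sq] using memLp_two_mul hf hf

lemma integrable_pow_four {f : Ω → ℝ} (hf : MemLp f 4 μ) : Integrable (fun ω => f ω ^ 4) μ := by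
  have := (memLp_two_sq hf).integrable_sq
  refine this.congr (ae_of_all _ fun ω => ?_)
  ring

lemma memLp_bdd_mul {f g : Ω → ℝ} {p : ENNReal} {C : ℝ} (hf : AEStronglyMeasurable f μ)
    (hC : ∀ ω, |f ω| ≤ C) (hg : MemLp g p μ) : MemLp (fun ω => f ω * g ω) p μ :=
  MemLp.mul' hg (memLp_top_of_bound hf C (ae_of_all _ hC))

/-- Integration against a function of the past only sees the conditional expectation. -/
lemma integral_mul_condExp {m : MeasurableSpace Ω} (hm : m ≤ mΩ) {f g h : Ω → ℝ}
    (hf : StronglyMeasurable[m] f) (hfg : Integrable (fun ω => f ω * g ω) μ) (hg : Integrable g μ)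
    (h1 : μ[g | m] =ᵐ[μ] h) : ∫ ω, f ω * g ω ∂μ = ∫ ω, f ω * h ω ∂μ := by
  have h2 := condExp_mul_of_stronglyMeasurable_left hf hfg hg
  rw [← integral_condExp (μ := μ) (f := fun ω => f ω * g ω) hm]
  refine integral_congr_ae ?_
  filter_upwards [h2, h1] with ω h3 h4
  rw [← h4]
  exact h3

variable {𝒢 : Filtration ℕ mΩ} {η : ℕ → Ω → ℝ} {s : ℕ → ℝ} {σ2 : ℝ}

lemma IsNoise.integral_sq (h : IsNoise μ 𝒢 η s σ2) (j : ℕ) : ∫ ω, η j ω ^ 2 ∂μ = s j := by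
  rw [← integral_condExp (𝒢.le j), integral_congr_ae (h.var j)]; simp

lemma IsNoise.var_nonneg (h : IsNoise μ 𝒢 η s σ2) (j : ℕ) : 0 ≤ s j := by
  rw [← h.integral_sq]; exact integral_nonneg fun _ => sq_nonneg _

lemma IsNoise.integral_mul_sq (h : IsNoise μ 𝒢 η s σ2) (j : ℕ) {V : Ω → ℝ}
    (hV : StronglyMeasurable[𝒢 j] V) (hV4 : MemLp V 4 μ) :
    ∫ ω, (V ω * η j ω) ^ 2 ∂μ = s j * ∫ ω, V ω ^ 2 ∂μ := by
  have h1 : ∀ ω, (V ω * η j ω) ^ 2 = V ω ^ 2 * η j ω ^ 2 := fun ω => mul_pow _ _ _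
  rw [integral_congr_ae (ae_of_all _ h1), integral_mul_condExp (f := fun ω => V ω ^ 2) (𝒢.le j)
    (hV.pow 2)
    ((memLp_two_sq hV4).integrable_mul (memLp_two_sq (h.memLp j)))
    ((memLp_two_sq (h.memLp j)).integrable (by norm_num)) (h.var j), integral_mul_const, mul_comm]

lemma IsNoise.condExp_mul (h : IsNoise μ 𝒢 η s σ2) (j : ℕ) {V : Ω → ℝ}
    (hV : StronglyMeasurable[𝒢 j] V) (hV4 : MemLp V 4 μ) :
    μ[fun ω => V ω * η j ω | 𝒢 j] =ᵐ[μ] 0 := by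
  have h2 : μ[fun ω => V ω * η j ω | 𝒢 j] =ᵐ[μ] V * μ[η j | 𝒢 j] :=
    condExp_mul_of_stronglyMeasurable_left hV
      ((memLp_two_mul hV4 (h.memLp j)).integrable (by norm_num))
      ((h.memLp j).integrable (by norm_num))
  filter_upwards [h2, h.mean j] with ω h3 h4
  rw [h3, Pi.mul_apply, h4]; simp

/-- Predictable multiples of the noise are martingale differences. -/
lemma IsNoise.isMDiff_mul (h : IsNoise μ 𝒢 η s σ2) {V : ℕ → Ω → ℝ}
    (hV : ∀ j, StronglyMeasurable[𝒢 j] (V j)) (hV4 : ∀ j, MemLp (V j) 4 μ) :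
    IsMDiff μ 𝒢 (fun j ω => V j ω * η j ω) where
  adapted j := ((hV j).mono (𝒢.mono (Nat.le_succ j))).mul (h.adapted j)
  memLp j := memLp_two_mul (hV4 j) (h.memLp j)
  mean j := h.condExp_mul j (hV j) (hV4 j)

/-- The indicator of the event that the conditional fourth moment of the `j`-th noise is at most
`C`. -/
noncomputable def fourthInd (μ : Measure Ω) (𝒢 : Filtration ℕ mΩ) (η : ℕ → Ω → ℝ) (C : ℝ) (j : ℕ) :
    Ω → ℝ :=
  {ω | (μ[fun ω' => η j ω' ^ 4 | 𝒢 j]) ω ≤ C}.indicator fun _ => 1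

lemma stronglyMeasurable_fourthInd (C : ℝ) (j : ℕ) :
    StronglyMeasurable[𝒢 j] (fourthInd μ 𝒢 η C j) := by
  refine stronglyMeasurable_const.indicator ?_
  exact @measurableSet_le _ _ _ _ _ (𝒢 j) _ _ _ _ _
    (stronglyMeasurable_condExp.measurable) measurable_const

lemma fourthInd_nonneg (C : ℝ) (j : ℕ) (ω : Ω) : 0 ≤ fourthInd μ 𝒢 η C j ω :=
  Set.indicator_nonneg (fun _ _ => zero_le_one) _

lemma fourthInd_le_one (C : ℝ) (j : ℕ) (ω : Ω) : fourthInd μ 𝒢 η C j ω ≤ 1 :=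
  Set.indicator_le_self' (fun _ _ => zero_le_one) _

/-- Bounded predictable multiples of the truncated centred squares of the noise. -/
lemma IsNoise.isMDiff_sq (h : IsNoise μ 𝒢 η s σ2) {g : ℕ → Ω → ℝ} {K : ℕ → ℝ} (C : ℝ)
    (hg : ∀ j, StronglyMeasurable[𝒢 j] (g j)) (hK : ∀ j ω, |g j ω| ≤ K j) :
    IsMDiff μ 𝒢 (fun j ω => (g j ω * fourthInd μ 𝒢 η C j ω) * (η j ω ^ 2 - s j)) := by
  have hm : ∀ j, StronglyMeasurable[𝒢 j] (fun ω => g j ω * fourthInd μ 𝒢 η C j ω) := fun j =>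
    (hg j).mul (stronglyMeasurable_fourthInd C j)
  have hb : ∀ j ω, |g j ω * fourthInd μ 𝒢 η C j ω| ≤ K j := fun j ω => by
    rw [abs_mul, abs_of_nonneg (fourthInd_nonneg C j ω)]
    exact (mul_le_of_le_one_right (abs_nonneg _) (fourthInd_le_one C j ω)).trans (hK j ω)
  have h2 : ∀ j, MemLp (fun ω => η j ω ^ 2 - s j) 2 μ := fun j =>
    (memLp_two_sq (h.memLp j)).sub (memLp_const _)
  have h3 : ∀ j, MemLp (fun ω => (g j ω * fourthInd μ 𝒢 η C j ω) * (η j ω ^ 2 - s j)) 2 μ :=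
    fun j => memLp_bdd_mul ((hm j).mono (𝒢.le j)).aestronglyMeasurable (hb j) (h2 j)
  refine ⟨fun j => ((hm j).mono (𝒢.mono (Nat.le_succ j))).mul
      (((h.adapted j).pow 2).sub stronglyMeasurable_const), h3, fun j => ?_⟩
  have h4 : μ[fun ω => (g j ω * fourthInd μ 𝒢 η C j ω) * (η j ω ^ 2 - s j) | 𝒢 j] =ᵐ[μ]
      (fun ω => g j ω * fourthInd μ 𝒢 η C j ω) * μ[fun ω => η j ω ^ 2 - s j | 𝒢 j] :=
    condExp_mul_of_stronglyMeasurable_left (hm j) ((h3 j).integrable (by norm_num))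
      ((h2 j).integrable (by norm_num))
  have h5 : μ[fun ω => η j ω ^ 2 - s j | 𝒢 j] =ᵐ[μ]
      μ[fun ω => η j ω ^ 2 | 𝒢 j] - μ[fun _ => s j | 𝒢 j] :=
    condExp_sub ((memLp_two_sq (h.memLp j)).integrable (by norm_num)) (integrable_const _) _
  filter_upwards [h4, h5, h.var j] with ω h6 h7 h8
  rw [h6, Pi.mul_apply, h7, Pi.sub_apply, h8, condExp_const (𝒢.le j)]
  simp

lemma IsNoise.integral_sq_le (h : IsNoise μ 𝒢 η s σ2) {g : ℕ → Ω → ℝ} {K : ℕ → ℝ} {C : ℝ}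
    (hg : ∀ j, StronglyMeasurable[𝒢 j] (g j)) (hK : ∀ j ω, |g j ω| ≤ K j) (hC : 0 ≤ C) (j : ℕ) :
    ∫ ω, ((g j ω * fourthInd μ 𝒢 η C j ω) * (η j ω ^ 2 - s j)) ^ 2 ∂μ
      ≤ C * ∫ ω, g j ω ^ 2 ∂μ := by
  set f : Ω → ℝ := fun ω => (g j ω * fourthInd μ 𝒢 η C j ω) ^ 2 with hf
  have hfm : StronglyMeasurable[𝒢 j] f := ((hg j).mul (stronglyMeasurable_fourthInd C j)).pow 2
  have hb : ∀ ω, |f ω| ≤ K j ^ 2 := fun ω => by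
    rw [hf]
    simp only
    rw [abs_of_nonneg (sq_nonneg _), ← sq_abs]
    refine pow_le_pow_left₀ (abs_nonneg _) ?_ 2
    rw [abs_mul, abs_of_nonneg (fourthInd_nonneg C j ω)]
    exact (mul_le_of_le_one_right (abs_nonneg _) (fourthInd_le_one C j ω)).trans (hK j ω)
  have hfa := (hfm.mono (𝒢.le j)).aestronglyMeasurable (μ := μ)
  have hi4 := integrable_pow_four (h.memLp j)
  have hi2 := (memLp_two_sq (h.memLp j)).integrable (by norm_num : (1 : ENNReal) ≤ 2)
  have hf4 : Integrable (fun ω => f ω * η j ω ^ 4) μ := hi4.bdd_mul hfa (ae_of_all _ hb)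
  have hf2 : Integrable (fun ω => f ω * η j ω ^ 2) μ := hi2.bdd_mul hfa (ae_of_all _ hb)
  have hf0 : Integrable f μ := Integrable.of_bound hfa _ (ae_of_all _ hb)
  have hg2 : Integrable (fun ω => g j ω ^ 2) μ := by
    refine Integrable.of_bound (((hg j).pow 2).mono (𝒢.le j)).aestronglyMeasurable (K j ^ 2)
      (ae_of_all _ fun ω => ?_)
    rw [Real.norm_eq_abs, abs_pow]
    exact pow_le_pow_left₀ (abs_nonneg _) (hK j ω) 2
  have e4 := integral_mul_condExp (𝒢.le j) hfm hf4 hi4 (EventuallyEq.refl _ _)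
  have e2 := integral_mul_condExp (𝒢.le j) hfm hf2 hi2 (h.var j)
  rw [integral_mul_const] at e2
  have hexp : ∀ ω, ((g j ω * fourthInd μ 𝒢 η C j ω) * (η j ω ^ 2 - s j)) ^ 2
      = f ω * η j ω ^ 4 - (2 * s j * (f ω * η j ω ^ 2) - s j ^ 2 * f ω) := fun ω => by
    simp only [hf]; ring
  have hq : Integrable (fun ω => 2 * s j * (f ω * η j ω ^ 2) - s j ^ 2 * f ω) μ :=
    (hf2.const_mul _).sub (hf0.const_mul _)
  rw [integral_congr_ae (ae_of_all _ hexp), integral_sub hf4 hq,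
    integral_sub (hf2.const_mul _) (hf0.const_mul _), integral_const_mul, integral_const_mul, e2, e4]
  have h1 : ∫ ω, f ω * (μ[fun ω' => η j ω' ^ 4 | 𝒢 j]) ω ∂μ ≤ C * ∫ ω, g j ω ^ 2 ∂μ := by
    rw [← integral_const_mul]
    refine integral_mono ?_ (hg2.const_mul C) fun ω => ?_
    · exact integrable_condExp.bdd_mul hfa (ae_of_all _ hb)
    · simp only [hf, fourthInd]
      by_cases hω : ω ∈ {ω | (μ[fun ω' => η j ω' ^ 4 | 𝒢 j]) ω ≤ C}
      · rw [Set.indicator_of_mem hω, mul_one, mul_comm]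
        exact mul_le_mul_of_nonneg_right hω (sq_nonneg _)
      · rw [Set.indicator_of_notMem hω]
        simpa using mul_nonneg hC (sq_nonneg (g j ω))
  have h2 : 0 ≤ ∫ ω, f ω ∂μ := integral_nonneg fun ω => sq_nonneg _
  nlinarith [mul_nonneg (sq_nonneg (s j)) h2]

end Noise

/-! ### The quadratic strong law for a pair of scalar regressors -/

section QuadraticLaw

variable {Ω : Type*} {mΩ : MeasurableSpace Ω} {μ : Measure Ω} [IsProbabilityMeasure μ]

/-- The regressors of generation `k` are known as soon as the individuals up to that generation
are: with `𝒢 j = σ(X 1, …, X (2 j - 1))` this is measurability with respect to `𝒢 (2 ^ k)`.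
The index `0` belongs to no generation, and is switched off. -/
structure IsRegressor (𝒢 : Filtration ℕ mΩ) (U : ℕ → Ω → ℝ) : Prop where
  zero : U 0 = 0
  meas : ∀ k, ∀ j ∈ gen k, StronglyMeasurable[𝒢 (2 ^ k)] (U j)

/-- The transform `∑_{i < j} U_i η_i`. -/
def mart (U η : ℕ → Ω → ℝ) (j : ℕ) (ω : Ω) : ℝ := ∑ i ∈ Finset.range j, U i ω * η i ω

lemma mem_gen_log {j : ℕ} (hj : j ≠ 0) : j ∈ gen (Nat.log 2 j) := by
  rw [gen, Finset.mem_Ico]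
  exact ⟨Nat.pow_log_le_self 2 hj, Nat.lt_pow_succ_log_self (by norm_num) j⟩

lemma two_pow_le_of_mem_gen {k j : ℕ} (hj : j ∈ gen k) : 2 ^ k ≤ j := by
  simp only [gen, Finset.mem_Ico] at hj
  exact hj.1

variable {𝒢 : Filtration ℕ mΩ} {η : ℕ → Ω → ℝ} {s : ℕ → ℝ} {σ2 : ℝ} {U V : ℕ → Ω → ℝ}

lemma IsRegressor.adapted (hU : IsRegressor 𝒢 U) (j : ℕ) : StronglyMeasurable[𝒢 j] (U j) := by
  rcases eq_or_ne j 0 with rfl | hj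
  · rw [hU.zero]; exact stronglyMeasurable_zero
  · exact (hU.meas _ j (mem_gen_log hj)).mono (𝒢.mono (two_pow_le_of_mem_gen (mem_gen_log hj)))

/-- The sums of squares over the generations are of the order of the size of the generation. The
bound is uniform in `ω`, so that each `U j` is a bounded random variable. -/
def SqBounded (U : ℕ → Ω → ℝ) (C : ℝ) : Prop :=
  ∀ k ω, ∑ j ∈ gen k, U j ω ^ 2 ≤ C * 2 ^ k

lemma SqBounded.nonneg [Nonempty Ω] {C : ℝ} (hC : SqBounded U C) : 0 ≤ C := by
  have := hC 0 (Classical.arbitrary Ω)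
  simp only [pow_zero, mul_one] at this
  exact (Finset.sum_nonneg fun j _ => sq_nonneg _).trans this

lemma SqBounded.abs_le {C : ℝ} (hU : IsRegressor 𝒢 U) (hC : SqBounded U C) (j : ℕ) (ω : Ω) :
    |U j ω| ≤ 1 + C * 2 ^ Nat.log 2 j := by
  have : Nonempty Ω := ⟨ω⟩
  have hC0 := hC.nonneg
  rcases eq_or_ne j 0 with rfl | hj
  · rw [hU.zero]; simp only [Pi.zero_apply, abs_zero]; positivity
  · have h1 : U j ω ^ 2 ≤ C * 2 ^ Nat.log 2 j :=
      (Finset.single_le_sum (f := fun i => U i ω ^ 2) (fun i _ => sq_nonneg _)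
        (mem_gen_log hj)).trans (hC _ ω)
    nlinarith [sq_abs (U j ω), sq_nonneg (|U j ω| - 1), abs_nonneg (U j ω)]

lemma IsRegressor.memLp {C : ℝ} (hU : IsRegressor 𝒢 U) (hC : SqBounded U C) (j : ℕ)
    (p : ENNReal) : MemLp (U j) p μ :=
  MemLp.of_bound ((hU.adapted j).mono (𝒢.le j)).aestronglyMeasurable (1 + C * 2 ^ Nat.log 2 j)
    (ae_of_all _ (hC.abs_le hU j))

lemma IsNoise.mart_memLp (h : IsNoise μ 𝒢 η s σ2) {C : ℝ} (hU : IsRegressor 𝒢 U)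
    (hC : SqBounded U C) (j : ℕ) : MemLp (mart U η j) 4 μ :=
  memLp_finsetSum _ fun i _ =>
    memLp_bdd_mul ((hU.adapted i).mono (𝒢.le i)).aestronglyMeasurable (hC.abs_le hU i) (h.memLp i)

lemma IsNoise.mart_adapted (h : IsNoise μ 𝒢 η s σ2) (hU : IsRegressor 𝒢 U) (j : ℕ) :
    StronglyMeasurable[𝒢 j] (mart U η j) := by
  refine Finset.stronglyMeasurable_fun_sum _ fun i hi => ?_
  exact ((hU.adapted i).mono (𝒢.mono (Finset.mem_range.1 hi).le)).mul
    ((h.adapted i).mono (𝒢.mono (Finset.mem_range.1 hi)))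

lemma IsNoise.integral_mart_sq_le (h : IsNoise μ 𝒢 η s σ2) {C : ℝ} (hU : IsRegressor 𝒢 U)
    (hC : SqBounded U C) (k : ℕ) : ∫ ω, mart U η (2 ^ k) ω ^ 2 ∂μ ≤ σ2 * (C * 2 ^ k) := by
  have hσ : 0 ≤ σ2 := (h.var_nonneg 0).trans (h.var_le 0)
  have hD := h.isMDiff_mul hU.adapted fun j => hU.memLp hC j 4
  simp only [mart]
  rw [hD.integral_sq_sum]
  have h1 : ∀ j, ∫ ω, (U j ω * η j ω) ^ 2 ∂μ ≤ σ2 * ∫ ω, U j ω ^ 2 ∂μ := fun j => by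
    rw [h.integral_mul_sq j (hU.adapted j) (hU.memLp hC j 4)]
    exact mul_le_mul_of_nonneg_right (h.var_le j) (integral_nonneg fun ω => sq_nonneg _)
  refine (Finset.sum_le_sum fun j _ => h1 j).trans ?_
  rw [← Finset.mul_sum]
  refine mul_le_mul_of_nonneg_left ?_ hσ
  have hi : ∀ j, Integrable (fun ω => U j ω ^ 2) μ := fun j => (hU.memLp hC j 2).integrable_sq
  rw [sum_range_two_pow (by simp [hU.zero])]
  have h2 : ∀ k, ∑ j ∈ gen k, ∫ ω, U j ω ^ 2 ∂μ ≤ C * 2 ^ k := fun k => by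
    rw [← integral_finsetSum _ fun j _ => hi j]
    refine (integral_mono (integrable_finsetSum _ fun j _ => hi j) (integrable_const _)
      (hC k)).trans ?_
    simp
  have : Nonempty Ω := μ.nonempty_of_neZero
  have hC0 := hC.nonneg
  induction k with
  | zero => simpa using hC0
  | succ k ih =>
    rw [Finset.sum_range_succ, pow_succ]
    linarith [h2 k]

/-- The crucial second moment bound. As `V j`, for `j` in generation `k`, is known when that
generation is complete but not independent of `mart U η (2 ^ k)`, the bound uses the deterministic
estimate `∑ V j ^ 2 ≤ C 2 ^ k` for this part of the transform; the remaining part, which comes from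
generation `k` itself, is a sum of martingale differences even after multiplication by `V j`. -/
lemma IsNoise.sum_integral_sq_le (h : IsNoise μ 𝒢 η s σ2) {C : ℝ} (hU : IsRegressor 𝒢 U)
    (hV : IsRegressor 𝒢 V) (hCU : SqBounded U C) (hCV : SqBounded V C) (k : ℕ) :
    ∑ j ∈ gen k, ∫ ω, (mart U η j ω * V j ω * η j ω) ^ 2 ∂μ ≤ 4 * σ2 ^ 2 * C ^ 2 * 4 ^ k := by
  have : Nonempty Ω := μ.nonempty_of_neZero
  have hC0 := hCU.nonneg
  have hσ : 0 ≤ σ2 := (h.var_nonneg 0).trans (h.var_le 0)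
  have hV4 : ∀ j, MemLp (fun ω => mart U η j ω * V j ω) 4 μ := fun j => by
    simpa only [mul_comm] using memLp_bdd_mul ((hV.adapted j).mono (𝒢.le j)).aestronglyMeasurable
      (hCV.abs_le hV j) (h.mart_memLp hU hCU j)
  have hk4 : ∀ j, MemLp (fun ω => mart U η (2 ^ k) ω * V j ω) 4 μ := fun j => by
    simpa only [mul_comm] using memLp_bdd_mul ((hV.adapted j).mono (𝒢.le j)).aestronglyMeasurable
      (hCV.abs_le hV j) (h.mart_memLp hU hCU (2 ^ k))
  -- the part of the transform that comes from the same generation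
  have hloc : ∀ j ∈ gen k, ∫ ω, (∑ i ∈ Finset.Ico (2 ^ k) j, V j ω * U i ω * η i ω) ^ 2 ∂μ
      ≤ σ2 * ∑ i ∈ gen k, ∫ ω, (V j ω * U i ω) ^ 2 ∂μ := by
    intro j hj
    have hj' := hj
    simp only [gen, Finset.mem_Ico] at hj'
    have hmem : ∀ i ∈ Finset.Ico (2 ^ k) j, i ∈ gen k := fun i hi => by
      simp only [gen, Finset.mem_Ico] at hi ⊢; omega
    have hm : ∀ i ∈ Finset.Ico (2 ^ k) j, StronglyMeasurable[𝒢 i] (fun ω => V j ω * U i ω) :=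
      fun i hi => ((hV.meas k j hj).mono (𝒢.mono (Finset.mem_Ico.1 hi).1)).mul (hU.adapted i)
    have h4 : ∀ i, MemLp (fun ω => V j ω * U i ω) 4 μ := fun i =>
      memLp_bdd_mul ((hV.adapted j).mono (𝒢.le j)).aestronglyMeasurable (hCV.abs_le hV j)
        (hU.memLp hCU i 4)
    rw [integral_sq_sum_Ico (𝒢 := 𝒢) (D := fun i ω => V j ω * U i ω * η i ω) hj'.1 fun i hi =>
      ⟨((hm i hi).mono (𝒢.mono (Nat.le_succ i))).mul (h.adapted i),
        memLp_two_mul (h4 i) (h.memLp i), h.condExp_mul i (hm i hi) (h4 i)⟩]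
    rw [Finset.mul_sum]
    refine (Finset.sum_le_sum fun i hi => ?_).trans
      (Finset.sum_le_sum_of_subset_of_nonneg hmem fun i _ _ =>
        mul_nonneg hσ (integral_nonneg fun ω => sq_nonneg _))
    rw [h.integral_mul_sq i (hm i hi) (h4 i)]
    exact mul_le_mul_of_nonneg_right (h.var_le i) (integral_nonneg fun ω => sq_nonneg _)
  have hsplit : ∀ j ∈ gen k, ∫ ω, (mart U η j ω * V j ω * η j ω) ^ 2 ∂μ
      ≤ σ2 * (2 * ∫ ω, (mart U η (2 ^ k) ω * V j ω) ^ 2 ∂μ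
        + 2 * (σ2 * ∑ i ∈ gen k, ∫ ω, (V j ω * U i ω) ^ 2 ∂μ)) := by
    intro j hj
    rw [h.integral_mul_sq j (V := fun ω => mart U η j ω * V j ω)
      ((h.mart_adapted hU j).mul (hV.adapted j)) (hV4 j)]
    refine mul_le_mul (h.var_le j) ?_ (integral_nonneg fun ω => sq_nonneg _) hσ
    have he : ∀ ω, mart U η j ω * V j ω = mart U η (2 ^ k) ω * V j ω
        + ∑ i ∈ Finset.Ico (2 ^ k) j, V j ω * U i ω * η i ω := fun ω => by
      simp only [mart]
      rw [← Finset.sum_range_add_sum_Ico _ (two_pow_le_of_mem_gen hj), add_mul]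
      congr 1
      rw [Finset.sum_mul]
      exact Finset.sum_congr rfl fun i _ => by ring
    have hS : MemLp (fun ω => ∑ i ∈ Finset.Ico (2 ^ k) j, V j ω * U i ω * η i ω) 4 μ := by
      have := (hV4 j).sub (hk4 j)
      refine this.congr_norm ?_ (ae_of_all _ fun ω => ?_)
      · exact (this.aestronglyMeasurable.congr (ae_of_all _ fun ω => by simp [he ω]))
      · simp [he ω]
    have i1 := (hk4 j).mono_exponent (q := 4) (p := 2) (by norm_num) |>.integrable_sq
    have i2 := hS.mono_exponent (q := 4) (p := 2) (by norm_num) |>.integrable_sq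
    refine le_trans (integral_mono ((hV4 j).mono_exponent (p := 2) (by norm_num)).integrable_sq
      ((i1.const_mul 2).add (i2.const_mul 2)) fun ω => ?_) ?_
    · simp only [he ω, Pi.add_apply]
      nlinarith [sq_nonneg (mart U η (2 ^ k) ω * V j ω
        - ∑ i ∈ Finset.Ico (2 ^ k) j, V j ω * U i ω * η i ω)]
    · rw [integral_add' (i1.const_mul 2) (i2.const_mul 2), integral_const_mul, integral_const_mul]
      linarith [hloc j hj]
  refine (Finset.sum_le_sum hsplit).trans ?_
  rw [← Finset.mul_sum, Finset.sum_add_distrib, ← Finset.mul_sum, ← Finset.mul_sum,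
    ← Finset.mul_sum]
  have b1 : ∑ j ∈ gen k, ∫ ω, (mart U η (2 ^ k) ω * V j ω) ^ 2 ∂μ ≤ σ2 * C ^ 2 * 4 ^ k := by
    have i1 : ∀ j, Integrable (fun ω => (mart U η (2 ^ k) ω * V j ω) ^ 2) μ := fun j =>
      (hk4 j).mono_exponent (q := 4) (p := 2) (by norm_num) |>.integrable_sq
    have i3 := (h.mart_memLp hU hCU (2 ^ k)).mono_exponent (p := 2) (by norm_num) |>.integrable_sq
    rw [← integral_finsetSum _ fun j _ => i1 j]
    refine le_trans (integral_mono (integrable_finsetSum _ fun j _ => i1 j)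
      (i3.mul_const (C * 2 ^ k)) fun ω => ?_) ?_
    · simp only [mul_pow]
      rw [← Finset.mul_sum]
      exact mul_le_mul_of_nonneg_left (hCV k ω) (sq_nonneg _)
    · rw [integral_mul_const]
      refine (mul_le_mul_of_nonneg_right (h.integral_mart_sq_le hU hCU k) (by positivity)).trans ?_
      have : (4 : ℝ) ^ k = 2 ^ k * 2 ^ k := by rw [← mul_pow]; norm_num
      rw [this]
      apply le_of_eq; ring
  have b2 : ∑ j ∈ gen k, ∑ i ∈ gen k, ∫ ω, (V j ω * U i ω) ^ 2 ∂μ ≤ C ^ 2 * 4 ^ k := by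
    have i1 : ∀ j i, Integrable (fun ω => (V j ω * U i ω) ^ 2) μ := fun j i =>
      (memLp_bdd_mul ((hV.adapted j).mono (𝒢.le j)).aestronglyMeasurable (hCV.abs_le hV j)
        (hU.memLp hCU i 2)).integrable_sq
    have e1 : ∑ j ∈ gen k, ∑ i ∈ gen k, ∫ ω, (V j ω * U i ω) ^ 2 ∂μ
        = ∫ ω, (∑ j ∈ gen k, V j ω ^ 2) * (∑ i ∈ gen k, U i ω ^ 2) ∂μ := by
      simp_rw [Finset.sum_mul_sum, ← mul_pow]
      rw [integral_finsetSum _ fun j _ => integrable_finsetSum _ fun i _ => i1 j i]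
      exact Finset.sum_congr rfl fun j _ => (integral_finsetSum _ fun i _ => i1 j i).symm
    rw [e1]
    refine le_trans (integral_mono_of_nonneg (ae_of_all _ fun ω => by positivity)
      (integrable_const (C * 2 ^ k * (C * 2 ^ k))) (ae_of_all _ fun ω => ?_)) ?_
    · exact mul_le_mul (hCV k ω) (hCU k ω) (Finset.sum_nonneg fun _ _ => sq_nonneg _)
        (by positivity)
    · have : (4 : ℝ) ^ k = 2 ^ k * 2 ^ k := by rw [← mul_pow]; norm_num
      rw [this]
      simp only [integral_const, probReal_univ, smul_eq_mul, one_mul]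
      apply le_of_eq; ring
  have hm := mul_le_mul_of_nonneg_left b2 hσ
  calc _ ≤ σ2 * (2 * (σ2 * C ^ 2 * 4 ^ k) + 2 * (σ2 * (C ^ 2 * 4 ^ k))) := by
        refine mul_le_mul_of_nonneg_left ?_ hσ
        linarith
    _ = _ := by ring

/-- The contribution of the cross terms `M_j V_j η_j` to the increments of the product `M M'`
vanishes in Cesàro mean. -/
lemma IsNoise.ae_cesaro_cross (h : IsNoise μ 𝒢 η s σ2) {C : ℝ} (hU : IsRegressor 𝒢 U)
    (hV : IsRegressor 𝒢 V) (hCU : SqBounded U C) (hCV : SqBounded V C) :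
    ∀ᵐ ω ∂μ, Tendsto (fun n : ℕ => (n : ℝ)⁻¹ * ∑ k ∈ Finset.range n, (2 ^ k : ℝ)⁻¹ *
      ∑ j ∈ gen k, mart U η j ω * V j ω * η j ω) atTop (𝓝 0) := by
  have hV4 : ∀ j, MemLp (fun ω => mart U η j ω * V j ω) 4 μ := fun j => by
    simpa only [mul_comm] using memLp_bdd_mul ((hV.adapted j).mono (𝒢.le j)).aestronglyMeasurable
      (hCV.abs_le hV j) (h.mart_memLp hU hCU j)
  exact (h.isMDiff_mul (fun j => (h.mart_adapted hU j).mul (hV.adapted j)) hV4).ae_tendsto_gen_cesaro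
    (h.sum_integral_sq_le hU hV hCU hCV)

/-- In the diagonal terms of the increments of the product `M M'`, the squared noise may be replaced
by its conditional variance in Cesàro mean. The truncation of the conditional fourth moments gives
the centred squares a finite variance. -/
lemma IsNoise.ae_cesaro_sq (h : IsNoise μ 𝒢 η s σ2) {C : ℝ} (hU : IsRegressor 𝒢 U)
    (hV : IsRegressor 𝒢 V) (hCU : SqBounded U C) (hCV : SqBounded V C) :
    ∀ᵐ ω ∂μ, Tendsto (fun n : ℕ => (n : ℝ)⁻¹ * ∑ k ∈ Finset.range n, (2 ^ k : ℝ)⁻¹ *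
      ∑ j ∈ gen k, (U j ω * V j ω * fourthInd μ 𝒢 η C j ω) * (η j ω ^ 2 - s j))
        atTop (𝓝 0) := by
  have : Nonempty Ω := μ.nonempty_of_neZero
  have hC0 := hCU.nonneg
  have hm : ∀ j, StronglyMeasurable[𝒢 j] (fun ω => U j ω * V j ω) := fun j =>
    (hU.adapted j).mul (hV.adapted j)
  have hK : ∀ j ω, |U j ω * V j ω| ≤ (1 + C * 2 ^ Nat.log 2 j) * (1 + C * 2 ^ Nat.log 2 j) :=
    fun j ω => by
      rw [abs_mul]
      exact mul_le_mul (hCU.abs_le hU j ω) (hCV.abs_le hV j ω) (abs_nonneg _) (by positivity)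
  refine (h.isMDiff_sq C hm hK).ae_tendsto_gen_cesaro (C := C * C ^ 2) fun k => ?_
  refine (Finset.sum_le_sum fun j _ => h.integral_sq_le hm hK hC0 j).trans ?_
  rw [← Finset.mul_sum, mul_assoc]
  refine mul_le_mul_of_nonneg_left ?_ hC0
  have i1 : ∀ j, Integrable (fun ω => (U j ω * V j ω) ^ 2) μ := fun j =>
    (memLp_bdd_mul ((hU.adapted j).mono (𝒢.le j)).aestronglyMeasurable (hCU.abs_le hU j)
      (hV.memLp hCV j 2)).integrable_sq
  rw [← integral_finsetSum _ fun j _ => i1 j]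
  refine le_trans (integral_mono (integrable_finsetSum _ fun j _ => i1 j)
    (integrable_const (C * 2 ^ k * (C * 2 ^ k))) fun ω => ?_) ?_
  · refine le_trans ?_ (mul_le_mul (hCU k ω) (hCV k ω) (Finset.sum_nonneg fun _ _ => sq_nonneg _)
      (by positivity))
    rw [Finset.sum_mul_sum]
    refine Finset.sum_le_sum fun j hj => ?_
    simp only [mul_pow]
    exact Finset.single_le_sum (f := fun i => U j ω ^ 2 * V i ω ^ 2) (fun i _ => by positivity) hj
  · have : (4 : ℝ) ^ k = 2 ^ k * 2 ^ k := by rw [← mul_pow]; norm_num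
    rw [this]
    simp only [integral_const, probReal_univ, smul_eq_mul, one_mul]
    apply le_of_eq; ring

/-- The regressors, set to zero in the generations where the squares of `U` and `V` are too
large. -/
noncomputable def trunc (U V W : ℕ → Ω → ℝ) (C : ℝ) (j : ℕ) : Ω → ℝ :=
  {ω | ∑ i ∈ gen (Nat.log 2 j), (U i ω ^ 2 + V i ω ^ 2) ≤ C * 2 ^ Nat.log 2 j}.indicator (W j)

lemma IsRegressor.trunc (hU : IsRegressor 𝒢 U) (hV : IsRegressor 𝒢 V) {W : ℕ → Ω → ℝ}
    (hW : IsRegressor 𝒢 W) (C : ℝ) : IsRegressor 𝒢 (trunc U V W C) where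
  zero := by simp [BAR.trunc, hW.zero]
  meas k j hj := by
    refine (hW.meas k j hj).indicator ?_
    rw [log_eq_of_mem_gen hj]
    have : StronglyMeasurable[𝒢 (2 ^ k)] (fun ω => ∑ i ∈ gen k, (U i ω ^ 2 + V i ω ^ 2)) :=
      Finset.stronglyMeasurable_fun_sum _ fun i hi =>
        ((hU.meas k i hi).pow 2).add ((hV.meas k i hi).pow 2)
    exact @measurableSet_le _ _ _ _ _ (𝒢 (2 ^ k)) _ _ _ _ _ this.measurable measurable_const

lemma SqBounded.trunc {W : ℕ → Ω → ℝ} {C : ℝ} (hC : 0 ≤ C)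
    (hW : ∀ j ω, W j ω ^ 2 ≤ U j ω ^ 2 + V j ω ^ 2) : SqBounded (trunc U V W C) C := by
  intro k ω
  by_cases h : ∑ i ∈ gen k, (U i ω ^ 2 + V i ω ^ 2) ≤ C * 2 ^ k
  · refine (Finset.sum_le_sum fun j hj => ?_).trans h
    rw [BAR.trunc, log_eq_of_mem_gen hj, Set.indicator_of_mem (by exact h)]
    exact hW j ω
  · rw [Finset.sum_eq_zero fun j hj => ?_]
    · positivity
    · rw [BAR.trunc, log_eq_of_mem_gen hj, Set.indicator_of_notMem (by exact h)]
      norm_num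

/-- The quadratic strong law for a pair of scalar martingale transforms: writing
`M = mart U η` and `M' = mart V η`, the normalized products `2⁻ᵏ M M'` at the times `2ᵏ` obey the
recursion `P (k + 1) = P k / 2 + r k`, where the Cesàro means of `r` converge to `l / 2`. -/
lemma IsNoise.quadratic_law (h : IsNoise μ 𝒢 η s σ2) (hU : IsRegressor 𝒢 U)
    (hV : IsRegressor 𝒢 V)
    (hbU : ∀ᵐ ω ∂μ, ∃ C, ∀ k, ∑ j ∈ gen k, U j ω ^ 2 ≤ C * 2 ^ k)
    (hbV : ∀ᵐ ω ∂μ, ∃ C, ∀ k, ∑ j ∈ gen k, V j ω ^ 2 ≤ C * 2 ^ k) {l : ℝ}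
    (hl : ∀ᵐ ω ∂μ, Tendsto (fun k => (2 ^ k : ℝ)⁻¹ * ∑ j ∈ gen k, U j ω * V j ω * s j) atTop
      (𝓝 l)) :
    ∀ᵐ ω ∂μ, Tendsto (fun n : ℕ => (n : ℝ)⁻¹ * ∑ k ∈ Finset.range n,
      (2 ^ k : ℝ)⁻¹ * (mart U η (2 ^ k) ω * mart V η (2 ^ k) ω)) atTop (𝓝 l) := by
  have tU : ∀ C : ℕ, IsRegressor 𝒢 (trunc U V U C) := fun C => hU.trunc hV hU C
  have tV : ∀ C : ℕ, IsRegressor 𝒢 (trunc U V V C) := fun C => hU.trunc hV hV C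
  have sU : ∀ C : ℕ, SqBounded (trunc U V U C) (C : ℝ) := fun C =>
    SqBounded.trunc (Nat.cast_nonneg C) fun j ω => le_add_of_nonneg_right (sq_nonneg _)
  have sV : ∀ C : ℕ, SqBounded (trunc U V V C) (C : ℝ) := fun C =>
    SqBounded.trunc (Nat.cast_nonneg C) fun j ω => le_add_of_nonneg_left (sq_nonneg _)
  have a1 := ae_all_iff.2 fun C : ℕ => h.ae_cesaro_cross (tU C) (tV C) (sU C) (sV C)
  have a2 := ae_all_iff.2 fun C : ℕ => h.ae_cesaro_cross (tV C) (tU C) (sV C) (sU C)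
  have a3 := ae_all_iff.2 fun C : ℕ => h.ae_cesaro_sq (tU C) (tV C) (sU C) (sV C)
  filter_upwards [a1, a2, a3, hbU, hbV, hl, h.fourth] with ω b1 b2 b3 ⟨C1, hC1⟩ ⟨C2, hC2⟩ hlω
    ⟨C3, hC3⟩
  -- for this `ω` and this `C`, none of the truncations is active
  obtain ⟨C, hC⟩ := exists_nat_ge (max (C1 + C2) C3)
  have hCsum : C1 + C2 ≤ C := (le_max_left _ _).trans hC
  have hC3' : C3 ≤ C := (le_max_right _ _).trans hC
  have hmem : ∀ k, ∑ i ∈ gen k, (U i ω ^ 2 + V i ω ^ 2) ≤ (C : ℝ) * 2 ^ k := fun k => by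
    rw [Finset.sum_add_distrib]
    have : (C1 + C2) * (2 : ℝ) ^ k ≤ C * 2 ^ k := by gcongr
    linarith [hC1 k, hC2 k]
  have eU : ∀ j, trunc U V U C j ω = U j ω := fun j => by
    rw [trunc]; exact Set.indicator_of_mem (by exact hmem _) _
  have eV : ∀ j, trunc U V V C j ω = V j ω := fun j => by
    rw [trunc]; exact Set.indicator_of_mem (by exact hmem _) _
  have eI : ∀ j, fourthInd μ 𝒢 η C j ω = 1 := fun j => by
    rw [fourthInd]; exact Set.indicator_of_mem (by exact (hC3 j).trans hC3') _
  have eMU : ∀ j, mart (trunc U V U C) η j ω = mart U η j ω := fun j => by simp only [mart, eU]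
  have eMV : ∀ j, mart (trunc U V V C) η j ω = mart V η j ω := fun j => by simp only [mart, eV]
  have c1 := b1 C
  have c2 := b2 C
  have c3 := b3 C
  simp only [eU, eV, eI, eMU, eMV, mul_one] at c1 c2 c3
  refine tendsto_cesaro_of_recursion (r := fun k =>
    (1 / 2) * ((2 ^ k : ℝ)⁻¹ * ∑ j ∈ gen k, mart U η j ω * V j ω * η j ω
      + (2 ^ k : ℝ)⁻¹ * ∑ j ∈ gen k, mart V η j ω * U j ω * η j ω
      + (2 ^ k : ℝ)⁻¹ * ∑ j ∈ gen k, U j ω * V j ω * (η j ω ^ 2 - s j)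
      + (2 ^ k : ℝ)⁻¹ * ∑ j ∈ gen k, U j ω * V j ω * s j)) ?_ ?_
  · intro k
    -- summation by parts for the product of the two transforms
    have hprod : ∀ n, mart U η n ω * mart V η n ω = ∑ j ∈ Finset.range n,
        (mart U η j ω * V j ω * η j ω + mart V η j ω * U j ω * η j ω
          + U j ω * V j ω * (η j ω ^ 2 - s j) + U j ω * V j ω * s j) := by
      intro n
      induction n with
      | zero => simp [mart]
      | succ n ih =>
        rw [Finset.sum_range_succ, ← ih]
        have e1 : mart U η (n + 1) ω = mart U η n ω + U n ω * η n ω := by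
          simp [mart, Finset.sum_range_succ]
        have e2 : mart V η (n + 1) ω = mart V η n ω + V n ω * η n ω := by
          simp [mart, Finset.sum_range_succ]
        rw [e1, e2]
        ring
    rw [hprod (2 ^ (k + 1)), sum_range_two_pow_succ, ← hprod (2 ^ k), Finset.sum_add_distrib,
      Finset.sum_add_distrib, Finset.sum_add_distrib, pow_succ, mul_inv]
    ring
  · have := (((c1.add c2).add c3).add hlω.cesaro).const_mul (1 / 2)
    have e : (1 : ℝ) / 2 * (0 + 0 + 0 + l) = l / 2 := by ring
    rw [e] at this
    refine this.congr fun n => ?_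
    rw [← Finset.mul_sum, Finset.sum_add_distrib, Finset.sum_add_distrib, Finset.sum_add_distrib]
    ring

end QuadraticLaw

/-! ### Conditional independence -/

section CondIndep

variable {Ω : Type*} {m mΩ : MeasurableSpace Ω} {μ : Measure Ω} [IsProbabilityMeasure μ]

lemma setIntegral_mul_condExp (hm : m ≤ mΩ) {f g : Ω → ℝ} {F : Set Ω}
    (hF : MeasurableSet[m] F) (hf : StronglyMeasurable[m] f)
    (hfg : Integrable (fun ω => f ω * g ω) μ) (hg : Integrable g μ) :
    ∫ ω in F, f ω * g ω ∂μ = ∫ ω in F, f ω * (μ[g | m]) ω ∂μ := by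
  rw [← setIntegral_condExp hm hfg hF]
  exact setIntegral_congr_ae (hm _ hF)
    ((condExp_mul_of_stronglyMeasurable_left hf hfg hg).mono fun ω h _ => h)

variable {ι β : Type*} [MeasurableSpace β]

/-- If the event `R` is conditionally independent of the variable `f`, then its indicator may be
replaced by its conditional probability. -/
lemma setIntegral_inter_of_condIndep (hm : m ≤ mΩ) {f : Ω → β}
    (hf : Measurable f) {R F : Set Ω} (hR : MeasurableSet R) (hF : MeasurableSet[m] F)
    (h : ∀ E : Set β, MeasurableSet E →
      μ⟦R ∩ f ⁻¹' E | m⟧ =ᵐ[μ] fun ω => (μ⟦R | m⟧) ω * (μ⟦f ⁻¹' E | m⟧) ω)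
    {g : β → ℝ} (hg : Measurable g) (hint : Integrable (fun ω => g (f ω)) μ) :
    ∫ ω in F ∩ R, g (f ω) ∂μ = ∫ ω in F ∩ R, (μ[fun ω => g (f ω) | m]) ω ∂μ := by
  set q : Ω → ℝ := μ⟦R | m⟧ with hq
  have hqm : StronglyMeasurable[m] q := stronglyMeasurable_condExp
  have hqi : Integrable q μ := integrable_condExp
  have hRi : Integrable (R.indicator fun _ => (1 : ℝ)) μ := (integrable_const 1).indicator hR
  have hq0 : 0 ≤ᵐ[μ] q := condExp_nonneg (ae_of_all _ fun ω =>
    Set.indicator_nonneg (fun _ _ => zero_le_one) ω)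
  have hq1 : ∀ᵐ ω ∂μ, ‖q ω‖ ≤ 1 := by
    have h1 : q ≤ᵐ[μ] μ[fun _ => (1 : ℝ) | m] := condExp_mono hRi (integrable_const 1)
      (ae_of_all _ fun ω => Set.indicator_le_self' (fun _ _ => zero_le_one) ω)
    rw [condExp_const hm] at h1
    filter_upwards [hq0, h1] with ω h2 h3
    rw [Real.norm_of_nonneg h2]; exact h3
  have hF' := hm _ hF
  -- on `F`, the law of `f` restricted to `R` has density `q`; this extends the hypothesis from
  -- events to integrable functions of `f`
  have hmeas : (μ.restrict (F ∩ R)).map f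
      = ((μ.restrict F).withDensity fun ω => ENNReal.ofReal (q ω)).map f := by
    ext E hE
    have hfE := hf hE
    rw [Measure.map_apply hf hE, Measure.map_apply hf hE, Measure.restrict_apply hfE,
      withDensity_apply _ hfE, Measure.restrict_restrict hfE,
      ← ofReal_integral_eq_lintegral_ofReal hqi.restrict (ae_restrict_of_ae hq0)]
    have hEi : Integrable ((f ⁻¹' E).indicator fun _ => (1 : ℝ)) μ :=
      (integrable_const 1).indicator hfE
    have e1 : ∫ ω in f ⁻¹' E ∩ F, q ω ∂μ
        = ∫ ω in F, q ω * (f ⁻¹' E).indicator (fun _ => (1 : ℝ)) ω ∂μ := by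
      rw [Set.inter_comm, ← setIntegral_indicator hfE]
      refine integral_congr_ae (ae_of_all _ fun ω => ?_)
      by_cases hω : ω ∈ f ⁻¹' E
      · simp only [Set.indicator_of_mem hω, mul_one]
      · simp only [Set.indicator_of_notMem hω, mul_zero]
    have hqE : Integrable (fun ω => q ω * (f ⁻¹' E).indicator (fun _ => (1 : ℝ)) ω) μ :=
      hEi.bdd_mul hqi.aestronglyMeasurable hq1
    have e2 : ∫ ω in F, q ω * (f ⁻¹' E).indicator (fun _ => (1 : ℝ)) ω ∂μ
        = ∫ ω in F, (R ∩ f ⁻¹' E).indicator (fun _ => (1 : ℝ)) ω ∂μ := by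
      rw [setIntegral_mul_condExp hm hF hqm hqE hEi,
        ← setIntegral_condExp (f := (R ∩ f ⁻¹' E).indicator fun _ => (1 : ℝ)) hm
          ((integrable_const 1).indicator (hR.inter hfE)) hF]
      exact setIntegral_congr_ae hF' ((h E hE).mono fun ω h3 _ => h3.symm)
    rw [e1, e2, setIntegral_indicator (hR.inter hfE), setIntegral_const, smul_eq_mul, mul_one,
      measureReal_def, ENNReal.ofReal_toReal (measure_ne_top _ _)]
    congr 1
    ext ω
    simp only [Set.mem_inter_iff]
    tauto
  have hqg : Integrable (fun ω => q ω * g (f ω)) μ := hint.bdd_mul hqi.aestronglyMeasurable hq1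
  have s1 : ∫ ω in F ∩ R, g (f ω) ∂μ = ∫ ω in F, q ω * g (f ω) ∂μ := by
    rw [← integral_map (μ := μ.restrict (F ∩ R)) hf.aemeasurable hg.aestronglyMeasurable, hmeas,
      integral_map hf.aemeasurable hg.aestronglyMeasurable,
      integral_withDensity_eq_integral_toReal_smul
        (hqm.mono hm).measurable.ennreal_ofReal (ae_of_all _ fun _ => ENNReal.ofReal_lt_top)]
    refine integral_congr_ae (ae_restrict_of_ae ?_)
    filter_upwards [hq0] with ω h0
    rw [ENNReal.toReal_ofReal h0, smul_eq_mul]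
  set G : Ω → ℝ := μ[fun ω => g (f ω) | m] with hG
  have hGi : Integrable G μ := integrable_condExp
  have hGR : Integrable (fun ω => G ω * R.indicator (fun _ => (1 : ℝ)) ω) μ := by
    refine (hGi.indicator hR).congr (ae_of_all _ fun ω => ?_)
    by_cases hω : ω ∈ R
    · simp only [Set.indicator_of_mem hω, mul_one]
    · simp only [Set.indicator_of_notMem hω, mul_zero]
  have s2 : ∫ ω in F, G ω * R.indicator (fun _ => (1 : ℝ)) ω ∂μ = ∫ ω in F, G ω * q ω ∂μ :=
    setIntegral_mul_condExp hm hF stronglyMeasurable_condExp hGR hRi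
  rw [s1, setIntegral_mul_condExp hm hF hqm hqg hint, ← setIntegral_indicator hR]
  simp_rw [mul_comm (q _)]
  rw [← s2]
  refine integral_congr_ae (ae_of_all _ fun ω => ?_)
  by_cases hω : ω ∈ R
  · simp only [Set.indicator_of_mem hω, mul_one]
  · simp only [Set.indicator_of_notMem hω, mul_zero]

/-- In a conditionally independent family, the other members bring no information about a given
member beyond that of the conditioning `σ`-algebra. -/
lemma condExp_sup_of_condIndepFamily [DecidableEq ι] (hm : m ≤ mΩ)
    {s t : Finset ι} {f : ι → Ω → β} (hf : ∀ i ∈ s, Measurable (f i))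
    (h : CondIndepFamily μ m s f) {j : ι} (hj : j ∈ s) (hts : t ⊆ s) (hjt : j ∉ t) {g : β → ℝ}
    (hg : Measurable g) (hint : Integrable (fun ω => g (f j ω)) μ) :
    μ[fun ω => g (f j ω) | m ⊔ ⨆ l ∈ t, MeasurableSpace.comap (f l) inferInstance]
      =ᵐ[μ] μ[fun ω => g (f j ω) | m] := by
  set m' := m ⊔ ⨆ l ∈ t, MeasurableSpace.comap (f l) inferInstance with hm'def
  have hm' : m' ≤ mΩ := sup_le hm (iSup₂_le fun l hl => (hf l (hts hl)).comap_le)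
  -- a π-system that generates `m'`, on which the two integrals are compared
  set π : Set (Set Ω) := {S | ∃ F, MeasurableSet[m] F ∧ ∃ D : ι → Set β,
    (∀ l, MeasurableSet (D l)) ∧ S = F ∩ ⋂ l ∈ t, f l ⁻¹' D l} with hπ
  have hpi : IsPiSystem π := by
    rintro _ ⟨F, hF, D, hD, rfl⟩ _ ⟨F', hF', D', hD', rfl⟩ -
    refine ⟨F ∩ F', hF.inter hF', fun l => D l ∩ D' l, fun l => (hD l).inter (hD' l), ?_⟩
    ext ω
    simp only [Set.mem_inter_iff, Set.mem_iInter, Set.mem_preimage]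
    constructor
    · rintro ⟨⟨h1, h2⟩, h3, h4⟩
      exact ⟨⟨h1, h3⟩, fun l hl => ⟨h2 l hl, h4 l hl⟩⟩
    · rintro ⟨⟨h1, h3⟩, h2⟩
      exact ⟨⟨h1, fun l hl => (h2 l hl).1⟩, h3, fun l hl => (h2 l hl).2⟩
  have hgen : m' = MeasurableSpace.generateFrom π := by
    refine le_antisymm (sup_le ?_ (iSup₂_le fun l hl => ?_)) ?_
    · intro F hF
      refine MeasurableSpace.measurableSet_generateFrom ⟨F, hF, fun _ => Set.univ,
        fun _ => MeasurableSet.univ, by simp⟩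
    · rintro _ ⟨D, hD, rfl⟩
      refine MeasurableSpace.measurableSet_generateFrom ⟨Set.univ, MeasurableSet.univ,
        fun l' => if l' = l then D else Set.univ, fun l' => ?_, ?_⟩
      · dsimp only
        split_ifs
        · exact hD
        · exact MeasurableSet.univ
      · ext ω
        simp only [Set.univ_inter, Set.mem_iInter, Set.mem_preimage]
        constructor
        · intro h1 l' _
          split_ifs with h2
          · rw [h2]; exact h1
          · trivial
        · intro h1
          simpa using h1 l hl
    · refine MeasurableSpace.generateFrom_le ?_
      rintro _ ⟨F, hF, D, hD, rfl⟩
      refine MeasurableSet.inter ((le_sup_left : m ≤ m') _ hF) ?_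
      refine Finset.measurableSet_biInter _ fun l hl => ?_
      have : MeasurableSpace.comap (f l) inferInstance ≤ m' :=
        (le_iSup₂ (f := fun l (_ : l ∈ t) => MeasurableSpace.comap (f l) inferInstance) l hl).trans
          le_sup_right
      exact this _ ⟨D l, hD l, rfl⟩
  symm
  refine ae_eq_condExp_of_forall_setIntegral_eq hm' hint (fun _ _ _ => integrable_condExp.integrableOn)
    ?_ (stronglyMeasurable_condExp.mono (le_sup_left : m ≤ m')).aestronglyMeasurable
  intro S hS _
  induction S, hS using MeasurableSpace.induction_on_inter hgen hpi with
  | empty => simp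
  | basic S hS =>
    obtain ⟨F, hF, D, hD, rfl⟩ := hS
    refine (setIntegral_inter_of_condIndep hm (hf j hj) ?_ hF ?_ hg hint).symm
    · exact Finset.measurableSet_biInter _ fun l hl => hf l (hts hl) (hD l)
    · intro E hE
      have h1 := h t hts D fun l _ => hD l
      have h2 := h (insert j t) (Finset.insert_subset hj hts)
        (Function.update D j E) fun l _ => by
          rcases eq_or_ne l j with rfl | hl
          · simpa using hE
          · simpa [hl] using hD l
      have hne : ∀ l ∈ t, l ≠ j := fun l hl he => hjt (he ▸ hl)
      have e1 : (⋂ i ∈ insert j t, f i ⁻¹' Function.update D j E i)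
          = (⋂ l ∈ t, f l ⁻¹' D l) ∩ f j ⁻¹' E := by
        ext ω
        simp only [Finset.mem_insert, Set.mem_iInter, Set.mem_preimage, Set.mem_inter_iff]
        constructor
        · intro h3
          refine ⟨fun l hl => ?_, ?_⟩
          · have := h3 l (Or.inr hl)
            rwa [Function.update_of_ne (hne l hl)] at this
          · simpa using h3 j (Or.inl rfl)
        · rintro ⟨h3, h4⟩ l (rfl | hl)
          · simpa using h4
          · rw [Function.update_of_ne (hne l hl)]; exact h3 l hl
      rw [e1] at h2
      filter_upwards [h1, h2] with ω h3 h4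
      rw [h4, h3, Finset.prod_insert hjt, mul_comm]
      congr 1
      · exact Finset.prod_congr rfl fun l hl => by rw [Function.update_of_ne (hne l hl)]
      · rw [Function.update_self]
  | compl S hS ih =>
    have h1 := integral_add_compl (hm' _ hS) hint
    have h2 := integral_add_compl (μ := μ) (hm' _ hS)
      (integrable_condExp (m := m) (f := fun ω => g (f j ω)))
    rw [integral_condExp hm] at h2
    linarith [ih (measure_lt_top _ _)]
  | iUnion S hd hS ih =>
    rw [integral_iUnion (fun i => hm' _ (hS i)) hd integrable_condExp.integrableOn,
      integral_iUnion (fun i => hm' _ (hS i)) hd hint.integrableOn]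
    exact tsum_congr fun i => ih i (measure_lt_top _ _)

end CondIndep

/-! ### The noise of the autoregressive process in linear time -/

section Model

variable {Ω : Type*} [mΩ : MeasurableSpace Ω] {μ : Measure Ω}
  {p : ℕ} {a b : Fin (p + 1) → ℝ} {σ2 ρ : ℝ} {X ε : ℕ → Ω → ℝ}

/-- The standing assumptions on the process and its noise. -/
structure IsModel (μ : Measure Ω) (p : ℕ) (a b : Fin (p + 1) → ℝ) (σ2 ρ : ℝ) (X ε : ℕ → Ω → ℝ) :
    Prop where
  one_le : 1 ≤ p
  meas : ∀ k, 1 ≤ k → Measurable (X k)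
  init : ∀ k, 1 ≤ k → k < 2 ^ p → MemLp (X k) 8 μ
  proc : IsProcess a b X ε
  contr : Contracting (companion a) (companion b)
  var : NoiseVariance μ p X ε σ2
  cov : NoiseCovariance μ p X ε σ2 ρ
  four : NoiseFourthMoment μ p X ε

variable [IsProbabilityMeasure μ]

/-- The `σ`-algebra `σ(X 1, …, X (2 j - 1))`: everything that is known before the offspring of the
individual `j` is born. -/
def treeFiltration (X : ℕ → Ω → ℝ) (hX : ∀ k, 1 ≤ k → Measurable (X k)) : Filtration ℕ mΩ where
  seq j := ⨆ k ∈ Finset.Ico 1 (2 * j), MeasurableSpace.comap (X k) inferInstance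
  mono' i j hij := iSup₂_le fun k hk =>
    le_iSup₂ (f := fun k (_ : k ∈ Finset.Ico 1 (2 * j)) =>
      MeasurableSpace.comap (X k) (inferInstance : MeasurableSpace ℝ)) k
      (by simp only [Finset.mem_Ico] at hk ⊢; omega)
  le' j := iSup₂_le fun k hk => (hX k (Finset.mem_Ico.1 hk).1).comap_le

variable {hX : ∀ k, 1 ≤ k → Measurable (X k)}

lemma treeFiltration_two_pow (n : ℕ) : treeFiltration X hX (2 ^ n) = sigmaAlg X n := by
  change (⨆ k ∈ Finset.Ico 1 (2 * 2 ^ n), MeasurableSpace.comap (X k) _) = _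
  rw [sigmaAlg, tree, pow_succ']

lemma stronglyMeasurable_of_mem_Ico {j k : ℕ} (hk : 1 ≤ k) (hkj : k < 2 * j) :
    StronglyMeasurable[treeFiltration X hX j] (X k) := by
  have h1 : MeasurableSpace.comap (X k) inferInstance ≤ treeFiltration X hX j :=
    le_iSup₂ (f := fun k (_ : k ∈ Finset.Ico 1 (2 * j)) =>
      MeasurableSpace.comap (X k) (inferInstance : MeasurableSpace ℝ)) k
      (Finset.mem_Ico.2 ⟨hk, hkj⟩)
  exact (measurable_iff_comap_le.2 h1).stronglyMeasurable

lemma one_le_div_two_pow {n : ℕ} (hn : 2 ^ (p - 1) ≤ n) (i : Fin p) : 1 ≤ n / 2 ^ (i : ℕ) := by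
  rw [Nat.one_le_div_iff (by positivity)]
  exact (Nat.pow_le_pow_right (by norm_num) (by omega)).trans hn

lemma ancestor_stronglyMeasurable {m : MeasurableSpace Ω} {c : Fin (p + 1) → ℝ} {n : ℕ}
    (hn : 2 ^ (p - 1) ≤ n)
    (h : ∀ k, 1 ≤ k → k ≤ n → StronglyMeasurable[m] (X k)) :
    StronglyMeasurable[m] (fun ω => c 0 + ∑ k : Fin p, c k.succ * X (n / 2 ^ (k : ℕ)) ω) := by
  refine stronglyMeasurable_const.add (Finset.stronglyMeasurable_fun_sum _ fun i _ => ?_)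
  exact (h _ (one_le_div_two_pow hn i) (Nat.div_le_self _ _)).const_mul _

/-- The coefficients for the offspring of type `c`: `a` for even and `b` for odd individuals. -/
def coeff (a b : Fin (p + 1) → ℝ) (c : Fin 2) : Fin (p + 1) → ℝ := if c = 0 then a else b

lemma IsModel.recursion (h : IsModel μ p a b σ2 ρ X ε) {n : ℕ} (hn : 2 ^ (p - 1) ≤ n) (c : Fin 2)
    (ω : Ω) : X (2 * n + c) ω = coeff a b c 0
      + ∑ k : Fin p, coeff a b c k.succ * X (n / 2 ^ (k : ℕ)) ω + ε (2 * n + c) ω := by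
  fin_cases c
  · simpa [coeff] using (h.proc n hn ω).1
  · simpa [coeff] using (h.proc n hn ω).2

lemma IsModel.noise_stronglyMeasurable (h : IsModel μ p a b σ2 ρ X ε) {n : ℕ}
    (hn : 2 ^ (p - 1) ≤ n) (c : Fin 2) :
    StronglyMeasurable[treeFiltration X hX (n + 1)] (ε (2 * n + c)) := by
  have h1 : ε (2 * n + c) = fun ω => X (2 * n + c) ω - (coeff a b c 0
      + ∑ k : Fin p, coeff a b c k.succ * X (n / 2 ^ (k : ℕ)) ω) := by
    ext ω; rw [h.recursion hn c ω]; ring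
  have hn1 : 1 ≤ n := Nat.one_le_two_pow.trans hn
  rw [h1]
  refine (stronglyMeasurable_of_mem_Ico (by omega) (by omega)).sub
    (ancestor_stronglyMeasurable hn fun k hk hkn => stronglyMeasurable_of_mem_Ico hk (by omega))

/-- The noises of the two sisters with mother `k`. -/
def noisePair (ε : ℕ → Ω → ℝ) (k : ℕ) (ω : Ω) : ℝ × ℝ := (ε (2 * k) ω, ε (2 * k + 1) ω)

lemma le_log_of_le {n : ℕ} (hn : 2 ^ (p - 1) ≤ n) : p - 1 ≤ Nat.log 2 n :=
  (Nat.le_log_iff_pow_le (by norm_num) (by have : 0 < 2 ^ (p - 1) := by positivity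
                                           omega)).2 hn

lemma two_pow_le_of_mem_gen_le {n k : ℕ} (hn : p - 1 ≤ n) (hk : k ∈ gen n) : 2 ^ (p - 1) ≤ k :=
  (Nat.pow_le_pow_right (by norm_num) hn).trans (two_pow_le_of_mem_gen hk)

lemma IsModel.noisePair_measurable (h : IsModel μ p a b σ2 ρ X ε) {n : ℕ} (hn : 2 ^ (p - 1) ≤ n) :
    Measurable (noisePair ε n) := by
  have h1 := h.noise_stronglyMeasurable (hX := h.meas) hn 0
  have h2 := h.noise_stronglyMeasurable (hX := h.meas) hn 1
  exact (h1.mono ((treeFiltration X h.meas).le _)).measurable.prodMk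
    (h2.mono ((treeFiltration X h.meas).le _)).measurable

lemma condExp_eq_of_le_of_le {m₁ m₂ m₃ mΩ : MeasurableSpace Ω} {μ : Measure Ω}
    [IsProbabilityMeasure μ] (h12 : m₁ ≤ m₂) (h23 : m₂ ≤ m₃)
    (h3 : m₃ ≤ mΩ) {f : Ω → ℝ} (h : μ[f | m₃] =ᵐ[μ] μ[f | m₁]) : μ[f | m₂] =ᵐ[μ] μ[f | m₁] := by
  have e1 := condExp_condExp_of_le (μ := μ) (f := f) h23 h3
  have e2 := condExp_congr_ae (m := m₂) h
  rw [condExp_of_stronglyMeasurable (h23.trans h3) (stronglyMeasurable_condExp.mono h12)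
    integrable_condExp] at e2
  exact e1.symm.trans e2

/-- The `σ`-algebra generated by the first `n` generations and by the noises of the offspring of
the individuals `l ∈ t`. -/
@[reducible] def siblingAlg (X ε : ℕ → Ω → ℝ) (n : ℕ) (t : Finset ℕ) : MeasurableSpace Ω :=
  sigmaAlg X n ⊔ ⨆ l ∈ t, MeasurableSpace.comap (noisePair ε l) inferInstance

/-- Given the individuals of the generation of `j` and before, the noises of the offspring of
elder individuals of that generation bring no information on the noise of the offspring of `j`. -/
lemma IsModel.condExp_eq (h : IsModel μ p a b σ2 ρ X ε) {j : ℕ} (hj : 2 ^ (p - 1) ≤ j)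
    {g : ℝ × ℝ → ℝ} (hg : Measurable g) (hint : Integrable (fun ω => g (noisePair ε j ω)) μ) :
    μ[fun ω => g (noisePair ε j ω) | treeFiltration X h.meas j]
      =ᵐ[μ] μ[fun ω => g (noisePair ε j ω) | sigmaAlg X (Nat.log 2 j)] := by
  set n := Nat.log 2 j with hndef
  set 𝒢 := treeFiltration X h.meas
  have hj0 : j ≠ 0 := by have : 0 < 2 ^ (p - 1) := by positivity
                         omega
  have hjn : j ∈ gen n := mem_gen_log hj0
  have hpn : p - 1 ≤ n := le_log_of_le hj
  have hgn : ∀ i ∈ gen n, 2 ^ (p - 1) ≤ i := fun i hi => two_pow_le_of_mem_gen_le hpn hi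
  have hFle : sigmaAlg X n ≤ 𝒢 j := by
    rw [← treeFiltration_two_pow (hX := h.meas)]
    exact 𝒢.mono (two_pow_le_of_mem_gen hjn)
  have hF : sigmaAlg X n ≤ mΩ := hFle.trans (𝒢.le j)
  set t := (gen n).filter (· < j) with ht
  have h1 := condExp_sup_of_condIndepFamily (μ := μ) hF (s := gen n) (t := t)
    (f := noisePair ε) (j := j) (fun i hi => h.noisePair_measurable (hgn i hi))
    ((h.cov.2 n hpn).2) hjn (Finset.filter_subset _ _) (by simp [ht]) hg hint
  have hm'le : siblingAlg X ε n t ≤ mΩ := sup_le hF (iSup₂_le fun l hl =>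
    (h.noisePair_measurable (hgn l (Finset.mem_filter.1 hl).1)).comap_le)
  have hold : ∀ k, 1 ≤ k → k < 2 ^ (n + 1) →
      StronglyMeasurable[siblingAlg X ε n t] (X k) := fun k hk hkn => by
    have h2 := stronglyMeasurable_of_mem_Ico (X := X) (hX := h.meas) (j := 2 ^ n) hk
      (by rw [← pow_succ']; exact hkn)
    rw [treeFiltration_two_pow] at h2
    exact h2.mono le_sup_left
  -- an individual of the next generation born before the offspring of `j` is a function of its
  -- ancestors and of the noise of its elder mother
  have hG : 𝒢 j ≤ siblingAlg X ε n t := by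
    refine iSup₂_le fun k hk => ?_
    rw [Finset.mem_Ico] at hk
    rw [← measurable_iff_comap_le]
    refine StronglyMeasurable.measurable ?_
    rcases lt_or_ge k (2 ^ (n + 1)) with hkn | hkn
    · exact hold k hk.1 hkn
    · have hl : k / 2 ∈ t := by
        simp only [gen, Finset.mem_Ico] at hjn
        rw [pow_succ] at hkn hjn
        simp only [ht, gen, Finset.mem_filter, Finset.mem_Ico, pow_succ]
        omega
      have hlg := (Finset.mem_filter.1 hl).1
      have hle : MeasurableSpace.comap (noisePair ε (k / 2)) inferInstance ≤ siblingAlg X ε n t :=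
        (le_iSup₂ (f := fun l (_ : l ∈ t) =>
          MeasurableSpace.comap (noisePair ε l) (inferInstance : MeasurableSpace (ℝ × ℝ))) _
          hl).trans le_sup_right
      have hpair : Measurable[siblingAlg X ε n t] (noisePair ε (k / 2)) :=
        measurable_iff_comap_le.2 hle
      have hanc : ∀ c : Fin 2, StronglyMeasurable[siblingAlg X ε n t] (fun ω => coeff a b c 0
          + ∑ i : Fin p, coeff a b c i.succ * X (k / 2 / 2 ^ (i : ℕ)) ω) := fun c =>
        ancestor_stronglyMeasurable (hgn _ hlg) fun i hi hik => hold i hi (by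
          simp only [gen, Finset.mem_Ico] at hlg; omega)
      rcases Nat.mod_two_eq_zero_or_one k with hk2 | hk2
      · have e : X k = fun ω => (coeff a b 0 0
            + ∑ i : Fin p, coeff a b 0 i.succ * X (k / 2 / 2 ^ (i : ℕ)) ω)
            + (noisePair ε (k / 2) ω).1 := by
          ext ω
          have := h.recursion (hgn _ hlg) 0 ω
          rw [show 2 * (k / 2) + ((0 : Fin 2) : ℕ) = k by simp; omega] at this
          rw [this, noisePair, show 2 * (k / 2) = k by omega]
        rw [e]
        exact (hanc 0).add hpair.fst.stronglyMeasurable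
      · have e : X k = fun ω => (coeff a b 1 0
            + ∑ i : Fin p, coeff a b 1 i.succ * X (k / 2 / 2 ^ (i : ℕ)) ω)
            + (noisePair ε (k / 2) ω).2 := by
          ext ω
          have := h.recursion (hgn _ hlg) 1 ω
          rw [show 2 * (k / 2) + ((1 : Fin 2) : ℕ) = k by simp; omega] at this
          rw [this, noisePair, show 2 * (k / 2) + 1 = k by omega]
        rw [e]
        exact (hanc 1).add hpair.snd.stronglyMeasurable
  exact condExp_eq_of_le_of_le hFle hG hm'le h1

/-- The noise of the offspring of type `c`, indexed by the mother; it is set to zero in the initial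
generations, where the recursion does not hold. -/
def noise (ε : ℕ → Ω → ℝ) (p : ℕ) (c : Fin 2) (j : ℕ) : Ω → ℝ :=
  if j < 2 ^ (p - 1) then 0 else ε (2 * j + c)

/-- The conditional variances of `noise`. -/
def noiseVar (σ2 : ℝ) (p j : ℕ) : ℝ := if j < 2 ^ (p - 1) then 0 else σ2

lemma child_mem_gen {j : ℕ} (hj : j ≠ 0) (c : Fin 2) : 2 * j + c ∈ gen (Nat.log 2 j + 1) := by
  have := mem_gen_log hj
  simp only [gen, Finset.mem_Ico] at this ⊢
  rw [pow_succ] at this ⊢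
  rw [pow_succ]
  have hc := c.2
  omega

/-- The noise of the offspring of type `c` is a noise sequence for the linear order of the mothers.
Conditional means, variances and fourth moments given `treeFiltration` agree with those given the
generations, by conditional independence of the pairs of sisters. -/
lemma IsModel.isNoise (h : IsModel μ p a b σ2 ρ X ε) (c : Fin 2) :
    IsNoise μ (treeFiltration X h.meas) (noise ε p c) (noiseVar σ2 p) σ2 := by
  set 𝒢 := treeFiltration X h.meas
  have hpos : 0 < 2 ^ (p - 1) := by positivity
  have hsel : ∃ q : ℝ × ℝ → ℝ, Measurable q ∧ ∀ j ω, q (noisePair ε j ω) = ε (2 * j + c) ω := by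
    fin_cases c
    · exact ⟨Prod.fst, measurable_fst, fun j ω => rfl⟩
    · exact ⟨Prod.snd, measurable_snd, fun j ω => rfl⟩
  obtain ⟨q, hq, hqe⟩ := hsel
  have hcond : ∀ {j : ℕ} (hj : 2 ^ (p - 1) ≤ j) (r : ℕ),
      Integrable (fun ω => ε (2 * j + c) ω ^ r) μ →
      μ[fun ω => ε (2 * j + c) ω ^ r | 𝒢 j]
        =ᵐ[μ] μ[fun ω => ε (2 * j + c) ω ^ r | sigmaAlg X (Nat.log 2 j)] := by
    intro j hj r hi
    have := h.condExp_eq hj (g := fun x => q x ^ r) (hq.pow_const r)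
    simp only [hqe] at this
    exact this hi
  have hmem : ∀ {j : ℕ}, 2 ^ (p - 1) ≤ j → MemLp (ε (2 * j + c)) 4 μ := fun {j} hj =>
    h.four.1 _ (le_log_of_le hj) _ (child_mem_gen (by omega) c)
  refine ⟨fun j => ?_, fun j => ?_, fun j => ?_, fun j => ?_, fun j => ?_, ?_⟩
  · simp only [noise]
    split_ifs with hj
    · exact stronglyMeasurable_zero
    · exact h.noise_stronglyMeasurable (not_lt.1 hj) c
  · simp only [noise]
    split_ifs with hj
    · exact MemLp.zero
    · exact hmem (not_lt.1 hj)
  · simp only [noise]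
    split_ifs with hj
    · rw [condExp_zero]
    · have h1 := hcond (not_lt.1 hj) 1
      simp only [pow_one] at h1
      exact (h1 ((hmem (not_lt.1 hj)).integrable (by norm_num))).trans
        (h.var.2 _ (le_log_of_le (not_lt.1 hj)) _ (child_mem_gen (by omega) c)).2.1
  · simp only [noise, noiseVar]
    split_ifs with hj
    · simp only [Pi.zero_apply, ne_eq, OfNat.ofNat_ne_zero, not_false_eq_true, zero_pow]
      exact (condExp_zero (μ := μ) (m := 𝒢 j) (E := ℝ)).eventuallyEq
    · exact (hcond (not_lt.1 hj) 2 ((memLp_two_sq (hmem (not_lt.1 hj))).integrable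
        (by norm_num))).trans
        (h.var.2 _ (le_log_of_le (not_lt.1 hj)) _ (child_mem_gen (by omega) c)).2.2
  · simp only [noiseVar]
    split_ifs with hj
    · exact h.var.1.le
    · exact le_rfl
  · have h1 : ∀ᵐ ω ∂μ, ∀ j, 2 ^ (p - 1) ≤ j → (μ[fun ω => ε (2 * j + c) ω ^ 4 | 𝒢 j]) ω
        = (μ[fun ω => ε (2 * j + c) ω ^ 4 | sigmaAlg X (Nat.log 2 j)]) ω := by
      rw [ae_all_iff]
      intro j
      rcases lt_or_ge j (2 ^ (p - 1)) with hj | hj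
      · exact ae_of_all _ fun ω hj' => absurd hj' (not_le.2 hj)
      · filter_upwards [hcond hj 4 (integrable_pow_four (hmem hj))] with ω hω _
        exact hω
    filter_upwards [h1, h.four.2] with ω h2 ⟨C, hC⟩
    refine ⟨max C 0, fun j => ?_⟩
    simp only [noise]
    split_ifs with hj
    · have : μ[fun ω' => (0 : Ω → ℝ) ω' ^ 4 | 𝒢 j] = 0 := by
        simp only [Pi.zero_apply, ne_eq, OfNat.ofNat_ne_zero, not_false_eq_true, zero_pow]
        exact condExp_zero
      rw [this]
      exact le_max_right _ _
    · rw [h2 j (not_lt.1 hj)]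
      exact (hC _ (le_log_of_le (not_lt.1 hj)) _ (child_mem_gen (by omega) c)).trans
        (le_max_left _ _)

lemma IsModel.memLp_four (h : IsModel μ p a b σ2 ρ X ε) {k : ℕ} (hk : 1 ≤ k) : MemLp (X k) 4 μ := by
  induction k using Nat.strong_induction_on with
  | _ k ih =>
    rcases lt_or_ge k (2 ^ p) with hkp | hkp
    · exact (h.init k hk hkp).mono_exponent (by norm_num)
    · have hp : 2 ^ p = 2 * 2 ^ (p - 1) := by
        rw [← pow_succ', Nat.sub_add_cancel h.one_le]
      have hn : 2 ^ (p - 1) ≤ k / 2 := by omega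
      have hpos : 0 < 2 ^ (p - 1) := by positivity
      have hc : ∃ c : Fin 2, 2 * (k / 2) + (c : ℕ) = k := by
        refine ⟨⟨k % 2, by omega⟩, ?_⟩
        simp only; omega
      obtain ⟨c, hc⟩ := hc
      have e : X k = fun ω => coeff a b c 0
          + ∑ i : Fin p, coeff a b c i.succ * X (k / 2 / 2 ^ (i : ℕ)) ω + noise ε p c (k / 2) ω := by
        ext ω
        have := h.recursion hn c ω
        rw [noise, if_neg (not_lt.2 hn), ← this, hc]
      rw [e]
      have h1 : MemLp (fun ω => ∑ i : Fin p, coeff a b c i.succ * X (k / 2 / 2 ^ (i : ℕ)) ω) 4 μ := by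
        refine memLp_finsetSum _ fun i _ => ?_
        refine (ih _ ?_ (one_le_div_two_pow hn i)).const_mul _
        exact (Nat.div_le_self _ _).trans_lt (by omega)
      have h0 : MemLp (fun _ : Ω => coeff a b c 0) 4 μ := memLp_const _
      have h2 : MemLp (noise ε p c (k / 2)) 4 μ := (h.isNoise c).memLp (k / 2)
      exact (h0.add h1).add h2

end Model

/-! ### Contractions on vectors and on matrices -/

section Contraction

variable {p : ℕ}

/-- A norm `N` on `ℝ^p`, equivalent to the sup norm with constant `K`, for which all `A c` are
contractions with constant `β < 1`. -/
structure IsContraction (N : Seminorm ℝ (Fin p → ℝ)) (A : Fin 2 → Matrix (Fin p) (Fin p) ℝ)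
    (β K : ℝ) : Prop where
  nonneg : 0 ≤ β
  lt_one : β < 1
  pos : 0 < K
  contr : ∀ c u, N (A c *ᵥ u) ≤ β * N u
  le_norm : ∀ u, N u ≤ K * ‖u‖
  norm_le : ∀ u, ‖u‖ ≤ K * N u

lemma seminorm_le_sum_mul_norm (N : Seminorm ℝ (Fin p → ℝ)) (u : Fin p → ℝ) :
    N u ≤ (∑ i, N (Pi.single i 1)) * ‖u‖ := by
  have hu : u = ∑ i, u i • (Pi.single i (1 : ℝ) : Fin p → ℝ) := by
    ext j
    simp [Finset.sum_apply, Pi.single_apply]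
  calc N u = N (∑ i, u i • (Pi.single i (1 : ℝ) : Fin p → ℝ)) := by rw [← hu]
    _ ≤ ∑ i, N (u i • (Pi.single i (1 : ℝ) : Fin p → ℝ)) :=
        Finset.le_sum_of_subadditive N (map_zero N).le (map_add_le_add N) _ _
    _ = ∑ i, ‖u i‖ * N (Pi.single i 1) := by simp_rw [map_smul_eq_mul]
    _ ≤ ∑ i, ‖u‖ * N (Pi.single i 1) := Finset.sum_le_sum fun i _ =>
        mul_le_mul_of_nonneg_right (norm_le_pi_norm u i) (apply_nonneg _ _)
    _ = _ := by rw [← Finset.mul_sum, mul_comm]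

lemma seminorm_continuous (N : Seminorm ℝ (Fin p → ℝ)) : Continuous N := by
  have h : LipschitzWith (∑ i, N (Pi.single i 1)).toNNReal N := by
    refine LipschitzWith.of_dist_le_mul fun u v => ?_
    rw [Real.dist_eq, dist_eq_norm, Real.coe_toNNReal _
      (Finset.sum_nonneg fun i _ => apply_nonneg _ _)]
    exact (abs_sub_map_le_sub N u v).trans (seminorm_le_sum_mul_norm N _)
  exact h.continuous

lemma exists_norm_le_mul_seminorm (N : Seminorm ℝ (Fin p → ℝ)) (hN : ∀ u, N u = 0 → u = 0) :
    ∃ K : ℝ, ∀ u, ‖u‖ ≤ K * N u := by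
  rcases (Metric.sphere (0 : Fin p → ℝ) 1).eq_empty_or_nonempty with he | hne
  · refine ⟨0, fun u => ?_⟩
    rw [zero_mul]
    by_contra hu
    have hu0 : ‖u‖ ≠ 0 := fun h0 => hu h0.le
    have : ‖u‖⁻¹ • u ∈ Metric.sphere (0 : Fin p → ℝ) 1 := by
      rw [mem_sphere_zero_iff_norm, norm_smul, norm_inv, norm_norm, inv_mul_cancel₀ hu0]
    rw [he] at this
    exact this
  · obtain ⟨v, hv, hmin⟩ := (isCompact_sphere (0 : Fin p → ℝ) 1).exists_isMinOn hne
      (seminorm_continuous N).continuousOn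
    rw [mem_sphere_zero_iff_norm] at hv
    have hv0 : 0 < N v := lt_of_le_of_ne (apply_nonneg _ _) fun h => by
      rw [hN v h.symm, norm_zero] at hv; exact zero_ne_one hv
    refine ⟨(N v)⁻¹, fun u => ?_⟩
    rcases eq_or_ne u 0 with rfl | hu
    · simp
    · have hu0 : ‖u‖ ≠ 0 := norm_ne_zero_iff.2 hu
      have hmem : ‖u‖⁻¹ • u ∈ Metric.sphere (0 : Fin p → ℝ) 1 := by
        rw [mem_sphere_zero_iff_norm, norm_smul, norm_inv, norm_norm, inv_mul_cancel₀ hu0]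
      have h1 : N v ≤ N (‖u‖⁻¹ • u) := hmin hmem
      rw [map_smul_eq_mul, norm_inv, norm_norm, le_inv_mul_iff₀ (norm_pos_iff.2 hu)] at h1
      rw [le_inv_mul_iff₀ hv0, mul_comm]
      exact h1

lemma Contracting.exists_isContraction {A B : Matrix (Fin p) (Fin p) ℝ} (h : Contracting A B) :
    ∃ N β K, IsContraction N ![A, B] β K := by
  obtain ⟨N, hN, β, hβ, hc⟩ := h
  obtain ⟨K, hK⟩ := exists_norm_le_mul_seminorm N hN
  set K₁ := ∑ i : Fin p, N (Pi.single i 1)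
  have hmax : ∀ u, β * N u ≤ max β 0 * N u := fun u =>
    mul_le_mul_of_nonneg_right (le_max_left _ _) (apply_nonneg _ _)
  refine ⟨N, max β 0, max (max K K₁) 1, le_max_right _ _, max_lt hβ one_pos,
    lt_max_of_lt_right one_pos, fun c u => ?_, fun u => ?_, fun u => ?_⟩
  · fin_cases c
    · exact (hc u).1.trans (hmax u)
    · exact (hc u).2.trans (hmax u)
  · exact (seminorm_le_sum_mul_norm N u).trans (mul_le_mul_of_nonneg_right
      ((le_max_right _ _).trans (le_max_left _ _)) (norm_nonneg _))
  · exact (hK u).trans (mul_le_mul_of_nonneg_right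
      ((le_max_left _ _).trans (le_max_left _ _)) (apply_nonneg _ _))

/-- `M`, viewed as a linear map from the dual of `(ℝ^p, N)` to `(ℝ^p, N)`, has operator norm at
most `c`. -/
def MatBound (N : Seminorm ℝ (Fin p → ℝ)) (M : Matrix (Fin p) (Fin p) ℝ) (c : ℝ) : Prop :=
  ∀ (φ : Fin p → ℝ) (d : ℝ), 0 ≤ d → (∀ u, |φ ⬝ᵥ u| ≤ d * N u) → N (M *ᵥ φ) ≤ c * d

variable {N : Seminorm ℝ (Fin p → ℝ)} {A : Fin 2 → Matrix (Fin p) (Fin p) ℝ} {β K : ℝ}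

lemma MatBound.add {M M' : Matrix (Fin p) (Fin p) ℝ} {c c' : ℝ} (h : MatBound N M c)
    (h' : MatBound N M' c') : MatBound N (M + M') (c + c') := fun φ d hd hφ => by
  rw [Matrix.add_mulVec, add_mul]
  exact (map_add_le_add N _ _).trans (add_le_add (h φ d hd hφ) (h' φ d hd hφ))

lemma MatBound.smul {M : Matrix (Fin p) (Fin p) ℝ} {c : ℝ} (h : MatBound N M c) {r : ℝ}
    (hr : 0 ≤ r) : MatBound N (r • M) (r * c) := fun φ d hd hφ => by
  rw [Matrix.smul_mulVec, map_smul_eq_mul, Real.norm_of_nonneg hr, mul_assoc]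
  exact mul_le_mul_of_nonneg_left (h φ d hd hφ) hr

/-- Conjugation `M ↦ A_c M A_cᵗ` contracts `MatBound`: `A_cᵗ` contracts the dual norm and `A_c` the
norm; one of the two factors `β` is enough. -/
lemma IsContraction.matBound_conj (h : IsContraction N A β K) {M : Matrix (Fin p) (Fin p) ℝ}
    {m : ℝ} (hM : MatBound N M m) (hm : 0 ≤ m) (c : Fin 2) :
    MatBound N (A c * M * (A c)ᵀ) (β * m) := fun φ d hd hφ => by
  have h1 : ∀ u, |((A c)ᵀ *ᵥ φ) ⬝ᵥ u| ≤ (d * β) * N u := fun u => by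
    rw [Matrix.mulVec_transpose, ← Matrix.dotProduct_mulVec]
    refine (hφ _).trans ?_
    rw [mul_assoc]
    exact mul_le_mul_of_nonneg_left (h.contr c u) hd
  have h2 := hM _ _ (mul_nonneg hd h.nonneg) h1
  rw [← Matrix.mulVec_mulVec, ← Matrix.mulVec_mulVec]
  refine (h.contr c _).trans ((mul_le_mul_of_nonneg_left h2 h.nonneg).trans ?_)
  have h3 : 0 ≤ m * d * β := mul_nonneg (mul_nonneg hm hd) h.nonneg
  nlinarith [h.lt_one, h.nonneg]

lemma IsContraction.matBound_of_entries (h : IsContraction N A β K)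
    (M : Matrix (Fin p) (Fin p) ℝ) : MatBound N M (K * K * ∑ i, ∑ j, |M i j|) :=
  fun φ d hd hφ => by
  have hφj : ∀ j, |φ j| ≤ d * K := fun j => by
    have h1 := hφ (Pi.single j 1)
    rw [dotProduct_single, mul_one] at h1
    refine h1.trans (mul_le_mul_of_nonneg_left ((h.le_norm _).trans ?_) hd)
    rw [Pi.norm_single, norm_one, mul_one]
  have hS : 0 ≤ ∑ i, ∑ j, |M i j| := Finset.sum_nonneg fun i _ => Finset.sum_nonneg fun j _ =>
    abs_nonneg _
  have h2 : ‖M *ᵥ φ‖ ≤ (∑ i, ∑ j, |M i j|) * (d * K) := by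
    refine (pi_norm_le_iff_of_nonneg (mul_nonneg hS (mul_nonneg hd h.pos.le))).2 fun i => ?_
    rw [Real.norm_eq_abs, Matrix.mulVec, dotProduct]
    refine (Finset.abs_sum_le_sum_abs _ _).trans ?_
    have : ∑ j, |M i j| ≤ ∑ i, ∑ j, |M i j| :=
      Finset.single_le_sum (f := fun i => ∑ j, |M i j|)
        (fun i _ => Finset.sum_nonneg fun j _ => abs_nonneg _) (Finset.mem_univ i)
    refine le_trans ?_ (mul_le_mul_of_nonneg_right this (mul_nonneg hd h.pos.le))
    rw [Finset.sum_mul]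
    refine Finset.sum_le_sum fun j _ => ?_
    rw [abs_mul]
    exact mul_le_mul_of_nonneg_left (hφj j) (abs_nonneg _)
  refine (h.le_norm _).trans ((mul_le_mul_of_nonneg_left h2 h.pos.le).trans (le_of_eq ?_))
  ring

lemma IsContraction.abs_le_of_matBound (h : IsContraction N A β K)
    {M : Matrix (Fin p) (Fin p) ℝ} {m : ℝ} (hM : MatBound N M m) (i j : Fin p) :
    |M i j| ≤ K * (m * K) := by
  have h1 := hM (Pi.single j 1) K h.pos.le fun u => by
    rw [single_dotProduct, one_mul]
    exact (norm_le_pi_norm u j).trans (h.norm_le u)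
  have h2 := (norm_le_pi_norm (M *ᵥ Pi.single j 1) i).trans (h.norm_le _)
  rw [Matrix.mulVec_single_one, Real.norm_eq_abs] at h2
  refine le_trans h2 (mul_le_mul_of_nonneg_left ?_ h.pos.le)
  rwa [Matrix.mulVec_single_one] at h1

/-- The linear map `M ↦ A M Aᵗ`. -/
def conj (A : Matrix (Fin p) (Fin p) ℝ) : Matrix (Fin p) (Fin p) ℝ →ₗ[ℝ]
    Matrix (Fin p) (Fin p) ℝ where
  toFun M := A * M * Aᵀ
  map_add' M M' := by rw [mul_add, add_mul]
  map_smul' r M := by simp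

/-- Perturbed iterations of `M ↦ ½ ∑ A_c M A_cᵗ` vanish in the limit with their perturbation. -/
lemma IsContraction.tendsto_zero (h : IsContraction N A β K)
    {E R : ℕ → Matrix (Fin p) (Fin p) ℝ} (n₀ : ℕ) (hR : Tendsto R atTop (𝓝 0))
    (hE : ∀ n, n₀ ≤ n → E (n + 1) = (1 / 2 : ℝ) • ∑ c, conj (A c) (E n) + R n) :
    Tendsto E atTop (𝓝 0) := by
  set r : ℕ → ℝ := fun n => K * K * ∑ i, ∑ j, |R (n₀ + n) i j| with hr
  have hKK : 0 ≤ K * K := mul_nonneg h.pos.le h.pos.le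
  have hr0 : ∀ n, 0 ≤ r n := fun n => mul_nonneg hKK
    (Finset.sum_nonneg fun i _ => Finset.sum_nonneg fun j _ => abs_nonneg _)
  have hrt : Tendsto r atTop (𝓝 0) := by
    have h1 : Tendsto (fun n => R (n₀ + n)) atTop (𝓝 0) := 
      (hR.comp (tendsto_add_atTop_nat n₀)).congr fun n => by simp [Function.comp, add_comm]
    have h2 : ∀ i j, Tendsto (fun n => |R (n₀ + n) i j|) atTop (𝓝 0) := fun i j => by
      simpa using ((tendsto_pi_nhds.1 ((tendsto_pi_nhds.1 h1) i)) j).abs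
    have h3 := (tendsto_finsetSum Finset.univ fun i _ =>
      tendsto_finsetSum Finset.univ fun j _ => h2 i j).const_mul (K * K)
    simpa using h3
  set e : ℕ → ℝ := fun n => Nat.rec (K * K * ∑ i, ∑ j, |E n₀ i j|) (fun n e => β * e + r n) n
    with he
  have he0 : ∀ n, 0 ≤ e n := fun n => by
    induction n with
    | zero =>
      change 0 ≤ K * K * ∑ i, ∑ j, |E n₀ i j|
      positivity
    | succ n ih => exact add_nonneg (mul_nonneg h.nonneg ih) (hr0 n)
  -- `e` dominates the operator norm of `E (n₀ + n)` by its very recursion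
  have het : Tendsto e atTop (𝓝 0) := tendsto_zero_of_le_mul_add 0 h.nonneg h.lt_one he0 hrt
    fun n _ => le_rfl
  have hbound : ∀ n, MatBound N (E (n₀ + n)) (e n) := fun n => by
    induction n with
    | zero => exact h.matBound_of_entries _
    | succ n ih =>
      rw [← add_assoc, hE _ (Nat.le_add_right _ _), Fin.sum_univ_two]
      have h1 := (((h.matBound_conj ih (he0 n) 0).add (h.matBound_conj ih (he0 n) 1)).smul
        (show (0 : ℝ) ≤ 1 / 2 by norm_num)).add (h.matBound_of_entries (R (n₀ + n)))
      have h2 : e (n + 1) = 1 / 2 * (β * e n + β * e n)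
          + K * K * ∑ i, ∑ j, |R (n₀ + n) i j| := by
        change β * e n + r n = _
        simp only [hr]; ring
      rw [h2]
      exact h1
  rw [← tendsto_add_atTop_iff_nat n₀]
  refine tendsto_pi_nhds.2 fun i => tendsto_pi_nhds.2 fun j => ?_
  refine squeeze_zero_norm (fun n => ?_) (a := fun n => K * (e n * K)) (by
    simpa using (het.mul_const K).const_mul K)
  rw [add_comm]
  exact h.abs_le_of_matBound (hbound n) i j

lemma IsContraction.eq_zero_of_conj (h : IsContraction N A β K) {M : Matrix (Fin p) (Fin p) ℝ}
    (hM : M = (1 / 2 : ℝ) • ∑ c, conj (A c) M) : M = 0 := by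
  have := h.tendsto_zero (E := fun _ => M) (R := fun _ => 0) 0 tendsto_const_nhds
    fun n _ => by simpa using hM
  exact tendsto_nhds_unique tendsto_const_nhds this

/-- The affine fixed point equation for matrices has exactly one solution. -/
lemma IsContraction.existsUnique_matrix (h : IsContraction N A β K)
    (T : Matrix (Fin p) (Fin p) ℝ) :
    ∃! M : Matrix (Fin p) (Fin p) ℝ, M = T + (1 / 2 : ℝ) • ∑ c, conj (A c) M := by
  set Φ : Matrix (Fin p) (Fin p) ℝ →ₗ[ℝ] Matrix (Fin p) (Fin p) ℝ :=
    LinearMap.id - (1 / 2 : ℝ) • ∑ c, conj (A c) with hΦ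
  have hΦa : ∀ M, Φ M = M - (1 / 2 : ℝ) • ∑ c, conj (A c) M := fun M => by
    simp [hΦ]
  have hinj : Function.Injective Φ := by
    rw [injective_iff_map_eq_zero]
    intro M hM
    rw [hΦa, sub_eq_zero] at hM
    exact h.eq_zero_of_conj hM
  obtain ⟨M, hM⟩ := LinearMap.injective_iff_surjective.1 hinj T
  refine ⟨M, ?_, fun M' hM' => hinj ?_⟩
  · rw [hΦa, sub_eq_iff_eq_add] at hM
    exact hM
  · rw [hM, hΦa, sub_eq_iff_eq_add]
    exact hM'

/-- The mean of the two matrices is a contraction, so it has no fixed vector. -/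
lemma IsContraction.isUnit_det (h : IsContraction N A β K) :
    IsUnit (1 - (1 / 2 : ℝ) • ∑ c, A c).det := by
  rw [isUnit_iff_ne_zero]
  intro h0
  obtain ⟨v, hv, hv0⟩ := Matrix.exists_mulVec_eq_zero_iff.2 h0
  rw [Matrix.sub_mulVec, Matrix.one_mulVec, sub_eq_zero, Matrix.smul_mulVec, Fin.sum_univ_two,
    Matrix.add_mulVec] at hv0
  have h1 : N v ≤ β * N v := by
    conv_lhs => rw [hv0]
    rw [map_smul_eq_mul, Real.norm_of_nonneg (by norm_num)]
    have := map_add_le_add N (A 0 *ᵥ v) (A 1 *ᵥ v)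
    linarith [h.contr 0 v, h.contr 1 v]
  have h2 : N v = 0 := by
    have := apply_nonneg N v
    nlinarith [h.lt_one]
  have h3 := h.norm_le v
  rw [h2, mul_zero] at h3
  exact hv (norm_le_zero_iff.1 h3)

end Contraction

/-! ### Averages over the generations -/

section GenAvg

variable {E F : Type*} [AddCommGroup E] [Module ℝ E] [AddCommGroup F] [Module ℝ F]

/-- The average over the `n`-th generation. -/
noncomputable def genAvg (f : ℕ → E) (n : ℕ) : E := (2 ^ n : ℝ)⁻¹ • ∑ j ∈ gen n, f j

lemma card_gen (n : ℕ) : (gen n).card = 2 ^ n := by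
  rw [gen, Nat.card_Ico, pow_succ]; omega

lemma genAvg_congr {f g : ℕ → E} {n : ℕ} (h : ∀ j ∈ gen n, f j = g j) : genAvg f n = genAvg g n := by
  rw [genAvg, genAvg, Finset.sum_congr rfl h]

lemma genAvg_add (f g : ℕ → E) (n : ℕ) :
    genAvg (fun j => f j + g j) n = genAvg f n + genAvg g n := by
  rw [genAvg, Finset.sum_add_distrib, smul_add]; rfl

lemma genAvg_map (L : E →ₗ[ℝ] F) (f : ℕ → E) (n : ℕ) :
    genAvg (fun j => L (f j)) n = L (genAvg f n) := by
  rw [genAvg, genAvg, map_smul, map_sum]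

lemma genAvg_const (x : E) (n : ℕ) : genAvg (fun _ => x) n = x := by
  rw [genAvg, Finset.sum_const, card_gen, ← Nat.cast_smul_eq_nsmul ℝ, smul_smul]
  push_cast
  rw [inv_mul_cancel₀ (by positivity), one_smul]

lemma sum_gen_succ (f : ℕ → E) (n : ℕ) :
    ∑ j ∈ gen (n + 1), f j = ∑ c : Fin 2, ∑ j ∈ gen n, f (2 * j + c) := by
  rw [Fin.sum_univ_two, ← Finset.sum_add_distrib, gen, gen, pow_succ (n := n + 1),
    pow_succ (n := n)]
  generalize 2 ^ n = m
  have h : ∀ b, m ≤ b → ∑ j ∈ Finset.Ico (m * 2) (b * 2), f j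
      = ∑ j ∈ Finset.Ico m b, (f (2 * j + (0 : Fin 2)) + f (2 * j + (1 : Fin 2))) := by
    intro b hb
    induction b, hb using Nat.le_induction with
    | base => simp
    | succ b hb ih =>
      rw [Finset.sum_Ico_succ_top hb, ← ih, show (b + 1) * 2 = b * 2 + 1 + 1 by ring,
        Finset.sum_Ico_succ_top (by omega), Finset.sum_Ico_succ_top (by omega), add_assoc]
      simp [mul_comm]
  exact h _ (by omega)

lemma genAvg_succ (f : ℕ → E) (n : ℕ) :
    genAvg f (n + 1) = (1 / 2 : ℝ) • ∑ c : Fin 2, genAvg (fun j => f (2 * j + c)) n := by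
  simp only [genAvg]
  rw [sum_gen_succ, ← Finset.smul_sum, smul_smul, pow_succ, mul_inv]
  congr 1
  ring

end GenAvg

/-! ### Limits of the averages of a deterministic autoregression -/

section Deterministic

variable {p : ℕ} {N : Seminorm ℝ (Fin p → ℝ)} {A : Fin 2 → Matrix (Fin p) (Fin p) ℝ} {β K : ℝ}

/-- The linear map `w ↦ (A w) uᵗ + u (A w)ᵗ`. -/
def symMap (A : Matrix (Fin p) (Fin p) ℝ) (u : Fin p → ℝ) :
    (Fin p → ℝ) →ₗ[ℝ] Matrix (Fin p) (Fin p) ℝ where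
  toFun w := Matrix.vecMulVec (A *ᵥ w) u + Matrix.vecMulVec u (A *ᵥ w)
  map_add' w w' := by
    rw [Matrix.mulVec_add, Matrix.add_vecMulVec, Matrix.vecMulVec_add]; abel
  map_smul' r w := by
    rw [Matrix.mulVec_smul, Matrix.smul_vecMulVec, Matrix.vecMulVec_smul]; simp

/-- The second order products of an autoregressive step. -/
lemma vecMulVec_affine (A : Matrix (Fin p) (Fin p) ℝ) (w u : Fin p → ℝ) (r e : ℝ) :
    Matrix.vecMulVec (A *ᵥ w + (r + e) • u) (A *ᵥ w + (r + e) • u)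
      = conj A (Matrix.vecMulVec w w) + r • symMap A u w + symMap A u (e • w)
        + (r ^ 2 + 2 * r * e + e ^ 2) • Matrix.vecMulVec u u := by
  have h1 : conj A (Matrix.vecMulVec w w) = Matrix.vecMulVec (A *ᵥ w) (A *ᵥ w) := by
    change A * Matrix.vecMulVec w w * Aᵀ = _
    rw [Matrix.mul_vecMulVec, Matrix.vecMulVec_mul, Matrix.vecMul_transpose]
  rw [h1, map_smul]
  ext i j
  simp [symMap, Matrix.vecMulVec_apply]
  ring

/-- The averages of `x` and of `x xᵗ` over the generations of an autoregression along the binary tree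
converge, when the noise obeys laws of large numbers: both averages satisfy perturbed affine
contractive recursions. -/
lemma IsContraction.tendsto_genAvg (h : IsContraction N A β K) {n₀ : ℕ} {x : ℕ → Fin p → ℝ}
    {e : Fin 2 → ℕ → ℝ} {r : Fin 2 → ℝ} {u l : Fin p → ℝ} {M : Matrix (Fin p) (Fin p) ℝ} {v : ℝ}
    (hx : ∀ j, 2 ^ n₀ ≤ j → ∀ c : Fin 2, x (2 * j + c) = A c *ᵥ x j + (r c + e c j) • u)
    (hl : l = (1 / 2 : ℝ) • ∑ c, (A c *ᵥ l + r c • u))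
    (hM : M = (1 / 2 : ℝ) • ∑ c, (conj (A c) M + r c • symMap (A c) u l
      + (r c ^ 2 + v) • Matrix.vecMulVec u u))
    (he : ∀ c, Tendsto (genAvg (e c)) atTop (𝓝 0))
    (hex : ∀ c, Tendsto (genAvg fun j => e c j • x j) atTop (𝓝 0))
    (hee : ∀ c, Tendsto (genAvg fun j => e c j ^ 2) atTop (𝓝 v)) :
    Tendsto (genAvg x) atTop (𝓝 l) ∧
      Tendsto (genAvg fun j => Matrix.vecMulVec (x j) (x j)) atTop (𝓝 M) := by
  have hgen : ∀ {n}, n₀ ≤ n → ∀ j ∈ gen n, 2 ^ n₀ ≤ j := fun hn j hj =>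
    (Nat.pow_le_pow_right (by norm_num) hn).trans (two_pow_le_of_mem_gen hj)
  have hrec1 : ∀ n, n₀ ≤ n → genAvg x (n + 1)
      = (1 / 2 : ℝ) • ∑ c, (A c *ᵥ genAvg x n + (r c + genAvg (e c) n) • u) := fun n hn => by
    rw [genAvg_succ]
    congr 1
    refine Finset.sum_congr rfl fun c _ => ?_
    rw [genAvg_congr fun j hj => hx j (hgen hn j hj) c, genAvg_add]
    congr 1
    · exact genAvg_map (Matrix.mulVecLin (A c)) x n
    · simp_rw [add_smul]
      rw [genAvg_add, genAvg_const]
      congr 1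
      exact genAvg_map ((LinearMap.id : ℝ →ₗ[ℝ] ℝ).smulRight u) (e c) n
  have hlim1 : Tendsto (fun n => N (genAvg x n - l)) atTop (𝓝 0) := by
    refine tendsto_zero_of_le_mul_add (s := fun n => 1 / 2 * ∑ c, |genAvg (e c) n| * N u) n₀
      h.nonneg h.lt_one (fun n => apply_nonneg _ _) ?_ fun n hn => ?_
    · have := (tendsto_finsetSum Finset.univ fun c _ => ((he c).abs.mul_const (N u))).const_mul
        ((1 : ℝ) / 2)
      simpa using this
    · have e1 : genAvg x (n + 1) - l = (1 / 2 : ℝ) • ∑ c,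
          (A c *ᵥ (genAvg x n - l) + genAvg (e c) n • u) := by
        conv_lhs => rw [hrec1 n hn, hl]
        rw [← smul_sub, ← Finset.sum_sub_distrib]
        congr 1
        refine Finset.sum_congr rfl fun c _ => ?_
        rw [Matrix.mulVec_sub, add_smul]
        abel
      rw [e1, map_smul_eq_mul, Real.norm_of_nonneg (by norm_num), Fin.sum_univ_two,
        Fin.sum_univ_two]
      have h1 : ∀ c, N (A c *ᵥ (genAvg x n - l) + genAvg (e c) n • u)
          ≤ β * N (genAvg x n - l) + |genAvg (e c) n| * N u := fun c => by
        refine (map_add_le_add N _ _).trans (add_le_add (h.contr c _) ?_)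
        rw [map_smul_eq_mul, Real.norm_eq_abs]
      have h2 := map_add_le_add N (A 0 *ᵥ (genAvg x n - l) + genAvg (e 0) n • u)
        (A 1 *ᵥ (genAvg x n - l) + genAvg (e 1) n • u)
      linarith [h1 0, h1 1]
  have hH : Tendsto (genAvg x) atTop (𝓝 l) := by
    rw [tendsto_iff_norm_sub_tendsto_zero]
    exact squeeze_zero (fun n => norm_nonneg _) (fun n => h.norm_le _)
      (by simpa using hlim1.const_mul K)
  refine ⟨hH, ?_⟩
  set Q : ℕ → Matrix (Fin p) (Fin p) ℝ := genAvg fun j => Matrix.vecMulVec (x j) (x j) with hQ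
  have hrec2 : ∀ n, n₀ ≤ n → Q (n + 1) = (1 / 2 : ℝ) • ∑ c, (conj (A c) (Q n)
      + r c • symMap (A c) u (genAvg x n) + symMap (A c) u (genAvg (fun j => e c j • x j) n)
      + (r c ^ 2 + 2 * r c * genAvg (e c) n + genAvg (fun j => e c j ^ 2) n)
        • Matrix.vecMulVec u u) := fun n hn => by
    rw [hQ, genAvg_succ]
    congr 1
    refine Finset.sum_congr rfl fun c _ => ?_
    rw [genAvg_congr fun j hj => by rw [hx j (hgen hn j hj) c, vecMulVec_affine], genAvg_add,
      genAvg_add, genAvg_add, genAvg_map (conj (A c)), genAvg_map (symMap (A c) u)]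
    congr 2
    · congr 1
      exact genAvg_map (r c • symMap (A c) u) x n
    · simp_rw [add_smul]
      rw [genAvg_add, genAvg_add, genAvg_const]
      congr 1
      · congr 1
        simp_rw [mul_smul]
        have h1 := genAvg_map ((2 : ℝ) • r c • (LinearMap.id : ℝ →ₗ[ℝ] ℝ).smulRight
          (Matrix.vecMulVec u u)) (e c) n
        exact h1
      · exact genAvg_map ((LinearMap.id : ℝ →ₗ[ℝ] ℝ).smulRight (Matrix.vecMulVec u u))
          (fun j => e c j ^ 2) n
  set R : ℕ → Matrix (Fin p) (Fin p) ℝ := fun n => (1 / 2 : ℝ) • ∑ c,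
    (r c • symMap (A c) u (genAvg x n - l) + symMap (A c) u (genAvg (fun j => e c j • x j) n)
      + (2 * r c * genAvg (e c) n + (genAvg (fun j => e c j ^ 2) n - v))
        • Matrix.vecMulVec u u) with hR
  have hcont : ∀ c, Continuous (symMap (A c) u) := fun c =>
    LinearMap.continuous_of_finiteDimensional _
  have hRt : Tendsto R atTop (𝓝 0) := by
    have h1 : ∀ c, Tendsto (fun n => r c • symMap (A c) u (genAvg x n - l)
        + symMap (A c) u (genAvg (fun j => e c j • x j) n)
        + (2 * r c * genAvg (e c) n + (genAvg (fun j => e c j ^ 2) n - v))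
        • Matrix.vecMulVec u u) atTop (𝓝 0) := fun c => by
      have t1 := (((hcont c).tendsto _).comp (hH.sub_const l)).const_smul (r c)
      have t2 := ((hcont c).tendsto _).comp (hex c)
      have t3 := (((he c).const_mul (2 * r c)).add ((hee c).sub_const v)).smul_const
        (Matrix.vecMulVec u u)
      have := (t1.add t2).add t3
      simpa using this
    have := (tendsto_finsetSum Finset.univ fun c _ => h1 c).const_smul ((1 : ℝ) / 2)
    simpa only [Finset.sum_const_zero, smul_zero] using this
  have hE := h.tendsto_zero (E := fun n => Q n - M) n₀ hRt fun n hn => by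
    conv_lhs => rw [hrec2 n hn, hM]
    rw [hR, ← smul_sub, ← smul_add, ← Finset.sum_sub_distrib, ← Finset.sum_add_distrib]
    congr 1
    refine Finset.sum_congr rfl fun c _ => ?_
    rw [map_sub, map_sub]
    module
  have := hE.add_const M
  simpa using this

end Deterministic

/-! ### Law of large numbers for the regressors -/

section LawOfLargeNumbers

variable {Ω : Type*} [mΩ : MeasurableSpace Ω] {μ : Measure Ω} [IsProbabilityMeasure μ]
  {p : ℕ} {a b : Fin (p + 1) → ℝ} {σ2 ρ : ℝ} {X ε : ℕ → Ω → ℝ}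

/-- The values of the individual `j` and its `p - 1` nearest ancestors. -/
def state (X : ℕ → Ω → ℝ) (p j : ℕ) (ω : Ω) : Fin p → ℝ := fun i => X (j / 2 ^ (i : ℕ)) ω

/-- The companion matrices for the two types of offspring. -/
noncomputable def compMat (a b : Fin (p + 1) → ℝ) (c : Fin 2) : Matrix (Fin p) (Fin p) ℝ :=
  companion (coeff a b c)

lemma companion_mulVec (c : Fin (p + 1) → ℝ) (u : Fin p → ℝ) (i : Fin p) :
    (companion c *ᵥ u) i = if (i : ℕ) = 0 then ∑ k : Fin p, c k.succ * u k
      else u ⟨i - 1, by omega⟩ := by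
  simp only [Matrix.mulVec, dotProduct, companion, Matrix.of_apply]
  split_ifs with hi
  · rfl
  · rw [Finset.sum_eq_single (⟨i - 1, by omega⟩ : Fin p)]
    · simp only
      rw [if_pos (by omega), one_mul]
    · intro j _ hj
      rw [if_neg (fun h => hj (Fin.ext (by simp only; omega))), zero_mul]
    · simp

lemma IsModel.state_recursion (h : IsModel μ p a b σ2 ρ X ε) {j : ℕ} (hj : 2 ^ (p - 1) ≤ j)
    (c : Fin 2) (ω : Ω) : state X p (2 * j + c) ω
      = compMat a b c *ᵥ state X p j ω + (coeff a b c 0 + noise ε p c j ω) • e₁ p := by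
  ext i
  rw [Pi.add_apply, Pi.smul_apply, compMat, companion_mulVec, noise, if_neg (not_lt.2 hj)]
  simp only [e₁, smul_eq_mul]
  have hc := c.2
  split_ifs with hi
  · simp only [state, hi, pow_zero, Nat.div_one]
    rw [h.recursion hj c ω]; ring
  · simp only [state]
    have : (2 * j + (c : ℕ)) / 2 ^ (i : ℕ) = j / 2 ^ ((i : ℕ) - 1) := by
      obtain ⟨k, hk⟩ : ∃ k, (i : ℕ) = k + 1 := ⟨i - 1, by omega⟩
      rw [hk, pow_succ', ← Nat.div_div_eq_div_mul, Nat.add_sub_cancel]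
      congr 1
      omega
    rw [this]; ring

lemma IsModel.exists_isContraction (h : IsModel μ p a b σ2 ρ X ε) :
    ∃ N β K, IsContraction N (compMat a b) β K := by
  obtain ⟨N, β, K, hN⟩ := h.contr.exists_isContraction
  have : ![companion a, companion b] = compMat a b := by
    ext c : 1
    fin_cases c
    · simp [compMat, coeff]
    · simp [compMat, coeff]
  exact ⟨N, β, K, this ▸ hN⟩

/-- The second moments of the process are bounded: if `g j = N (state j)`, then
`g (2 j + c) ≤ β g j + (|c₀| + |ε|) N e₁`, and by convexity the bound
`E[g (2 j + c)²] ≤ β E[(g j)²] + const` follows. -/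
lemma IsModel.exists_second_moment_le (h : IsModel μ p a b σ2 ρ X ε) :
    ∃ B, ∀ j, 2 ^ (p - 1) ≤ j → ∀ i : Fin p, ∫ ω, X (j / 2 ^ (i : ℕ)) ω ^ 2 ∂μ ≤ B := by
  obtain ⟨N, β, K, hN⟩ := h.exists_isContraction
  have hpos : 0 < 2 ^ (p - 1) := by positivity
  set g : ℕ → Ω → ℝ := fun j ω => N (state X p j ω) with hg
  have hX2 : ∀ {j}, 2 ^ (p - 1) ≤ j → ∀ i : Fin p, MemLp (X (j / 2 ^ (i : ℕ))) 2 μ :=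
    fun hj i => (h.memLp_four (one_le_div_two_pow hj i)).mono_exponent (by norm_num)
  have hgm : ∀ {j}, 2 ^ (p - 1) ≤ j → Measurable (g j) := fun hj =>
    (seminorm_continuous N).measurable.comp
      (measurable_pi_lambda _ fun i => h.meas _ (one_le_div_two_pow hj i))
  have hg2 : ∀ {j}, 2 ^ (p - 1) ≤ j → MemLp (g j) 2 μ := fun {j} hj => by
    have h1 : MemLp (fun ω => K * ∑ i : Fin p, |X (j / 2 ^ (i : ℕ)) ω|) 2 μ :=
      (memLp_finsetSum _ fun i _ => (hX2 hj i).abs).const_mul K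
    refine h1.mono (hgm hj).aestronglyMeasurable (ae_of_all _ fun ω => ?_)
    have hS : 0 ≤ ∑ i : Fin p, |X (j / 2 ^ (i : ℕ)) ω| := Finset.sum_nonneg fun i _ => abs_nonneg _
    rw [Real.norm_of_nonneg (apply_nonneg _ _), Real.norm_of_nonneg (mul_nonneg hN.pos.le hS)]
    refine (hN.le_norm _).trans (mul_le_mul_of_nonneg_left ?_ hN.pos.le)
    refine (pi_norm_le_iff_of_nonneg hS).2 fun i => ?_
    exact Finset.single_le_sum (f := fun i : Fin p => |X (j / 2 ^ (i : ℕ)) ω|)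
      (fun i _ => abs_nonneg _) (Finset.mem_univ i)
  set ν := N (e₁ p)
  set C := max (a 0 ^ 2) (b 0 ^ 2)
  have hC : ∀ c, coeff a b c 0 ^ 2 ≤ C := fun c => by
    fin_cases c
    · exact le_max_left _ _
    · exact le_max_right _ _
  set H := 2 * (C + σ2) * ν ^ 2
  have hσ := h.var.1
  have hβ : 0 < 1 - β := by linarith [hN.lt_one]
  have hC0 : 0 ≤ C := (sq_nonneg _).trans (le_max_left _ _)
  have hstep : ∀ j, 2 ^ (p - 1) ≤ j → ∀ c : Fin 2,
      ∫ ω, g (2 * j + c) ω ^ 2 ∂μ ≤ β * ∫ ω, g j ω ^ 2 ∂μ + H / (1 - β) := by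
    intro j hj c
    have hn := (h.isNoise c)
    have hη2 : Integrable (fun ω => noise ε p c j ω ^ 2) μ :=
      (memLp_two_sq (hn.memLp j)).integrable (by norm_num)
    have hpt : ∀ ω, g (2 * j + c) ω ^ 2 ≤ β * g j ω ^ 2
        + (2 * ν ^ 2 / (1 - β)) * (coeff a b c 0 ^ 2 + noise ε p c j ω ^ 2) := by
      intro ω
      set z := coeff a b c 0
      set y := noise ε p c j ω
      have h1 : g (2 * j + c) ω ≤ β * g j ω + |z + y| * ν := by
        simp only [hg]
        rw [h.state_recursion hj c ω]
        refine (map_add_le_add N _ _).trans (add_le_add (hN.contr c _) ?_)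
        rw [map_smul_eq_mul, Real.norm_eq_abs]
      have h0 : 0 ≤ g (2 * j + c) ω := apply_nonneg _ _
      have h2 : g (2 * j + c) ω ^ 2 ≤ (β * g j ω + |z + y| * ν) ^ 2 :=
        pow_le_pow_left₀ h0 h1 2
      have h3 : (β * g j ω + |z + y| * ν) ^ 2
          ≤ β * g j ω ^ 2 + (z + y) ^ 2 * ν ^ 2 / (1 - β) := by
        rw [← sub_nonneg]
        have e : β * g j ω ^ 2 + (z + y) ^ 2 * ν ^ 2 / (1 - β) - (β * g j ω + |z + y| * ν) ^ 2
            = β / (1 - β) * ((1 - β) * g j ω - |z + y| * ν) ^ 2 := by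
          rw [← sq_abs (z + y)]
          field_simp
          ring
        rw [e]
        exact mul_nonneg (div_nonneg hN.nonneg hβ.le) (sq_nonneg _)
      have h4 : (z + y) ^ 2 * ν ^ 2 / (1 - β)
          ≤ (2 * ν ^ 2 / (1 - β)) * (z ^ 2 + y ^ 2) := by
        rw [div_mul_eq_mul_div]
        refine div_le_div_of_nonneg_right ?_ hβ.le
        nlinarith [mul_nonneg (sq_nonneg (z - y)) (sq_nonneg ν)]
      linarith
    have hj2 : 2 ^ (p - 1) ≤ 2 * j + c := by omega
    have i1 := (hg2 hj).integrable_sq.const_mul β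
    have i2 : Integrable (fun ω => (2 * ν ^ 2 / (1 - β))
        * (coeff a b c 0 ^ 2 + noise ε p c j ω ^ 2)) μ :=
      ((integrable_const _).add hη2).const_mul _
    refine (integral_mono (hg2 hj2).integrable_sq (i1.add i2) hpt).trans ?_
    rw [integral_add' i1 i2, integral_const_mul, integral_const_mul,
      integral_add (integrable_const _) hη2, hn.integral_sq]
    have h5 := hn.var_le j
    have h6 := hC c
    simp only [integral_const, probReal_univ, smul_eq_mul, one_mul, H]
    refine add_le_add le_rfl ?_
    rw [div_mul_eq_mul_div]
    refine div_le_div_of_nonneg_right ?_ hβ.le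
    nlinarith [sq_nonneg ν]
  set B := max (∑ j ∈ Finset.range (2 ^ p), ∫ ω, g j ω ^ 2 ∂μ) (H / (1 - β) / (1 - β))
  have hp2 : 2 ^ p = 2 * 2 ^ (p - 1) := by
    rw [← pow_succ', Nat.sub_add_cancel h.one_le]
  have hB : ∀ j, 2 ^ (p - 1) ≤ j → ∫ ω, g j ω ^ 2 ∂μ ≤ B := by
    intro j
    induction j using Nat.strong_induction_on with
    | _ j ih =>
      intro hj
      rcases lt_or_ge j (2 ^ p) with hjp | hjp
      · refine le_max_of_le_left ?_
        exact Finset.single_le_sum (f := fun j => ∫ ω, g j ω ^ 2 ∂μ)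
          (fun i _ => integral_nonneg fun ω => sq_nonneg _) (Finset.mem_range.2 hjp)
      · have h1 := hstep (j / 2) (by omega) ⟨j % 2, by omega⟩
        have h2 := ih (j / 2) (by omega) (by omega)
        simp only [Nat.div_add_mod] at h1
        have h3 : H / (1 - β) ≤ B * (1 - β) := by
          rw [← div_le_iff₀ hβ]; exact le_max_right _ _
        have h4 := mul_le_mul_of_nonneg_left h2 hN.nonneg
        linarith
  refine ⟨K ^ 2 * B, fun j hj i => ?_⟩
  refine le_trans (integral_mono (hX2 hj i).integrable_sq ((hg2 hj).integrable_sq.const_mul (K ^ 2))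
    fun ω => ?_) (by rw [integral_const_mul]; exact mul_le_mul_of_nonneg_left (hB j hj) (sq_nonneg K))
  have h1 : |X (j / 2 ^ (i : ℕ)) ω| ≤ K * g j ω :=
    (norm_le_pi_norm (state X p j ω) i).trans (hN.norm_le _)
  have h2 := pow_le_pow_left₀ (abs_nonneg _) h1 2
  rw [sq_abs, mul_pow] at h2
  exact h2

/-- The components of the regressor, set to zero in the initial generations. -/
def reg (X : ℕ → Ω → ℝ) (p : ℕ) (r : Fin (p + 1)) (j : ℕ) : Ω → ℝ :=
  if j < 2 ^ (p - 1) then 0 else fun ω => regressor X p j ω r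

lemma reg_of_le {j : ℕ} (hj : 2 ^ (p - 1) ≤ j) (r : Fin (p + 1)) (ω : Ω) :
    reg X p r j ω = regressor X p j ω r := by
  rw [reg, if_neg (not_lt.2 hj)]

lemma regressor_succ (j : ℕ) (i : Fin p) (ω : Ω) :
    regressor X p j ω i.succ = state X p j ω i := rfl

lemma IsModel.isRegressor (h : IsModel μ p a b σ2 ρ X ε) (r : Fin (p + 1)) :
    IsRegressor (treeFiltration X h.meas) (reg X p r) where
  zero := by rw [reg, if_pos (by positivity)]
  meas k j hj := by
    rw [reg]
    split_ifs with hjp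
    · exact stronglyMeasurable_zero
    · refine Fin.cases ?_ (fun i => ?_) r
      · exact stronglyMeasurable_const
      · refine stronglyMeasurable_of_mem_Ico (one_le_div_two_pow (not_lt.1 hjp) i)
          ((Nat.div_le_self _ _).trans_lt ?_)
        simp only [gen, Finset.mem_Ico, pow_succ] at hj
        omega

lemma IsModel.reg_memLp (h : IsModel μ p a b σ2 ρ X ε) (r : Fin (p + 1)) (j : ℕ) :
    MemLp (reg X p r j) 4 μ := by
  rw [reg]
  split_ifs with hjp
  · exact MemLp.zero
  · refine Fin.cases ?_ (fun i => ?_) r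
    · exact memLp_const _
    · exact h.memLp_four (one_le_div_two_pow (not_lt.1 hjp) i)

lemma IsModel.ae_tendsto_noise (h : IsModel μ p a b σ2 ρ X ε) (c : Fin 2) :
    ∀ᵐ ω ∂μ, Tendsto (genAvg fun j => noise ε p c j ω) atTop (𝓝 0) := by
  have hn := h.isNoise c
  refine IsMDiff.ae_tendsto_gen_average (C := σ2)
    ⟨hn.adapted, fun j => (hn.memLp j).mono_exponent (by norm_num), hn.mean⟩ fun j _ => ?_
  rw [hn.integral_sq]
  exact hn.var_le j

lemma IsModel.ae_tendsto_noise_mul (h : IsModel μ p a b σ2 ρ X ε) (c : Fin 2) (i : Fin p) :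
    ∀ᵐ ω ∂μ, Tendsto (genAvg fun j => reg X p i.succ j ω * noise ε p c j ω) atTop (𝓝 0) := by
  have hn := h.isNoise c
  obtain ⟨B, hB⟩ := h.exists_second_moment_le
  have hB0 : 0 ≤ B := (integral_nonneg fun ω => sq_nonneg _).trans (hB _ le_rfl i)
  have hσ := h.var.1
  refine (hn.isMDiff_mul (h.isRegressor i.succ).adapted (h.reg_memLp i.succ)).ae_tendsto_gen_average
    (C := σ2 * B) fun j _ => ?_
  rw [hn.integral_mul_sq j ((h.isRegressor i.succ).adapted j) (h.reg_memLp i.succ j)]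
  refine mul_le_mul (hn.var_le j) ?_ (integral_nonneg fun ω => sq_nonneg _) hσ.le
  rw [reg]
  split_ifs with hjp
  · simpa using hB0
  · exact hB j (not_lt.1 hjp) i

lemma eventually_noiseVar (σ2 : ℝ) (p : ℕ) : ∀ n, p - 1 ≤ n → ∀ j ∈ gen n, noiseVar σ2 p j = σ2 :=
  fun n hn j hj => by
    rw [noiseVar, if_neg (not_lt.2 (two_pow_le_of_mem_gen_le hn hj))]

/-- The conditional fourth moments are bounded only almost surely, by a random constant: the law of
large numbers is applied to the truncations at all integer levels. -/
lemma IsModel.ae_tendsto_noise_sq (h : IsModel μ p a b σ2 ρ X ε) (c : Fin 2) :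
    ∀ᵐ ω ∂μ, Tendsto (genAvg fun j => noise ε p c j ω ^ 2) atTop (𝓝 σ2) := by
  have hn := h.isNoise c
  have hall := ae_all_iff.2 fun C : ℕ =>
    (hn.isMDiff_sq (g := fun _ _ => 1) (K := fun _ => 1) C (fun j => stronglyMeasurable_const)
      (fun j ω => by simp)).ae_tendsto_gen_average (C := C) fun j _ =>
        (hn.integral_sq_le (g := fun _ _ => 1) (K := fun _ => 1) (fun j => stronglyMeasurable_const)
          (fun j ω => by simp) (Nat.cast_nonneg C) j).trans (by simp)
  filter_upwards [hall, hn.fourth] with ω h1 ⟨C₀, hC₀⟩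
  obtain ⟨C, hC⟩ := exists_nat_ge C₀
  have eI : ∀ j, fourthInd μ (treeFiltration X h.meas) (noise ε p c) C j ω = 1 := fun j => by
    rw [fourthInd]; exact Set.indicator_of_mem (by exact (hC₀ j).trans hC) _
  have h2 := h1 C
  simp only [eI, mul_one, one_mul] at h2
  have h3 := h2.add_const σ2
  rw [zero_add] at h3
  refine h3.congr' ?_
  filter_upwards [eventually_ge_atTop (p - 1)] with n hn
  rw [Finset.sum_congr rfl fun j hj => by rw [eventually_noiseVar σ2 p n hn j hj],
    Finset.sum_sub_distrib, mul_sub]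
  have := genAvg_const σ2 n
  simp only [genAvg, smul_eq_mul] at this ⊢
  rw [this]; ring

end LawOfLargeNumbers

/-! ### The limiting matrix -/

section Limit

variable {p : ℕ} {N : Seminorm ℝ (Fin p → ℝ)} {β K : ℝ} {a b : Fin (p + 1) → ℝ} {σ2 : ℝ}

lemma limMean_eq (h : IsContraction N (compMat a b) β K) :
    limMean a b = (1 / 2 : ℝ) • ∑ c, (compMat a b c *ᵥ limMean a b + coeff a b c 0 • e₁ p) := by
  have hdet := h.isUnit_det
  have hsum : ∑ c, compMat a b c = companion a + companion b := by
    rw [Fin.sum_univ_two]; simp [compMat, coeff]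
  rw [hsum] at hdet
  have h1 : (1 - (1 / 2 : ℝ) • (companion a + companion b)) *ᵥ limMean a b
      = ((a 0 + b 0) / 2) • e₁ p := by
    rw [limMean, Matrix.mulVec_smul, Matrix.mulVec_mulVec, Matrix.mul_nonsing_inv _ hdet,
      Matrix.one_mulVec]
  rw [Matrix.sub_mulVec, Matrix.one_mulVec, sub_eq_iff_eq_add, Matrix.smul_mulVec,
    Matrix.add_mulVec] at h1
  conv_lhs => rw [h1]
  rw [Fin.sum_univ_two]
  simp only [compMat, coeff, if_true, Fin.isValue, one_ne_zero, if_false]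
  module

lemma limSource_eq (a b : Fin (p + 1) → ℝ) (σ2 : ℝ) : limSource a b σ2 = (1 / 2 : ℝ) • ∑ c,
    (coeff a b c 0 • symMap (compMat a b c) (e₁ p) (limMean a b)
      + (coeff a b c 0 ^ 2 + σ2) • Matrix.vecMulVec (e₁ p) (e₁ p)) := by
  rw [Fin.sum_univ_two, limSource]
  simp only [symMap, compMat, coeff, if_true, Fin.isValue, one_ne_zero, if_false,
    LinearMap.coe_mk, AddHom.coe_mk]
  module

lemma limEquation_iff (M : Matrix (Fin p) (Fin p) ℝ) : LimEquation a b σ2 M ↔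
    M = limSource a b σ2 + (1 / 2 : ℝ) • ∑ c, conj (compMat a b c) M := by
  rw [Fin.sum_univ_two, LimEquation]
  simp [compMat, coeff, conj]

lemma limEquation_iff' (M : Matrix (Fin p) (Fin p) ℝ) : LimEquation a b σ2 M ↔
    M = (1 / 2 : ℝ) • ∑ c, (conj (compMat a b c) M
      + coeff a b c 0 • symMap (compMat a b c) (e₁ p) (limMean a b)
      + (coeff a b c 0 ^ 2 + σ2) • Matrix.vecMulVec (e₁ p) (e₁ p)) := by
  rw [limEquation_iff, limSource_eq, ← smul_add, ← Finset.sum_add_distrib,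
    Finset.sum_congr rfl fun c _ => add_comm _ _]
  simp_rw [← add_assoc]

/-- The quadratic form of the limiting matrix. -/
def limForm (l : Fin p → ℝ) (M : Matrix (Fin p) (Fin p) ℝ) (t : ℝ) (x : Fin p → ℝ) : ℝ :=
  t ^ 2 + 2 * t * (l ⬝ᵥ x) + x ⬝ᵥ (M *ᵥ x)

lemma limMatrix_dotProduct (M : Matrix (Fin p) (Fin p) ℝ) (v : Fin (p + 1) → ℝ) :
    v ⬝ᵥ (limMatrix a b M *ᵥ v) = limForm (limMean a b) M (v 0) (fun i => v i.succ) := by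
  simp only [limForm, Matrix.mulVec, dotProduct, limMatrix, Matrix.of_apply, Fin.sum_univ_succ,
    Matrix.cons_val_zero, Matrix.cons_val_succ, mul_add, Finset.sum_add_distrib, one_mul]
  have h1 : ∑ i : Fin p, v i.succ * (limMean a b i * v 0)
      = v 0 * ∑ i, limMean a b i * v i.succ := by
    rw [Finset.mul_sum]; exact Finset.sum_congr rfl fun i _ => by ring
  rw [h1]; ring

lemma dotProduct_conj (A M : Matrix (Fin p) (Fin p) ℝ) (x : Fin p → ℝ) :
    x ⬝ᵥ (conj A M *ᵥ x) = (Aᵀ *ᵥ x) ⬝ᵥ (M *ᵥ (Aᵀ *ᵥ x)) := by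
  change x ⬝ᵥ ((A * M * Aᵀ) *ᵥ x) = _
  rw [← Matrix.mulVec_mulVec, ← Matrix.mulVec_mulVec, Matrix.dotProduct_mulVec,
    Matrix.mulVec_transpose A x]

lemma dotProduct_symMap (A : Matrix (Fin p) (Fin p) ℝ) (u l x : Fin p → ℝ) :
    x ⬝ᵥ (symMap A u l *ᵥ x) = 2 * (l ⬝ᵥ (Aᵀ *ᵥ x)) * (u ⬝ᵥ x) := by
  have h1 : l ⬝ᵥ (Aᵀ *ᵥ x) = x ⬝ᵥ (A *ᵥ l) := by
    rw [Matrix.mulVec_transpose, Matrix.dotProduct_mulVec, dotProduct_comm]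
  change x ⬝ᵥ ((Matrix.vecMulVec (A *ᵥ l) u + Matrix.vecMulVec u (A *ᵥ l)) *ᵥ x) = _
  rw [Matrix.add_mulVec, Matrix.vecMulVec_mulVec, Matrix.vecMulVec_mulVec, dotProduct_add, h1]
  simp only [op_smul_eq_smul, dotProduct_smul, smul_eq_mul]
  rw [dotProduct_comm x u, dotProduct_comm (A *ᵥ l) x]
  ring

/-- The quadratic form of the limiting matrix reproduces itself along the two types of offspring,
up to the contribution of the noise. -/
lemma limForm_eq (h : IsContraction N (compMat a b) β K) {M : Matrix (Fin p) (Fin p) ℝ}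
    (hM : LimEquation a b σ2 M) (t : ℝ) (x : Fin p → ℝ) :
    limForm (limMean a b) M t x = σ2 * (e₁ p ⬝ᵥ x) ^ 2 + 1 / 2 * ∑ c,
      limForm (limMean a b) M (t + coeff a b c 0 * (e₁ p ⬝ᵥ x)) ((compMat a b c)ᵀ *ᵥ x) := by
  have hl : limMean a b ⬝ᵥ x = 1 / 2 * ∑ c, (limMean a b ⬝ᵥ ((compMat a b c)ᵀ *ᵥ x)
      + coeff a b c 0 * (e₁ p ⬝ᵥ x)) := by
    conv_lhs => rw [limMean_eq h]
    rw [smul_dotProduct, sum_dotProduct, smul_eq_mul]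
    congr 1
    refine Finset.sum_congr rfl fun c _ => ?_
    rw [add_dotProduct, smul_dotProduct, smul_eq_mul, Matrix.mulVec_transpose, dotProduct_comm,
      Matrix.dotProduct_mulVec, dotProduct_comm (limMean a b)]
  have hq : x ⬝ᵥ (M *ᵥ x) = 1 / 2 * ∑ c,
      (((compMat a b c)ᵀ *ᵥ x) ⬝ᵥ (M *ᵥ ((compMat a b c)ᵀ *ᵥ x))
        + coeff a b c 0 * (2 * (limMean a b ⬝ᵥ ((compMat a b c)ᵀ *ᵥ x)) * (e₁ p ⬝ᵥ x))
        + (coeff a b c 0 ^ 2 + σ2) * (e₁ p ⬝ᵥ x) ^ 2) := by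
    conv_lhs => rw [(limEquation_iff' M).1 hM]
    rw [Matrix.smul_mulVec, dotProduct_smul, Matrix.sum_mulVec, dotProduct_sum, smul_eq_mul]
    congr 1
    refine Finset.sum_congr rfl fun c _ => ?_
    rw [Matrix.add_mulVec, Matrix.add_mulVec, dotProduct_add, dotProduct_add, dotProduct_conj,
      Matrix.smul_mulVec, dotProduct_smul, dotProduct_symMap, Matrix.smul_mulVec, dotProduct_smul,
      Matrix.vecMulVec_mulVec, smul_eq_mul, smul_eq_mul, op_smul_eq_smul, dotProduct_smul,
      smul_eq_mul, dotProduct_comm x (e₁ p)]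
    ring
  simp only [limForm]
  rw [hl, hq, Fin.sum_univ_two, Fin.sum_univ_two, Fin.sum_univ_two]
  ring

lemma e₁_dotProduct (hp : 0 < p) (x : Fin p → ℝ) : e₁ p ⬝ᵥ x = x ⟨0, hp⟩ := by
  rw [dotProduct, Finset.sum_eq_single (⟨0, hp⟩ : Fin p)]
  · simp [e₁]
  · intro i _ hi
    have : (i : ℕ) ≠ 0 := fun h => hi (Fin.ext h)
    simp [e₁, this]
  · simp

/-- On vectors with vanishing first coordinate the transposed companion matrix is the shift. -/
lemma companion_transpose_mulVec (c : Fin (p + 1) → ℝ) {x : Fin p → ℝ} {k : ℕ} (hk : k + 1 < p)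
    (hx : x ⟨0, by omega⟩ = 0) : ((companion c)ᵀ *ᵥ x) ⟨k, by omega⟩ = x ⟨k + 1, hk⟩ := by
  rw [Matrix.mulVec, dotProduct, Finset.sum_eq_single (⟨k + 1, hk⟩ : Fin p)]
  · simp [companion]
  · intro i _ hi
    rcases Nat.eq_zero_or_pos i with h0 | h0
    · have : i = ⟨0, by omega⟩ := Fin.ext h0
      rw [this, hx, mul_zero]
    · have : (i : ℕ) ≠ k + 1 := fun h => hi (Fin.ext h)
      simp [companion, h0.ne', this]
  · simp

/-- If the form of the limiting matrix is nonnegative, it is definite: at a zero `(t, x)` the first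
coordinate of `x` vanishes, and the shifted vector is a zero again. -/
lemma limForm_eq_zero (hp : 0 < p) (h : IsContraction N (compMat a b) β K) (hσ : 0 < σ2)
    {M : Matrix (Fin p) (Fin p) ℝ} (hM : LimEquation a b σ2 M)
    (hnn : ∀ t x, 0 ≤ limForm (limMean a b) M t x) {t : ℝ} {x : Fin p → ℝ}
    (h0 : limForm (limMean a b) M t x = 0) : t = 0 ∧ x = 0 := by
  have hstep : ∀ x, limForm (limMean a b) M t x = 0 → x ⟨0, hp⟩ = 0 ∧
      limForm (limMean a b) M t ((companion a)ᵀ *ᵥ x) = 0 := by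
    intro x hx
    have h1 := limForm_eq h hM t x
    rw [hx, Fin.sum_univ_two, e₁_dotProduct hp] at h1
    have h2 := hnn (t + coeff a b 0 0 * x ⟨0, hp⟩) ((compMat a b 0)ᵀ *ᵥ x)
    have h3 := hnn (t + coeff a b 1 0 * x ⟨0, hp⟩) ((compMat a b 1)ᵀ *ᵥ x)
    have h4 := mul_nonneg hσ.le (sq_nonneg (x ⟨0, hp⟩))
    have h5 : σ2 * x ⟨0, hp⟩ ^ 2 = 0 := by linarith
    have h6 : x ⟨0, hp⟩ = 0 := by
      rcases mul_eq_zero.1 h5 with h | h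
      · exact absurd h hσ.ne'
      · exact pow_eq_zero_iff (two_ne_zero) |>.1 h
    refine ⟨h6, ?_⟩
    rw [h6, mul_zero, add_zero] at h1 h2 h3
    have h7 : limForm (limMean a b) M t ((compMat a b 0)ᵀ *ᵥ x) = 0 := by
      rw [mul_zero, add_zero] at h1
      simp only [ne_eq, OfNat.ofNat_ne_zero, not_false_eq_true, zero_pow, mul_zero, zero_add] at h1
      linarith
    simpa [compMat, coeff] using h7
  have hall : ∀ k (hk : k < p) x, limForm (limMean a b) M t x = 0 → x ⟨k, hk⟩ = 0 := by
    intro k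
    induction k with
    | zero => exact fun hk x hx => (hstep x hx).1
    | succ k ih =>
      intro hk x hx
      rw [← companion_transpose_mulVec a hk (hstep x hx).1]
      exact ih (by omega) _ (hstep x hx).2
  have hx : x = 0 := by
    ext i
    exact hall i i.2 x h0
  refine ⟨?_, hx⟩
  rw [hx] at h0
  simpa [limForm] using h0

end Limit

/-! ### Convergence of the Gram matrices -/

section Gram

variable {Ω : Type*} [mΩ : MeasurableSpace Ω] {μ : Measure Ω} [IsProbabilityMeasure μ]
  {p : ℕ} {a b : Fin (p + 1) → ℝ} {σ2 ρ : ℝ} {X ε : ℕ → Ω → ℝ}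

lemma genAvg_apply {ι : Type*} (f : ℕ → ι → ℝ) (n : ℕ) (i : ι) :
    genAvg f n i = genAvg (fun j => f j i) n :=
  (genAvg_map (LinearMap.proj (R := ℝ) (φ := fun _ : ι => ℝ) i) f n).symm

lemma genAvg_eq (f : ℕ → ℝ) (n : ℕ) : genAvg f n = (2 ^ n : ℝ)⁻¹ * ∑ j ∈ gen n, f j := rfl

/-- The averages of `Y Yᵗ` over the generations converge to the limiting matrix. -/
lemma IsModel.ae_tendsto_gram (h : IsModel μ p a b σ2 ρ X ε) {M : Matrix (Fin p) (Fin p) ℝ}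
    (hM : LimEquation a b σ2 M) : ∀ᵐ ω ∂μ, ∀ r s : Fin (p + 1),
      Tendsto (fun k => (2 ^ k : ℝ)⁻¹ * ∑ j ∈ gen k, reg X p r j ω * reg X p s j ω) atTop
        (𝓝 (limMatrix a b M r s)) := by
  obtain ⟨N, β, K, hN⟩ := h.exists_isContraction
  filter_upwards [ae_all_iff.2 h.ae_tendsto_noise, ae_all_iff.2 h.ae_tendsto_noise_sq,
    ae_all_iff.2 fun c => ae_all_iff.2 fun i => h.ae_tendsto_noise_mul c i] with ω h1 h2 h3
  have hex : ∀ c, Tendsto (genAvg fun j => noise ε p c j ω • state X p j ω) atTop (𝓝 0) := by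
    intro c
    refine tendsto_pi_nhds.2 fun i => (h3 c i).congr fun n => ?_
    rw [genAvg_apply]
    refine genAvg_congr fun j _ => ?_
    rw [Pi.smul_apply, smul_eq_mul, mul_comm]
    rcases lt_or_ge j (2 ^ (p - 1)) with hj | hj
    · rw [noise, if_pos hj]; simp
    · rw [reg_of_le hj, regressor_succ]
  obtain ⟨t1, t2⟩ := hN.tendsto_genAvg (n₀ := p - 1) (fun j hj c => h.state_recursion hj c ω)
    (limMean_eq hN) ((limEquation_iff' M).1 hM) h1 hex h2
  have hev : ∀ r s : Fin (p + 1), ∀ᶠ n in atTop,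
      genAvg (fun j => regressor X p j ω r * regressor X p j ω s) n
        = (2 ^ n : ℝ)⁻¹ * ∑ j ∈ gen n, reg X p r j ω * reg X p s j ω := fun r s => by
    filter_upwards [eventually_ge_atTop (p - 1)] with n hn
    rw [genAvg_eq]
    congr 1
    refine Finset.sum_congr rfl fun j hj => ?_
    rw [reg_of_le (two_pow_le_of_mem_gen_le hn hj), reg_of_le (two_pow_le_of_mem_gen_le hn hj)]
  intro r s
  refine Tendsto.congr' (hev r s) ?_
  refine Fin.cases ?_ (fun i => ?_) r
  · refine Fin.cases ?_ (fun j => ?_) s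
    · refine tendsto_const_nhds.congr fun n => ?_
      exact ((genAvg_congr fun j _ => one_mul (1 : ℝ)).trans (genAvg_const (1 : ℝ) n)).symm
    · refine ((tendsto_pi_nhds.1 t1) j).congr fun n => ?_
      rw [genAvg_apply]
      exact genAvg_congr fun k _ => (one_mul _).symm
  · refine Fin.cases ?_ (fun j => ?_) s
    · refine ((tendsto_pi_nhds.1 t1) i).congr fun n => ?_
      rw [genAvg_apply]
      exact genAvg_congr fun k _ => (mul_one _).symm
    · refine ((tendsto_pi_nhds.1 ((tendsto_pi_nhds.1 t2) i)) j).congr fun n => ?_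
      exact (genAvg_map (Matrix.entryLinearMap ℝ ℝ i j)
        (fun k => Matrix.vecMulVec (state X p k ω) (state X p k ω)) n).symm

/-- As a limit of Gram matrices the limiting matrix is positive semidefinite; definiteness is
`limForm_eq_zero`. -/
lemma IsModel.limMatrix_posDef (h : IsModel μ p a b σ2 ρ X ε) {M : Matrix (Fin p) (Fin p) ℝ}
    (hM : LimEquation a b σ2 M) : (limMatrix a b M).PosDef := by
  obtain ⟨N, β, K, hN⟩ := h.exists_isContraction
  obtain ⟨ω, hω⟩ := (h.ae_tendsto_gram hM).exists
  have hsymm : ∀ r s, limMatrix a b M s r = limMatrix a b M r s := fun r s =>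
    tendsto_nhds_unique (hω s r) ((hω r s).congr fun n => by simp_rw [mul_comm])
  have hnn : ∀ v : Fin (p + 1) → ℝ, 0 ≤ v ⬝ᵥ (limMatrix a b M *ᵥ v) := by
    intro v
    have h1 := tendsto_finsetSum Finset.univ fun r _ =>
      (tendsto_finsetSum Finset.univ fun s _ => (hω r s).mul_const (v s)).const_mul (v r)
    refine ge_of_tendsto' h1 fun n => ?_
    have h2 : ∑ r, v r * ∑ s, (2 ^ n : ℝ)⁻¹ * (∑ j ∈ gen n, reg X p r j ω * reg X p s j ω) * v s
        = (2 ^ n : ℝ)⁻¹ * ∑ j ∈ gen n, (∑ r, v r * reg X p r j ω) ^ 2 := by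
      have h3 : ∑ j ∈ gen n, (∑ r, v r * reg X p r j ω) ^ 2
          = ∑ r, ∑ s, v r * v s * ∑ j ∈ gen n, reg X p r j ω * reg X p s j ω := by
        simp_rw [sq, Finset.sum_mul_sum]
        rw [Finset.sum_comm]
        refine Finset.sum_congr rfl fun r _ => ?_
        rw [Finset.sum_comm]
        refine Finset.sum_congr rfl fun s _ => ?_
        rw [Finset.mul_sum]
        exact Finset.sum_congr rfl fun j _ => by ring
      rw [h3, Finset.mul_sum]
      refine Finset.sum_congr rfl fun r _ => ?_
      rw [Finset.mul_sum, Finset.mul_sum]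
      exact Finset.sum_congr rfl fun s _ => by ring
    rw [h2]
    positivity
  refine Matrix.PosDef.of_dotProduct_mulVec_pos ?_ fun v hv => ?_
  · ext r s
    simpa using hsymm r s
  · rw [star_trivial]
    refine lt_of_le_of_ne (hnn v) fun h0 => hv ?_
    rw [limMatrix_dotProduct] at h0
    obtain ⟨h1, h2⟩ := limForm_eq_zero h.one_le hN h.var.1 hM (fun t x => by
      have := hnn (Matrix.vecCons t x)
      rwa [limMatrix_dotProduct] at this) h0.symm
    ext r
    refine Fin.cases h1 (fun i => congrFun h2 i) r

end Gram

/-! ### From the martingale to the estimator -/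

section Estimator

lemma tendsto_cesaro_congr {f g : ℕ → ℝ} {l : ℝ} (hfg : ∀ᶠ k in atTop, f k = g k)
    (hf : Tendsto (fun n : ℕ => (n : ℝ)⁻¹ * ∑ k ∈ Finset.range n, f k) atTop (𝓝 l)) :
    Tendsto (fun n : ℕ => (n : ℝ)⁻¹ * ∑ k ∈ Finset.range n, g k) atTop (𝓝 l) := by
  have h1 : Tendsto (fun k => g k - f k) atTop (𝓝 0) :=
    tendsto_const_nhds.congr' (hfg.mono fun k hk => by simp only [hk, sub_self])
  have h2 := hf.add h1.cesaro
  rw [add_zero] at h2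
  refine h2.congr fun n => ?_
  rw [← mul_add, ← Finset.sum_add_distrib]
  congr 1
  exact Finset.sum_congr rfl fun k _ => by ring

lemma tendsto_cesaro_Icc {f : ℕ → ℝ} {l : ℝ}
    (hf : Tendsto (fun n : ℕ => (n : ℝ)⁻¹ * ∑ k ∈ Finset.range n, f k) atTop (𝓝 l)) :
    Tendsto (fun n : ℕ => (1 / (n : ℝ)) * ∑ k ∈ Finset.Icc 1 n, f k) atTop (𝓝 l) := by
  have h1 := (hf.add (tendsto_div_of_cesaro hf)).sub
    ((tendsto_inv_atTop_nhds_zero_nat (𝕜 := ℝ)).mul_const (f 0))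
  rw [zero_mul, add_zero, sub_zero] at h1
  refine h1.congr fun n => ?_
  have h2 : ∑ k ∈ Finset.range (n + 1), f k = f 0 + ∑ k ∈ Finset.Icc 1 n, f k := by
    rw [Finset.range_eq_Ico, Finset.sum_eq_sum_Ico_succ_bot (Nat.succ_pos n)]
    rfl
  rw [Finset.sum_range_succ] at h2
  rw [one_div, ← mul_add, h2]
  ring

lemma tendsto_matrix_inv {ι : Type*} [Fintype ι] [DecidableEq ι] {S : ℕ → Matrix ι ι ℝ}
    {L : Matrix ι ι ℝ} (hS : Tendsto S atTop (𝓝 L)) (hL : IsUnit L.det) :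
    Tendsto (fun n => (S n)⁻¹) atTop (𝓝 L⁻¹) := by
  have h1 : Tendsto (fun n => (S n).det) atTop (𝓝 L.det) :=
    ((continuous_id.matrix_det).tendsto L).comp hS
  have h2 : Tendsto (fun n => (S n).adjugate) atTop (𝓝 L.adjugate) :=
    ((continuous_id.matrix_adjugate).tendsto L).comp hS
  simp only [Matrix.inv_def, Ring.inverse_eq_inv']
  exact (h1.inv₀ hL.ne_zero).smul h2

variable {ι : Type*} [Fintype ι] [DecidableEq ι]

/-- The quadratic form of the estimation error in terms of the martingale. -/
lemma trace_error_eq {S G : Matrix ι ι ℝ} {E m : Matrix ι (Fin 2) ℝ} {q : ℝ}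
    (hS : IsUnit S.det) (hE : S * E = q⁻¹ • m) :
    (Eᵀ * (G * E)).trace
      = q⁻¹ * ∑ c, ∑ r, ∑ s, ((S⁻¹)ᵀ * G * S⁻¹) r s * (q⁻¹ * (m r c * m s c)) := by
  have hE' : E = q⁻¹ • (S⁻¹ * m) := by
    rw [← Matrix.mul_smul, ← hE, ← Matrix.mul_assoc, Matrix.nonsing_inv_mul _ hS, Matrix.one_mul]
  have h1 : Eᵀ * (G * E) = (q⁻¹ * q⁻¹) • (mᵀ * ((S⁻¹)ᵀ * G * S⁻¹) * m) := by
    rw [hE']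
    simp only [Matrix.transpose_smul, Matrix.transpose_mul, Matrix.smul_mul, Matrix.mul_smul,
      smul_smul, Matrix.mul_assoc]
  rw [h1, Matrix.trace_smul, smul_eq_mul, Matrix.trace, mul_assoc, Finset.mul_sum]
  congr 1
  refine Finset.sum_congr rfl fun c _ => ?_
  rw [Matrix.diag_apply, Matrix.mul_apply, Finset.mul_sum]
  simp only [Matrix.mul_apply (M := mᵀ), Matrix.transpose_apply, Finset.sum_mul]
  rw [Finset.sum_comm' (t' := Finset.univ) (s' := fun _ => Finset.univ) (by simp)]
  simp only [Finset.mul_sum]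
  refine Finset.sum_congr rfl fun r _ => Finset.sum_congr rfl fun s _ => ?_
  ring

/-- The rate of convergence and the quadratic strong law for the estimation error `E`, given the
quadratic strong law for the entries of the martingale `m`. The error is only constrained where
`S n` is invertible, which holds eventually. -/
lemma error_limits {S : ℕ → Matrix ι ι ℝ} {L : Matrix ι ι ℝ} {E m : ℕ → Matrix ι (Fin 2) ℝ}
    {σ2 : ℝ} (hL : IsUnit L.det) (hS : Tendsto S atTop (𝓝 L))
    (hm : ∀ c r s, Tendsto (fun n : ℕ => (n : ℝ)⁻¹ * ∑ k ∈ Finset.range n,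
      (2 ^ k : ℝ)⁻¹ * (m k r c * m k s c)) atTop (𝓝 (σ2 * L r s)))
    (hE : ∀ᶠ n in atTop, IsUnit (S n).det → S n * E n = (2 ^ n : ℝ)⁻¹ • m n) :
    Tendsto (fun n : ℕ => (n : ℝ)⁻¹ * (2 ^ n * ((E n)ᵀ * E n).trace)) atTop (𝓝 0) ∧
    Tendsto (fun n : ℕ => (n : ℝ)⁻¹ * ∑ k ∈ Finset.range n,
      (2 ^ k - 1) * ((E k)ᵀ * (L * E k)).trace) atTop (𝓝 (2 * Fintype.card ι * σ2)) := by
  have hinv := tendsto_matrix_inv hS hL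
  have hunit : ∀ᶠ n in atTop, IsUnit (S n).det := by
    have h1 : Tendsto (fun n => (S n).det) atTop (𝓝 L.det) :=
      ((continuous_id.matrix_det).tendsto L).comp hS
    exact (h1.eventually_ne hL.ne_zero).mono fun n hn => isUnit_iff_ne_zero.2 hn
  have hform : ∀ G : Matrix ι ι ℝ, ∀ᶠ n in atTop, ((E n)ᵀ * (G * E n)).trace
      = (2 ^ n : ℝ)⁻¹ * ∑ c, ∑ r, ∑ s, (((S n)⁻¹)ᵀ * G * (S n)⁻¹) r s
        * ((2 ^ n : ℝ)⁻¹ * (m n r c * m n s c)) := fun G => by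
    filter_upwards [hunit, hE] with n h1 h2
    exact trace_error_eq h1 (h2 h1)
  have hW : ∀ (G : Matrix ι ι ℝ) r s, Tendsto (fun n => (((S n)⁻¹)ᵀ * G * (S n)⁻¹) r s) atTop
      (𝓝 (((L⁻¹)ᵀ * G * L⁻¹) r s)) := fun G r s => by
    have hc : Continuous fun W : Matrix ι ι ℝ => (Wᵀ * G * W) r s :=
      ((continuous_id.matrix_transpose.matrix_mul continuous_const).matrix_mul
        continuous_id).matrix_elem r s
    exact (hc.tendsto _).comp hinv
  constructor
  · have h1 : Tendsto (fun n : ℕ => ∑ c, ∑ r, ∑ s, (((S n)⁻¹)ᵀ * (1 : Matrix ι ι ℝ) * (S n)⁻¹) r s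
        * ((n : ℝ)⁻¹ * ((2 ^ n : ℝ)⁻¹ * (m n r c * m n s c)))) atTop (𝓝 0) := by
      have := tendsto_finsetSum Finset.univ fun c _ => tendsto_finsetSum Finset.univ fun r _ =>
        tendsto_finsetSum Finset.univ fun s _ =>
          (hW 1 r s).mul (tendsto_div_of_cesaro (hm c r s))
      simpa only [mul_zero, Finset.sum_const_zero] using this
    refine h1.congr' ?_
    filter_upwards [hform 1] with n hn
    rw [Matrix.one_mul] at hn
    rw [hn, mul_inv_cancel_left₀ (by positivity)]
    simp only [Finset.mul_sum]
    refine Finset.sum_congr rfl fun c _ => Finset.sum_congr rfl fun r _ =>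
      Finset.sum_congr rfl fun s _ => ?_
    ring
  · have hq : Tendsto (fun k : ℕ => (1 : ℝ) - (2 ^ k : ℝ)⁻¹) atTop (𝓝 1) := by
      have h2 : Tendsto (fun k : ℕ => (2 ^ k : ℝ)⁻¹) atTop (𝓝 0) := by
        have := tendsto_pow_atTop_nhds_zero_of_lt_one (r := (1 / 2 : ℝ)) (by norm_num) (by norm_num)
        refine this.congr fun k => ?_
        rw [one_div, inv_pow]
      simpa using h2.const_sub 1
    -- the diagonal entries dominate the absolute values of all entries
    have hbdd : ∀ c r, ∃ C, ∀ n : ℕ, (n : ℝ)⁻¹ * ∑ k ∈ Finset.range n,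
        (2 ^ k : ℝ)⁻¹ * (m k r c * m k r c) ≤ C := fun c r => by
      obtain ⟨C, hC⟩ := (hm c r r).bddAbove_range
      exact ⟨C, fun n => hC ⟨n, rfl⟩⟩
    have hterm : ∀ c r s, Tendsto (fun n : ℕ => (n : ℝ)⁻¹ * ∑ k ∈ Finset.range n,
        ((1 - (2 ^ k : ℝ)⁻¹) * (((S k)⁻¹)ᵀ * L * (S k)⁻¹) r s)
          * ((2 ^ k : ℝ)⁻¹ * (m k r c * m k s c))) atTop
        (𝓝 ((((L⁻¹)ᵀ * L * L⁻¹) r s) * (σ2 * L r s))) := fun c r s => by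
      obtain ⟨C1, hC1⟩ := hbdd c r
      obtain ⟨C2, hC2⟩ := hbdd c s
      have h1 := hq.mul (hW L r s)
      rw [one_mul] at h1
      refine tendsto_cesaro_mul (C := C1 + C2) h1 (hm c r s) fun n => ?_
      refine le_trans ?_ (add_le_add (hC1 n) (hC2 n))
      rw [← mul_add, ← Finset.sum_add_distrib]
      refine mul_le_mul_of_nonneg_left (Finset.sum_le_sum fun k _ => ?_) (by positivity)
      rw [abs_mul, abs_of_pos (by positivity : (0 : ℝ) < (2 ^ k)⁻¹), ← mul_add]
      refine mul_le_mul_of_nonneg_left ?_ (by positivity)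
      rw [abs_mul]
      nlinarith [sq_nonneg (|m k r c| - |m k s c|), abs_mul_abs_self (m k r c),
        abs_mul_abs_self (m k s c), mul_nonneg (abs_nonneg (m k r c)) (abs_nonneg (m k s c))]
    have hlim := tendsto_finsetSum (Finset.univ : Finset (Fin 2)) fun c _ =>
      tendsto_finsetSum Finset.univ fun r _ => tendsto_finsetSum Finset.univ fun s _ => hterm c r s
    -- `tr (L⁻¹ L L⁻¹ L)` is the dimension
    have hval : ∑ _c : Fin 2, ∑ r, ∑ s, (((L⁻¹)ᵀ * L * L⁻¹) r s) * (σ2 * L r s)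
        = 2 * Fintype.card ι * σ2 := by
      have h1 : (L⁻¹)ᵀ * L * L⁻¹ = (L⁻¹)ᵀ := by
        rw [Matrix.mul_assoc, Matrix.mul_nonsing_inv _ hL, Matrix.mul_one]
      have h2 : ∑ r, ∑ s, L⁻¹ s r * L r s = Fintype.card ι := by
        have h3 : (L * L⁻¹).trace = Fintype.card ι := by
          rw [Matrix.mul_nonsing_inv _ hL, Matrix.trace_one]
        rw [← h3, Matrix.trace]
        refine Finset.sum_congr rfl fun r _ => ?_
        rw [Matrix.diag_apply, Matrix.mul_apply]
        exact Finset.sum_congr rfl fun s _ => mul_comm _ _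
      rw [h1, Finset.sum_const, Finset.card_univ, Fintype.card_fin, ← h2]
      simp only [Matrix.transpose_apply, nsmul_eq_mul, Finset.mul_sum, Finset.sum_mul]
      refine Finset.sum_congr rfl fun r _ => Finset.sum_congr rfl fun s _ => ?_
      push_cast; ring
    rw [hval] at hlim
    refine tendsto_cesaro_congr (f := fun k => ∑ c, ∑ r, ∑ s,
      ((1 - (2 ^ k : ℝ)⁻¹) * (((S k)⁻¹)ᵀ * L * (S k)⁻¹) r s)
          * ((2 ^ k : ℝ)⁻¹ * (m k r c * m k s c))) ?_ (hlim.congr fun n => ?_)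
    · filter_upwards [hform L] with k hk
      rw [hk]
      simp only [Finset.mul_sum]
      refine Finset.sum_congr rfl fun c _ => Finset.sum_congr rfl fun r _ =>
        Finset.sum_congr rfl fun s _ => ?_
      have : (2 : ℝ) ^ k ≠ 0 := by positivity
      field_simp
    · symm
      rw [Finset.sum_comm, Finset.mul_sum]
      refine Finset.sum_congr rfl fun c _ => ?_
      rw [Finset.sum_comm, Finset.mul_sum]
      refine Finset.sum_congr rfl fun r _ => ?_
      rw [Finset.sum_comm, Finset.mul_sum]

end Estimator

/-! ### The normal equations -/

section NormalEquations

variable {Ω : Type*} [mΩ : MeasurableSpace Ω] {μ : Measure Ω} [IsProbabilityMeasure μ]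
  {p : ℕ} {a b : Fin (p + 1) → ℝ} {σ2 ρ : ℝ} {X ε : ℕ → Ω → ℝ}

lemma sum_treeFrom {E : Type*} [AddCommMonoid E] {n : ℕ} (hn : 1 ≤ n) (q : ℕ) (f : ℕ → E) :
    ∑ j ∈ treeFrom (n - 1) q, f j = ∑ j ∈ Finset.range (2 ^ n), if j < 2 ^ q then 0 else f j := by
  have h1 : treeFrom (n - 1) q = (Finset.range (2 ^ n)).filter fun j => ¬ j < 2 ^ q := by
    ext j
    have : 0 < 2 ^ q := by positivity
    simp only [treeFrom, tree, Finset.mem_filter, Finset.mem_Ico, Finset.mem_range,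
      Nat.sub_add_cancel hn]
    omega
  rw [h1, Finset.sum_filter]
  refine Finset.sum_congr rfl fun j _ => ?_
  split_ifs with h
  · rfl
  · rfl

lemma gram_apply {n : ℕ} (hn : 1 ≤ n) (ω : Ω) (r s : Fin (p + 1)) :
    gram X p (n - 1) ω r s = ∑ j ∈ Finset.range (2 ^ n), reg X p r j ω * reg X p s j ω := by
  rw [gram, Matrix.sum_apply, sum_treeFrom hn]
  refine Finset.sum_congr rfl fun j _ => ?_
  simp only [reg]
  split_ifs
  · simp
  · rfl

lemma eq_zero_of_quadratic_nonneg {x y : ℝ} (hy : 0 ≤ y) (h : ∀ t : ℝ, 0 ≤ t ^ 2 * y - 2 * t * x) :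
    x = 0 := by
  have h1 := h (x / (y + 1))
  have hy1 : 0 < y + 1 := by linarith
  have h2 : (x / (y + 1)) ^ 2 * y - 2 * (x / (y + 1)) * x = - (x ^ 2 * (y + 2) / (y + 1) ^ 2) := by
    field_simp
    ring
  rw [h2] at h1
  have h3 : x ^ 2 * (y + 2) / (y + 1) ^ 2 ≤ 0 := by linarith
  rw [div_le_iff₀ (by positivity), zero_mul] at h3
  have h4 : x ^ 2 ≤ 0 := by nlinarith [sq_nonneg x]
  exact pow_eq_zero_iff two_ne_zero |>.1 (le_antisymm h4 (sq_nonneg x))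

/-- The residuals of a minimizer of the least-squares criterion are orthogonal to the regressors. -/
lemma residual_orthogonal {n : ℕ} {ω : Ω} {η : Matrix (Fin (p + 1)) (Fin 2) ℝ}
    (hη : ∀ η', lsCriterion X p n ω η ≤ lsCriterion X p n ω η') (r : Fin (p + 1)) (c : Fin 2) :
    ∑ k ∈ treeFrom (n - 1) (p - 1),
      (response X k ω c - (ηᵀ *ᵥ regressor X p k ω) c) * regressor X p k ω r = 0 := by
  refine eq_zero_of_quadratic_nonneg
    (y := ∑ k ∈ treeFrom (n - 1) (p - 1), regressor X p k ω r ^ 2)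
    (Finset.sum_nonneg fun k _ => sq_nonneg _) fun t => ?_
  have h1 := hη (η + Matrix.single r c t)
  have h2 : ∀ k, ∑ j : Fin 2,
      (response X k ω j - ((η + Matrix.single r c t)ᵀ *ᵥ regressor X p k ω) j) ^ 2
      = ∑ j : Fin 2, (response X k ω j - (ηᵀ *ᵥ regressor X p k ω) j) ^ 2
        + (t ^ 2 * regressor X p k ω r ^ 2
          - 2 * t * ((response X k ω c - (ηᵀ *ᵥ regressor X p k ω) c) * regressor X p k ω r)) := by
    intro k
    have h3 : ∀ j, ((η + Matrix.single r c t)ᵀ *ᵥ regressor X p k ω) j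
        = (ηᵀ *ᵥ regressor X p k ω) j + if j = c then t * regressor X p k ω r else 0 := by
      intro j
      rw [Matrix.transpose_add, Matrix.add_mulVec, Pi.add_apply, Matrix.transpose_single,
        Matrix.single_mulVec]
      congr 1
      by_cases hj : j = c
      · subst hj; simp
      · simp [hj]
    simp only [h3]
    fin_cases c <;> simp [Fin.sum_univ_two] <;> ring
  simp only [lsCriterion, h2, Finset.sum_add_distrib, Finset.sum_sub_distrib, ← Finset.mul_sum] at h1
  linarith

lemma theta_apply (r : Fin (p + 1)) (c : Fin 2) : theta a b r c = coeff a b c r := by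
  fin_cases c
  · simp [theta, coeff]
  · simp [theta, coeff]

lemma IsModel.response_eq (h : IsModel μ p a b σ2 ρ X ε) {k : ℕ} (hk : 2 ^ (p - 1) ≤ k)
    (c : Fin 2) (ω : Ω) : response X k ω c
      = ((theta a b)ᵀ *ᵥ regressor X p k ω) c + noise ε p c k ω := by
  have h1 : response X k ω c = X (2 * k + c) ω := by
    fin_cases c <;> simp [response]
  rw [h1, h.recursion hk c ω, noise, if_neg (not_lt.2 hk), Matrix.mulVec, dotProduct,
    Fin.sum_univ_succ]
  simp only [Matrix.transpose_apply, theta_apply]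
  simp [regressor]

/-- The normal equations `S (θh - θ) = M`, where `M` is the martingale `∑ Y_k (ε_{2k}, ε_{2k+1})`. -/
lemma IsModel.gram_mul_error (h : IsModel μ p a b σ2 ρ X ε)
    {θh : ℕ → Ω → Matrix (Fin (p + 1)) (Fin 2) ℝ} (hθ : IsLSEstimator X p θh) {n : ℕ} (hn : p ≤ n)
    {ω : Ω} (hu : IsUnit (gram X p (n - 1) ω)) :
    gram X p (n - 1) ω * (θh n ω - theta a b)
      = Matrix.of fun r c => mart (reg X p r) (noise ε p c) (2 ^ n) ω := by
  have hn1 : 1 ≤ n := h.one_le.trans hn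
  ext r c
  have h1 := residual_orthogonal (hθ n hn ω hu) r c
  rw [sum_treeFrom hn1] at h1
  rw [Matrix.mul_apply, Matrix.of_apply, mart]
  simp only [gram_apply hn1, Finset.sum_mul]
  rw [Finset.sum_comm, ← sub_eq_zero, ← Finset.sum_sub_distrib]
  rw [← neg_eq_zero, ← Finset.sum_neg_distrib]
  rw [← h1]
  refine Finset.sum_congr rfl fun j _ => ?_
  split_ifs with hj
  · simp [reg, hj]
  · have hj' := not_lt.1 hj
    rw [h.response_eq hj' c ω]
    simp only [reg_of_le hj', Matrix.mulVec, dotProduct, Matrix.transpose_apply, Matrix.sub_apply,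
      mul_sub, Finset.sum_sub_distrib]
    have e1 : ∀ f : Fin (p + 1) → ℝ, ∑ x, regressor X p j ω r * regressor X p j ω x * f x
        = (∑ x, f x * regressor X p j ω x) * regressor X p j ω r := fun f => by
      rw [Finset.sum_mul]; exact Finset.sum_congr rfl fun x _ => by ring
    rw [e1, e1]
    ring

end NormalEquations

/-! ### Asymptotics of the least-squares estimator -/

lemma IsModel.existsUnique_limEquation {Ω : Type*} [MeasurableSpace Ω] {μ : Measure Ω}
    [IsProbabilityMeasure μ] {p : ℕ} {a b : Fin (p + 1) → ℝ} {σ2 ρ : ℝ} {X ε : ℕ → Ω → ℝ}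
    (h : IsModel μ p a b σ2 ρ X ε) :
    ∃! M : Matrix (Fin p) (Fin p) ℝ, LimEquation a b σ2 M := by
  obtain ⟨N, β, K, hN⟩ := h.exists_isContraction
  simpa only [limEquation_iff] using hN.existsUnique_matrix (limSource a b σ2)

/-- The rate `n / 2ⁿ` is `O(log |T_{n-1}| / |T_{n-1}|)`, where `|T_{n-1}| = 2ⁿ - 1`. -/
lemma isBigO_log_card_tree : (fun n : ℕ => (n : ℝ) * (2 ^ n : ℝ)⁻¹) =O[atTop]
    fun n => Real.log ((tree (n - 1)).card : ℝ) / ((tree (n - 1)).card : ℝ) := by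
  have hl2 : 0 < Real.log 2 := Real.log_pos (by norm_num)
  refine IsBigO.of_bound (2 / Real.log 2) ?_
  filter_upwards [eventually_ge_atTop 2] with n hn
  have hcard : ((tree (n - 1)).card : ℝ) = 2 ^ n - 1 := by
    rw [tree, Nat.card_Ico, Nat.sub_add_cancel (by omega), Nat.cast_sub Nat.one_le_two_pow]
    simp
  have h2 : (2 : ℝ) ^ n = 2 * 2 ^ (n - 1) := by
    rw [← pow_succ', Nat.sub_add_cancel (by omega)]
  have h3 : (1 : ℝ) ≤ 2 ^ (n - 1) := one_le_pow₀ (by norm_num)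
  have hlog : (n : ℝ) / 2 * Real.log 2 ≤ Real.log (2 ^ n - 1) := by
    have h4 : Real.log (2 ^ (n - 1)) ≤ Real.log (2 ^ n - 1) :=
      Real.log_le_log (by positivity) (by linarith)
    rw [Real.log_pow, Nat.cast_sub (by omega)] at h4
    have h5 : (2 : ℝ) ≤ n := by exact_mod_cast hn
    refine le_trans (mul_le_mul_of_nonneg_right ?_ hl2.le) h4
    push_cast; linarith
  have hpos : (0 : ℝ) < 2 ^ n - 1 := by linarith
  have hlog0 : 0 ≤ Real.log (2 ^ n - 1) := le_trans (by positivity) hlog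
  rw [hcard, Real.norm_of_nonneg (by positivity), Real.norm_of_nonneg (div_nonneg hlog0 hpos.le)]
  calc (n : ℝ) * (2 ^ n : ℝ)⁻¹ = 2 / Real.log 2 * ((n / 2 * Real.log 2) / 2 ^ n) := by
        field_simp
    _ ≤ 2 / Real.log 2 * (Real.log (2 ^ n - 1) / (2 ^ n - 1)) := by
        refine mul_le_mul_of_nonneg_left ?_ (by positivity)
        exact div_le_div₀ hlog0 hlog hpos (by linarith)

lemma norm_vec_sq {p : ℕ} (E : Matrix (Fin (p + 1)) (Fin 2) ℝ) :
    ‖WithLp.toLp 2 (Matrix.vec E)‖ ^ 2 = (Eᵀ * E).trace := by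
  rw [← Matrix.vec_dotProduct_vec, EuclideanSpace.norm_sq_eq, dotProduct]
  refine Finset.sum_congr rfl fun i _ => ?_
  rw [Real.norm_eq_abs, sq_abs, sq]

end BAR

theorem theorem5p2 {Ω : Type*} [MeasurableSpace Ω] (μ : Measure Ω) [IsProbabilityMeasure μ]
    (p : ℕ) (hp : 1 ≤ p) (a b : Fin (p + 1) → ℝ) (σ2 ρ : ℝ) (X ε : ℕ → Ω → ℝ)
    (hX : ∀ k, 1 ≤ k → Measurable (X k))
    (hinit : ∀ k, 1 ≤ k → k < 2 ^ p → MemLp (X k) 8 μ)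
    (hproc : BAR.IsProcess a b X ε)
    (hcontr : BAR.Contracting (BAR.companion a) (BAR.companion b))
    (hvar : BAR.NoiseVariance μ p X ε σ2)
    (hcov : BAR.NoiseCovariance μ p X ε σ2 ρ)
    (hfour : BAR.NoiseFourthMoment μ p X ε)
    (θh : ℕ → Ω → Matrix (Fin (p + 1)) (Fin 2) ℝ)
    (hθh : BAR.IsLSEstimator X p θh) :
    (∀ᵐ ω ∂μ, Tendsto (fun n => θh n ω) atTop (𝓝 (BAR.theta a b))) ∧
    (∀ᵐ ω ∂μ,
      (fun n => ‖WithLp.toLp 2 (Matrix.vec (θh n ω - BAR.theta a b))‖ ^ 2) =O[atTop]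
        (fun n => Real.log ((BAR.tree (n - 1)).card : ℝ) / ((BAR.tree (n - 1)).card : ℝ))) ∧
    ∃ M : Matrix (Fin p) (Fin p) ℝ,
      (BAR.LimEquation a b σ2 M ∧ ∀ M', BAR.LimEquation a b σ2 M' → M' = M) ∧
      (BAR.limMatrix a b M).PosDef ∧
      ∀ᵐ ω ∂μ,
        Tendsto
          (fun n : ℕ => (1 / (n : ℝ)) * ∑ k ∈ Finset.Icc 1 n,
            ((BAR.tree (k - 1)).card : ℝ) *
              (Matrix.vec (θh k ω - BAR.theta a b) ⬝ᵥ
                (((1 : Matrix (Fin 2) (Fin 2) ℝ) ⊗ₖ BAR.limMatrix a b M) *ᵥ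
                  Matrix.vec (θh k ω - BAR.theta a b))))
          atTop (𝓝 (2 * ((p : ℝ) + 1) * σ2)) := by
  have h : BAR.IsModel μ p a b σ2 ρ X ε := ⟨hp, hX, hinit, hproc, hcontr, hvar, hcov, hfour⟩
  obtain ⟨M, hM, huniq⟩ := h.existsUnique_limEquation
  have hL := h.limMatrix_posDef hM
  have hdet : IsUnit (BAR.limMatrix a b M).det := (Matrix.isUnit_iff_isUnit_det _).1 hL.isUnit
  have hgram := h.ae_tendsto_gram hM
  -- the sums of squares of each regressor over the generations are bounded
  have hbd : ∀ r, ∀ᵐ ω ∂μ, ∃ C, ∀ k, ∑ j ∈ BAR.gen k, BAR.reg X p r j ω ^ 2 ≤ C * 2 ^ k := by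
    intro r
    filter_upwards [hgram] with ω hω
    obtain ⟨C, hC⟩ := (hω r r).bddAbove_range
    refine ⟨C, fun k => ?_⟩
    have h1 := hC ⟨k, rfl⟩
    simp only [← sq] at h1
    rwa [inv_mul_le_iff₀ (by positivity), mul_comm] at h1
  -- the quadratic strong law for the entries of the martingale
  have hquad : ∀ᵐ ω ∂μ, ∀ (c : Fin 2) (r s : Fin (p + 1)), Tendsto (fun n : ℕ => (n : ℝ)⁻¹ *
      ∑ k ∈ Finset.range n, (2 ^ k : ℝ)⁻¹ * (BAR.mart (BAR.reg X p r) (BAR.noise ε p c) (2 ^ k) ω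
        * BAR.mart (BAR.reg X p s) (BAR.noise ε p c) (2 ^ k) ω)) atTop
      (𝓝 (σ2 * BAR.limMatrix a b M r s)) := by
    refine ae_all_iff.2 fun c => ae_all_iff.2 fun r => ae_all_iff.2 fun s => ?_
    refine (h.isNoise c).quadratic_law (h.isRegressor r) (h.isRegressor s) (hbd r) (hbd s) ?_
    filter_upwards [hgram] with ω hω
    refine ((hω r s).const_mul σ2).congr' ?_
    filter_upwards [eventually_ge_atTop (p - 1)] with n hn
    rw [mul_left_comm, Finset.mul_sum]
    congr 1
    refine Finset.sum_congr rfl fun j hj => ?_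
    rw [BAR.eventually_noiseVar σ2 p n hn j hj, mul_comm]
  have hmain : ∀ᵐ ω ∂μ,
      Tendsto (fun n : ℕ => (n : ℝ)⁻¹ * (2 ^ n * ((θh n ω - BAR.theta a b)ᵀ
        * (θh n ω - BAR.theta a b)).trace)) atTop (𝓝 0) ∧
      Tendsto (fun n : ℕ => (n : ℝ)⁻¹ * ∑ k ∈ Finset.range n,
        (2 ^ k - 1) * ((θh k ω - BAR.theta a b)ᵀ
          * (BAR.limMatrix a b M * (θh k ω - BAR.theta a b))).trace) atTop
        (𝓝 (2 * Fintype.card (Fin (p + 1)) * σ2)) := by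
    filter_upwards [hgram, hquad] with ω h1 h2
    refine BAR.error_limits (S := fun n => (2 ^ n : ℝ)⁻¹ • BAR.gram X p (n - 1) ω)
      (m := fun n => Matrix.of fun r c => BAR.mart (BAR.reg X p r) (BAR.noise ε p c) (2 ^ n) ω)
      hdet ?_ (fun c r s => h2 c r s) ?_
    · refine tendsto_pi_nhds.2 fun r => tendsto_pi_nhds.2 fun s => ?_
      refine (BAR.tendsto_tree_average 0 (h1 r s) (T := fun n =>
        ∑ j ∈ Finset.range (2 ^ n), BAR.reg X p r j ω * BAR.reg X p s j ω)
        fun n _ => BAR.sum_range_two_pow_succ _ n).congr' ?_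
      filter_upwards [eventually_ge_atTop 1] with n hn
      rw [Matrix.smul_apply, BAR.gram_apply hn, smul_eq_mul]
    · filter_upwards [eventually_ge_atTop p] with n hn hu
      have hu' : IsUnit (BAR.gram X p (n - 1) ω) := by
        rw [Matrix.isUnit_iff_isUnit_det]
        rw [Matrix.det_smul] at hu
        exact isUnit_of_mul_isUnit_right hu
      rw [Matrix.smul_mul, h.gram_mul_error hθh hn hu']
  -- the squared error is `o(n / 2ⁿ)`
  have hrate : ∀ᵐ ω ∂μ, (fun n : ℕ => ((θh n ω - BAR.theta a b)ᵀ
      * (θh n ω - BAR.theta a b)).trace) =O[atTop] fun n : ℕ => (n : ℝ) * (2 ^ n : ℝ)⁻¹ := by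
    filter_upwards [hmain] with ω ⟨h1, _⟩
    refine IsBigO.of_bound 1 ?_
    filter_upwards [h1.norm.eventually_le_const (show ‖(0 : ℝ)‖ < 1 by simp),
      eventually_gt_atTop 0] with n hn hn0
    have hn' : (0 : ℝ) < n := by exact_mod_cast hn0
    rw [norm_mul, norm_mul, norm_inv, inv_mul_le_iff₀ (norm_pos_iff.2 hn'.ne'), mul_one,
      norm_pow, Real.norm_two] at hn
    rw [one_mul, norm_mul, norm_inv, norm_pow, Real.norm_two, ← div_eq_mul_inv,
      le_div_iff₀ (by positivity), mul_comm]
    exact hn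
  refine ⟨?_, ?_, M, ⟨hM, fun M' hM' => huniq M' hM'⟩, hL, ?_⟩
  · filter_upwards [hrate] with ω hω
    have h0 : Tendsto (fun n : ℕ => (n : ℝ) * (2 ^ n : ℝ)⁻¹) atTop (𝓝 0) := by
      have := tendsto_self_mul_const_pow_of_lt_one (r := (1 / 2 : ℝ)) (by norm_num) (by norm_num)
      refine this.congr fun n => ?_
      rw [one_div, inv_pow]
    have h1 := hω.trans_tendsto h0
    refine tendsto_pi_nhds.2 fun r => tendsto_pi_nhds.2 fun c => ?_
    rw [tendsto_iff_norm_sub_tendsto_zero]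
    have h2 := (Real.continuous_sqrt.tendsto 0).comp h1
    rw [Real.sqrt_zero] at h2
    refine squeeze_zero (fun n => norm_nonneg _) (fun n => ?_) h2
    rw [Real.norm_eq_abs, Function.comp]
    refine Real.abs_le_sqrt ?_
    rw [← BAR.norm_vec_sq, EuclideanSpace.norm_sq_eq]
    have h3 := Finset.single_le_sum (f := fun i : Fin 2 × Fin (p + 1) =>
      ‖(WithLp.toLp 2 (Matrix.vec (θh n ω - BAR.theta a b))).ofLp i‖ ^ 2)
      (fun i _ => sq_nonneg _) (Finset.mem_univ (c, r))
    refine le_trans (le_of_eq ?_) h3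
    simp [Matrix.vec, Real.norm_eq_abs, sq_abs]
  · filter_upwards [hrate] with ω hω
    simp only [BAR.norm_vec_sq]
    exact hω.trans BAR.isBigO_log_card_tree
  · filter_upwards [hmain] with ω ⟨_, h2⟩
    have hc : (2 : ℝ) * Fintype.card (Fin (p + 1)) * σ2 = 2 * ((p : ℝ) + 1) * σ2 := by
      rw [Fintype.card_fin]; push_cast; ring
    rw [hc] at h2
    refine (BAR.tendsto_cesaro_Icc h2).congr fun n => ?_
    congr 1
    refine Finset.sum_congr rfl fun k hk => ?_
    have hk1 : 1 ≤ k := (Finset.mem_Icc.1 hk).1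
    rw [← Matrix.vec_mul_eq_mulVec, Matrix.vec_dotProduct_vec, BAR.tree, Nat.card_Ico,
      Nat.sub_add_cancel hk1, Nat.cast_sub Nat.one_le_two_pow]
    simp
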